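/- **Lemma 2.3 (Ranked rearrangements).** Let $\alpha\in(0,1)$ and let $\mathbf x$ be a non-negative random variable such that $c:=\lim_{t\to\infty}t^{\alpha}\,\mathbb P(\mathbf x\ge t)$ exists and $c\in(0,\infty)$. For each $n\ge 1$ let $X_{i,j}=X^{(n)}_{i,j}$, $i,j\in[n]=\{1,\dots,n\}$, be i.i.d. copies of $\mathbf x$, let $\rho_i=\sum_{j=1}^nX_{i,j}$ and $M_{i,j}=X_{i,j}/\rho_i$ (if $\rho_i=0$, then $M_{i,i}=1$ and $M_{i,j}=0$ for $j\ne i$). Let $\pi=\pi^n$ be a permutation of $[n]$, determined by the first column $(X_{j,1})_{j\in[n]}$, with $X_{\pi(1),1}\ge X_{\pi(2),1}\ge\dots\ge X_{\pi(n),1}$, where ties are broken by an arbitrary measurable rule (e.g. lexicographic order), and put $\hat M_{j,1}:=M_{\pi(j),1}$. Let $\xi_1\ge\xi_2\ge\cdots$ be the ranked points of a Poisson point process on $(0,\infty)$ with intensity $\alpha t^{-\alpha-1}\,dt$ (law PPP($\alpha$)), and let $(S_i)_{i\ge1}$ be a sequence, independent of $(\xi_i)_{i\ge 1}$, of i.i.d.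 one-sided $\alpha$-stable variables, that is, $S_i\ge0$ and $\mathbb E[e^{-\theta S_i}]=\exp(-\Gamma(1-\alpha)\theta^{\alpha})$ for all $\theta\ge0$. Define $$\hat\omega_i:=\frac{\xi_i}{\xi_i+S_i},\qquad \omega_i:=\frac{\xi_i}{\xi_i+q},\qquad q:=\big(\Gamma(1+\alpha)\Gamma(1-\alpha)\big)^{1/\alpha}.$$ 1. For every $k\in\mathbb N$, $(\hat M_{1,1},\dots,\hat M_{k,1})$ converges in distribution to $(\hat\omega_1,\dots,\hat\omega_k)$ as $n\to\infty$. 2. Almost surely, $(\hat\omega_i)_{i\ge1}$ can be rearranged in nonincreasing order. The ranked (nonincreasing) rearrangement of $\{M_{j,1},\,j\in[n]\}$ converges in distribution, as $n\to\infty$, to the ranked rearrangement of $(\hat\omega_i)_{i\ge1}$; that is, for every $k\in\mathbb N$ the joint law of the $k$ largest entries $M_{j,1}$ converges weakly to the joint law of the $k$ largest $\hat\omega_i$. The ranked rearrangement of $(\hat\omega_i)_{i\ge1}$ has the same law as the ranked sequence $(\omega_i)_{i\ge1}$. -/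

import Mathlib

open MeasureTheory ProbabilityTheory Filter Topology

/-- Assumption (H1) on the law `L` of the weights: it is carried by `[0, ∞)`, and
`t ^ α * L [t, ∞)` tends, as `t → ∞`, to a limit `c > 0`. -/
structure HeavyTailedLaw (α c : ℝ) (L : Measure ℝ) : Prop where
  nonneg : ∀ᵐ x ∂L, 0 ≤ x
  pos : 0 < c
  tail : Tendsto (fun t : ℝ => t ^ α * L.real (Set.Ici t)) atTop (𝓝 c)

/-- The entries of the random matrix `X` are i.i.d. with law `L`. -/
structure IsIIDMatrix {Ω : Type*} [MeasurableSpace Ω] {m : ℕ}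
    (X : Ω → Matrix (Fin m) (Fin m) ℝ) (L : Measure ℝ) (P : Measure Ω) : Prop where
  measurable : ∀ i j, Measurable fun w => X w i j
  law : ∀ i j, HasLaw (fun w => X w i j) L P
  indep : iIndepFun (fun (p : Fin m × Fin m) w => X w p.1 p.2) P

/-- The Markov matrix obtained by dividing each row of `X` by its sum; a row whose sum is `0`
is replaced by the corresponding row of the identity matrix. -/
noncomputable def markovMatrix {m : ℕ} (X : Matrix (Fin m) (Fin m) ℝ) :
    Matrix (Fin m) (Fin m) ℝ := fun i j =>
  if ∑ l, X i l = 0 then (if i = j then 1 else 0) else X i j / ∑ l, X i l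

/-- The `(k + 1)`-st largest value of the family `x`, counted with multiplicity
(and `0` if a finite family has fewer than `k + 1` members). For a family that can be arranged in
nonincreasing order, `ranked x` is that arrangement: see `ranked_eq_of_fin` and
`ranked_eq_of_nat`. -/
noncomputable def ranked {ι : Type*} (x : ι → ℝ) (k : ℕ) : ℝ :=
  sSup {t : ℝ | (k : ℕ∞) < {i | t ≤ x i}.encard}

theorem ranked_eq_of_fin {ι : Type*} {m : ℕ} (x : ι → ℝ) (e : Fin m ≃ ι)
    (h : Antitone (x ∘ e)) (k : Fin m) : ranked x k = x (e k) := by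
  apply IsGreatest.csSup_eq
  constructor
  · have h1 : e '' (Set.Iic k) ⊆ {i | x (e k) ≤ x i} := by
      rintro _ ⟨j, hj, rfl⟩
      exact h hj
    have h2 := Set.encard_le_encard h1
    rw [e.injective.encard_image, Set.encard_eq_coe_toFinset_card (Set.Iic k)] at h2
    refine lt_of_lt_of_le ?_ h2
    simp only [Set.toFinset_Iic, Fin.card_Iic]
    exact_mod_cast Nat.lt_succ_self _
  · intro t ht
    by_contra hlt
    have h1 : {i | t ≤ x i} ⊆ e '' (Set.Iio k) := by
      intro i hi
      refine ⟨e.symm i, ?_, by simp⟩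
      by_contra hk
      have := h (not_lt.mp hk)
      simp only [Function.comp, Equiv.apply_symm_apply] at this
      exact hlt (le_trans hi this)
    have h2 := Set.encard_le_encard h1
    rw [e.injective.encard_image, Set.encard_eq_coe_toFinset_card (Set.Iio k)] at h2
    simp only [Set.toFinset_Iio, Fin.card_Iio] at h2
    exact absurd ht (not_lt.mpr h2)

theorem ranked_eq_of_nat {ι : Type*} (x : ι → ℝ) (e : ℕ ≃ ι)
    (h : Antitone (x ∘ e)) (k : ℕ) : ranked x k = x (e k) := by
  apply IsGreatest.csSup_eq
  constructor
  · have h1 : e '' (Set.Iic k) ⊆ {i | x (e k) ≤ x i} := by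
      rintro _ ⟨j, hj, rfl⟩
      exact h hj
    have h2 := Set.encard_le_encard h1
    rw [e.injective.encard_image, Set.encard_eq_coe_toFinset_card (Set.Iic k)] at h2
    refine lt_of_lt_of_le ?_ h2
    simp only [Set.toFinset_Iic, Nat.card_Iic]
    exact_mod_cast Nat.lt_succ_self _
  · intro t ht
    by_contra hlt
    have h1 : {i | t ≤ x i} ⊆ e '' (Set.Iio k) := by
      intro i hi
      refine ⟨e.symm i, ?_, by simp⟩
      by_contra hk
      have := h (not_lt.mp hk)
      simp only [Function.comp, Equiv.apply_symm_apply] at this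
      exact hlt (le_trans hi this)
    have h2 := Set.encard_le_encard h1
    rw [e.injective.encard_image, Set.encard_eq_coe_toFinset_card (Set.Iio k)] at h2
    simp only [Set.toFinset_Iio, Nat.card_Iio] at h2
    exact absurd ht (not_lt.mpr h2)

/-- `σ` chooses, for every vector `x`, a permutation that puts the entries of `x` in nonincreasing
order, with some measurable rule for breaking ties (such as the lexicographic order). -/
structure IsRankingRule {m : ℕ} (σ : (Fin m → ℝ) → Equiv.Perm (Fin m)) : Prop where
  measurable : ∀ i, Measurable fun x => σ x i
  antitone : ∀ x, Antitone (x ∘ σ x)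

/-- The first `k` coordinates of a finite vector (padded with `0` if it is shorter than `k`). -/
def firstCoords {m : ℕ} (k : ℕ) (x : Fin m → ℝ) : Fin k → ℝ := fun i =>
  if h : (i : ℕ) < m then x ⟨i, h⟩ else 0

/-- The random points `ξ i` form a Poisson point process with intensity measure `ν`: the numbers of
points in disjoint measurable sets are independent, and the number of points in a set of finite
`ν`-measure has the Poisson law with that mean. -/
structure IsPoissonPointProcess {Ω ι E : Type*} [MeasurableSpace Ω] [MeasurableSpace E]
    (ξ : ι → Ω → E) (ν : Measure E) (P : Measure Ω) : Prop where
  measurable : ∀ i, Measurable (ξ i)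
  law : ∀ A : Set E, MeasurableSet A → ν A ≠ ⊤ →
    HasLaw (fun w => {i | ξ i w ∈ A}.encard)
      ((poissonMeasure (ν A).toNNReal).map (fun n : ℕ => (n : ℕ∞))) P
  indep : ∀ (m : ℕ) (A : Fin m → Set E), (∀ j, MeasurableSet (A j)) →
    Pairwise (fun j l => Disjoint (A j) (A l)) →
    iIndepFun (fun j w => {i | ξ i w ∈ A j}.encard) P

/-- The measure `α t ^ (-α - 1) dt` on `(0, ∞)`. -/
noncomputable def pppIntensity (α : ℝ) : Measure ℝ :=
  (volume.restrict (Set.Ioi 0)).withDensity fun t => ENNReal.ofReal (α * t ^ (-α - 1))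

/-- The ranked sequence `ξ 0 ≥ ξ 1 ≥ ⋯` has law PPP(α): its points form a Poisson point process
with intensity `α t ^ (-α - 1)`. -/
structure IsPPP {Ω : Type*} [MeasurableSpace Ω] (α : ℝ) (ξ : ℕ → Ω → ℝ) (P : Measure Ω) :
    Prop where
  poisson : IsPoissonPointProcess ξ (pppIntensity α) P
  antitone : ∀ᵐ w ∂P, Antitone fun i => ξ i w

/-- `S` is a one-sided `α`-stable variable, normalized by its Laplace transform
`E exp (-θ S) = exp (-Γ(1 - α) θ ^ α)`, `θ ≥ 0`. -/
structure IsOneSidedStable {Ω : Type*} [MeasurableSpace Ω] (α : ℝ) (S : Ω → ℝ) (P : Measure Ω) :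
    Prop where
  measurable : Measurable S
  nonneg : ∀ᵐ w ∂P, 0 ≤ S w
  laplace : ∀ θ : ℝ, 0 ≤ θ →
    ∫ w, Real.exp (-θ * S w) ∂P = Real.exp (-Real.Gamma (1 - α) * θ ^ α)

/-- The constant `q = (Γ(1 + α) Γ(1 - α)) ^ (1 / α)`. -/
noncomputable def qConst (α : ℝ) : ℝ :=
  (Real.Gamma (1 + α) * Real.Gamma (1 - α)) ^ (1 / α)

/-! In a matrix of size `n + 1`, an entry of the first column of the Markov matrix is `x / (x + r)`,
where `x` is the weight in that column and `r` is the sum of the other `n` weights of the row. The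
pairs `(x, r)` are i.i.d. over the rows, and `x` is independent of `r`. With `a_n = (c (n + 1)) ^ (1
/ α)`, the tail assumption gives `(n + 1) P(x ≥ a_n y) → y ^ (-α)`, and Laplace transforms give `r /
a_n → S` in law.

Ranked convergence is a statement about counts: the `(k + 1)`-st largest value is at least `t` iff
more than `k` values are (`le_ranked_iff`). For i.i.d. rows with entry law `μ_n`, the joint Laplace
transform of the counts above finitely many levels is `(∫ G dμ_n) ^ (n + 1)` for a step function
`G`. It tends to `exp (-∫ (1 - G) dν)` as soon as `(n + 1) μ_n [T, ∞) → ν [T, ∞)` for all `T` in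
`(0, 1)`. If `ν` is the image of the intensity times the law of the marks, this limit is the Laplace
transform of the counts of the points `ξ / (ξ + S)`, by the marking theorem
(`IsMarkedPoisson.integral_counts_eq`).

There remains one scalar limit (`HeavyTailedLaw.tendsto_mul_entryLaw`). Put `s = T / (1 - T)` and
let `G` now be the tail of the weights. Given `r`, an entry is at least `T` with probability `G (s
r)`, and `(n + 1) G (s r)` converges in law to `(s S) ^ (-α)`. Expectations converge too, because
`P((n + 1) G (s r) > u) ≤ exp (-C u)` uniformly in `n ≥ 1`: a small sum of non-negative weights
forces all of them to be small.

The limiting tail is `(T / (1 - T)) ^ (-α) E[S ^ (-α)]`, so the marks enter only through `E[S ^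
(-α)]`. Writing `Γ(α) S ^ (-α)` as a Gamma integral gives `E[S ^ (-α)] = 1 / (Γ(1 + α) Γ(1 - α)) = q
^ (-α)`. Hence constant marks `q` yield the same ranked law.

For the entries listed in the order of the first column, the permutation depends on that column
only, and the column is independent of the remaining row sums. The row sums at the top positions are
therefore i.i.d. and independent of the column, and the joint moments of `x / (x + a_n)` and `exp
(-r / a_n)` factor exactly. The first factor converges by the counting argument with constant mark
`1`, the second by the Laplace limit, and a continuous map recovers `x / (x + r)`. -/

/-! ### Convergence in distribution: moments, approximation, continuous mapping. -/

section WeakConvergence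

variable {Ω : ℕ → Type*} [∀ n, MeasurableSpace (Ω n)] {P : ∀ n, Measure (Ω n)}
  [∀ n, IsProbabilityMeasure (P n)] {Ω' : Type*} [MeasurableSpace Ω'] {P' : Measure Ω'}
  [IsProbabilityMeasure P']

theorem tendstoInDistribution_of_integral {E : Type*} [TopologicalSpace E] [MeasurableSpace E]
    [OpensMeasurableSpace E] {X : ∀ n, Ω n → E} {Z : Ω' → E}
    (hX : ∀ n, AEMeasurable (X n) (P n)) (hZ : AEMeasurable Z P')
    (h : ∀ f : BoundedContinuousFunction E ℝ,
      Tendsto (fun n => ∫ w, f (X n w) ∂P n) atTop (𝓝 (∫ w, f (Z w) ∂P'))) :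
    TendstoInDistribution X atTop Z P P' := by
  refine ⟨hX, hZ, ?_⟩
  refine ProbabilityMeasure.tendsto_iff_forall_integral_tendsto.mpr fun f => ?_
  have h1 : ∀ n, ∫ x, f x ∂((P n).map (X n)) = ∫ w, f (X n w) ∂P n := fun n =>
    integral_map (hX n) f.continuous.measurable.aestronglyMeasurable
  have h2 : ∫ x, f x ∂(P'.map Z) = ∫ w, f (Z w) ∂P' :=
    integral_map hZ f.continuous.measurable.aestronglyMeasurable
  simpa only [ProbabilityMeasure.coe_mk, h1, h2] using h f

theorem MeasureTheory.TendstoInDistribution.tendsto_integral {E : Type*} [TopologicalSpace E]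
    [MeasurableSpace E] [OpensMeasurableSpace E] {X : ∀ n, Ω n → E} {Z : Ω' → E}
    (h : TendstoInDistribution X atTop Z P P') (f : BoundedContinuousFunction E ℝ) :
    Tendsto (fun n => ∫ w, f (X n w) ∂P n) atTop (𝓝 (∫ w, f (Z w) ∂P')) := by
  have h0 := ProbabilityMeasure.tendsto_iff_forall_integral_tendsto.mp h.tendsto
  have h1 : ∀ n, ∫ x, f x ∂((P n).map (X n)) = ∫ w, f (X n w) ∂P n := fun n =>
    integral_map (h.forall_aemeasurable n) f.continuous.measurable.aestronglyMeasurable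
  have h2 : ∫ x, f x ∂(P'.map Z) = ∫ w, f (Z w) ∂P' :=
    integral_map h.aemeasurable_limit f.continuous.measurable.aestronglyMeasurable
  simpa only [ProbabilityMeasure.coe_mk, h1, h2] using h0 f

theorem integral_eval_mvPolynomial {ι : Type*} [Fintype ι] {Θ : Type*} [MeasurableSpace Θ]
    {Q : Measure Θ} [IsProbabilityMeasure Q] {V : Θ → ι → ℝ} (hV : AEMeasurable V Q)
    (h01 : ∀ᵐ w ∂Q, ∀ i, V w i ∈ Set.Icc (0 : ℝ) 1) (p : MvPolynomial ι ℝ) :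
    Integrable (fun w => p.eval (V w)) Q ∧
    ∫ w, p.eval (V w) ∂Q = ∑ d ∈ p.support, p.coeff d * ∫ w, ∏ i, V w i ^ d i ∂Q := by
  have hint : ∀ d : ι →₀ ℕ, Integrable (fun w => ∏ i, V w i ^ d i) Q := by
    intro d
    refine Integrable.of_bound (C := 1) ?_ ?_
    · have : Measurable fun v : ι → ℝ => ∏ i, v i ^ d i := by fun_prop
      exact (this.comp_aemeasurable hV).aestronglyMeasurable
    · filter_upwards [h01] with w hw
      rw [Real.norm_eq_abs, abs_of_nonneg (Finset.prod_nonneg fun i _ => pow_nonneg (hw i).1 _)]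
      exact Finset.prod_le_one (fun i _ => pow_nonneg (hw i).1 _)
        fun i _ => pow_le_one₀ (hw i).1 (hw i).2
  simp only [MvPolynomial.eval_eq']
  refine ⟨integrable_finsetSum _ fun d _ => (hint d).const_mul _, ?_⟩
  rw [integral_finsetSum _ fun d _ => (hint d).const_mul _]
  exact Finset.sum_congr rfl fun d _ => integral_const_mul _ _

/-- Stone–Weierstrass: the algebra generated by the coordinates separates points, and the cube is
compact. -/
theorem exists_mvPolynomial_near {ι : Type*} [Fintype ι] {f : (ι → ℝ) → ℝ} (hf : Continuous f)
    {ε : ℝ} (hε : 0 < ε) : ∃ p : MvPolynomial ι ℝ, ∀ x : ι → ℝ,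
      (∀ i, x i ∈ Set.Icc (0 : ℝ) 1) → |p.eval x - f x| < ε := by
  let c : ι → C(ι → ℝ, ℝ) := fun i => ⟨fun x => x i, continuous_apply i⟩
  have hval : ∀ (p : MvPolynomial ι ℝ) (x : ι → ℝ), (MvPolynomial.aeval c p) x = p.eval x := by
    intro p x
    induction p using MvPolynomial.induction_on with
    | C a => simp
    | add p q hp hq => simp [hp, hq]
    | mul_X p i hp => simp [hp, c]
  let A : Subalgebra ℝ C(ι → ℝ, ℝ) := (MvPolynomial.aeval c).range
  have hA : A.SeparatesPoints := by
    intro x y hxy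
    obtain ⟨i, hi⟩ := Function.ne_iff.mp hxy
    exact ⟨c i, ⟨c i, ⟨MvPolynomial.X i, by simp⟩, rfl⟩, hi⟩
  have hK : IsCompact (Set.univ.pi fun _ : ι => Set.Icc (0 : ℝ) 1) :=
    isCompact_univ_pi fun _ => isCompact_Icc
  obtain ⟨g, ⟨p, hp⟩, hg⟩ :=
    ContinuousMap.exists_mem_subalgebra_near_continuous_of_isCompact_of_separatesPoints hA
      ⟨f, hf⟩ hK hε
  refine ⟨p, fun x hx => ?_⟩
  have := hg x fun i _ => hx i
  rw [← hp] at this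
  simpa [hval, Real.norm_eq_abs] using this

theorem abs_integral_sub_integral_eval_le {ι : Type*} [Fintype ι] {Θ : Type*} [MeasurableSpace Θ]
    {Q : Measure Θ} [IsProbabilityMeasure Q] {W : Θ → ι → ℝ} (hW : AEMeasurable W Q)
    (hW01 : ∀ᵐ w ∂Q, ∀ i, W w i ∈ Set.Icc (0 : ℝ) 1) (f : BoundedContinuousFunction (ι → ℝ) ℝ)
    (p : MvPolynomial ι ℝ) {δ : ℝ} (hp : ∀ x : ι → ℝ, (∀ i, x i ∈ Set.Icc (0 : ℝ) 1) →
      |p.eval x - f x| < δ) : |∫ w, f (W w) ∂Q - ∫ w, p.eval (W w) ∂Q| ≤ δ := by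
  have hf : Integrable (fun w => f (W w)) Q :=
    Integrable.of_bound (C := ‖f‖)
      (f.continuous.measurable.comp_aemeasurable hW).aestronglyMeasurable
      (ae_of_all _ fun w => f.norm_coe_le_norm _)
  rw [← integral_sub hf (integral_eval_mvPolynomial hW hW01 p).1]
  have := norm_integral_le_of_norm_le_const (μ := Q) (C := δ)
    (f := fun w => f (W w) - p.eval (W w)) (by
      filter_upwards [hW01] with w hw
      rw [Real.norm_eq_abs, abs_sub_comm]
      exact (hp _ hw).le)
  simpa [Real.norm_eq_abs] using this

/-- The method of moments on the cube. -/
theorem tendstoInDistribution_of_moments {ι : Type*} [Fintype ι] {V : ∀ n, Ω n → ι → ℝ}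
    {V' : Ω' → ι → ℝ} (hV : ∀ n, AEMeasurable (V n) (P n)) (hV' : AEMeasurable V' P')
    (h01 : ∀ n, ∀ᵐ w ∂P n, ∀ i, V n w i ∈ Set.Icc (0 : ℝ) 1)
    (h01' : ∀ᵐ w ∂P', ∀ i, V' w i ∈ Set.Icc (0 : ℝ) 1)
    (hm : ∀ p : ι → ℕ, Tendsto (fun n => ∫ w, ∏ i, V n w i ^ p i ∂P n) atTop
      (𝓝 (∫ w, ∏ i, V' w i ^ p i ∂P'))) :
    TendstoInDistribution V atTop V' P P' := by
  refine tendstoInDistribution_of_integral hV hV' fun f => ?_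
  rw [Metric.tendsto_atTop]
  intro ε hε
  obtain ⟨p, hp⟩ := exists_mvPolynomial_near f.continuous (show (0 : ℝ) < ε / 4 by positivity)
  have hpt : Tendsto (fun n => ∫ w, p.eval (V n w) ∂P n) atTop (𝓝 (∫ w, p.eval (V' w) ∂P')) := by
    rw [(integral_eval_mvPolynomial hV' h01' p).2]
    simp only [fun n => (integral_eval_mvPolynomial (hV n) (h01 n) p).2]
    exact tendsto_finsetSum _ fun d _ => (hm d).const_mul _
  obtain ⟨N, hN⟩ := Metric.tendsto_atTop.mp hpt (ε / 4) (by positivity)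
  refine ⟨N, fun n hn => ?_⟩
  have h1 := abs_integral_sub_integral_eval_le (hV n) (h01 n) f p hp
  have h2 := abs_integral_sub_integral_eval_le hV' h01' f p hp
  have h3 := hN n hn
  rw [Real.dist_eq] at h3 ⊢
  rw [abs_le] at h1 h2
  rw [abs_lt] at h3 ⊢
  constructor <;> linarith [h1.1, h1.2, h2.1, h2.2, h3.1, h3.2]

/-- Where the two variables are within `δ`, the Lipschitz bound costs `L δ`; elsewhere the
oscillation `M` is paid with probability at most `δ`. -/
theorem abs_integral_comp_sub_le {E : Type*} [NormedAddCommGroup E]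
    [SecondCountableTopology E] [MeasurableSpace E] [BorelSpace E] {Θ : Type*} [MeasurableSpace Θ]
    {Q : Measure Θ} [IsProbabilityMeasure Q] {U W : Θ → E} (hU : AEMeasurable U Q)
    (hW : AEMeasurable W Q) {F : E → ℝ} {M : ℝ} (hM : ∀ x y, dist (F x) (F y) ≤ M) {L : NNReal}
    (hL : LipschitzWith L F) {δ : ℝ} (hδ : 0 < δ) (hQ : Q.real {w | δ < ‖U w - W w‖} ≤ δ) :
    |∫ w, F (U w) ∂Q - ∫ w, F (W w) ∂Q| ≤ (L + M) * δ := by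
  have hFc : Continuous F := hL.continuous
  have hM0 : 0 ≤ M := dist_nonneg.trans (hM 0 0)
  let Fb : BoundedContinuousFunction E ℝ := ⟨⟨F, hFc⟩, M, hM⟩
  have hi : ∀ {T : Θ → E}, AEMeasurable T Q → Integrable (fun w => F (T w)) Q := fun hT =>
    Integrable.of_bound (C := ‖Fb‖) (hFc.measurable.comp_aemeasurable hT).aestronglyMeasurable
      (ae_of_all _ fun w => Fb.norm_coe_le_norm _)
  have hms : NullMeasurableSet {w | δ < ‖U w - W w‖} Q :=
    nullMeasurableSet_lt aemeasurable_const (hU.sub hW).norm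
  rw [← integral_sub (hi hU) (hi hW), ← Real.norm_eq_abs]
  have hind : Integrable ({w | δ < ‖U w - W w‖}.indicator fun _ => M) Q :=
    (integrable_const M).indicator₀ hms
  calc ‖∫ w, (F (U w) - F (W w)) ∂Q‖
      ≤ ∫ w, (L * δ + {w | δ < ‖U w - W w‖}.indicator (fun _ => M) w) ∂Q := by
        refine norm_integral_le_of_norm_le ((integrable_const _).add hind)
          (ae_of_all _ fun w => ?_)
        by_cases hw : δ < ‖U w - W w‖
        · rw [Set.indicator_of_mem (show w ∈ {w | δ < ‖U w - W w‖} from hw)]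
          have := hM (U w) (W w)
          rw [dist_eq_norm] at this
          have h0 : 0 ≤ (L : ℝ) * δ := by positivity
          linarith
        · rw [Set.indicator_of_notMem (show w ∉ {w | δ < ‖U w - W w‖} from hw), add_zero]
          exact hL.norm_sub_le_of_le (not_lt.mp hw)
    _ = L * δ + M * Q.real {w | δ < ‖U w - W w‖} := by
        rw [integral_add (integrable_const _) hind, integral_indicator₀ hms]
        simp [mul_comm]
    _ ≤ L * δ + M * δ := by gcongr
    _ = (L + M) * δ := by ring

/-- The approximation theorem for convergence in distribution. -/
theorem tendstoInDistribution_of_forall_approx {E : Type*} [NormedAddCommGroup E]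
    [SecondCountableTopology E] [MeasurableSpace E] [BorelSpace E] {Y : ∀ n, Ω n → E} {Y' : Ω' → E}
    (hY : ∀ n, AEMeasurable (Y n) (P n)) (hY' : AEMeasurable Y' P')
    (h : ∀ ε > 0, ∃ (D : ∀ n, Ω n → E) (D' : Ω' → E), TendstoInDistribution D atTop D' P P' ∧
      (∀ᶠ n in atTop, (P n).real {w | ε < ‖Y n w - D n w‖} ≤ ε) ∧
      P'.real {w | ε < ‖Y' w - D' w‖} ≤ ε) :
    TendstoInDistribution Y atTop Y' P P' := by
  refine ⟨hY, hY', ?_⟩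
  refine tendsto_iff_forall_lipschitz_integral_tendsto.mpr ?_
  rintro F ⟨M, hM⟩ ⟨L, hL⟩
  have hFc : Continuous F := hL.continuous
  have h1 : ∀ n, ∫ x, F x ∂((P n).map (Y n)) = ∫ w, F (Y n w) ∂P n := fun n =>
    integral_map (hY n) hFc.measurable.aestronglyMeasurable
  have h2 : ∫ x, F x ∂(P'.map Y') = ∫ w, F (Y' w) ∂P' :=
    integral_map hY' hFc.measurable.aestronglyMeasurable
  simp only [ProbabilityMeasure.coe_mk, h1, h2]
  have hM0 : 0 ≤ M := dist_nonneg.trans (hM 0 0)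
  let Fb : BoundedContinuousFunction E ℝ := ⟨⟨F, hFc⟩, M, hM⟩
  rw [Metric.tendsto_atTop]
  intro ε hε
  have hLM : 0 < (L : ℝ) + M + 1 := by positivity
  -- This `δ` makes `(L + M) δ ≤ ε / 4`; the `+ 1` keeps the denominator positive.
  obtain ⟨D, D', hD, hDn, hD'⟩ := h (ε / (4 * (L + M + 1))) (by positivity)
  obtain ⟨N, hN⟩ := eventually_atTop.mp
    (hDn.and (Metric.tendsto_nhds.mp (hD.tendsto_integral Fb) (ε / 4) (by positivity)))
  refine ⟨N, fun n hn => ?_⟩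
  have hδ : (L + M) * (ε / (4 * (L + M + 1))) ≤ ε / 4 := by
    rw [mul_div_assoc', div_le_div_iff₀ (by positivity) (by positivity)]
    nlinarith [L.2]
  have e1 := (abs_integral_comp_sub_le (hY n) (hD.forall_aemeasurable n) hM hL (by positivity) (hN n hn).1).trans hδ
  have e2 := (abs_integral_comp_sub_le hY' hD.aemeasurable_limit hM hL (by positivity) hD').trans hδ
  have e3 := (hN n hn).2
  change dist (∫ w, F (D n w) ∂P n) (∫ w, F (D' w) ∂P') < _ at e3
  rw [Real.dist_eq] at e3 ⊢
  rw [abs_le] at e1 e2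
  rw [abs_lt] at e3 ⊢
  constructor <;> linarith [e1.1, e1.2, e2.1, e2.2, e3.1, e3.2]

/-- The continuous mapping theorem for a map that is continuous on an open set which carries the
limit. -/
theorem MeasureTheory.TendstoInDistribution.comp_of_continuousOn {E F : Type*} [TopologicalSpace E]
    [HasOuterApproxClosed E] [MeasurableSpace E] [BorelSpace E] [TopologicalSpace F]
    [HasOuterApproxClosed F]
    [MeasurableSpace F] [BorelSpace F] {X : ∀ n, Ω n → E} {Z : Ω' → E}
    (h : TendstoInDistribution X atTop Z P P') {g : E → F} (hg : Measurable g) {O : Set E}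
    (hO : IsOpen O) (hgO : ContinuousOn g O) (hZ : ∀ᵐ w ∂P', Z w ∈ O) :
    TendstoInDistribution (fun n w => g (X n w)) atTop (fun w => g (Z w)) P P' := by
  refine ⟨fun n => hg.comp_aemeasurable (h.forall_aemeasurable n),
    hg.comp_aemeasurable h.aemeasurable_limit, ?_⟩
  refine tendsto_of_forall_isClosed_limsup_le' fun C hC => ?_
  have hm : ∀ n, ((P n).map fun w => g (X n w)) C = ((P n).map (X n)) (g ⁻¹' C) := fun n => by
    rw [← Measure.map_apply hg hC.measurableSet,
      AEMeasurable.map_map_of_aemeasurable hg.aemeasurable (h.forall_aemeasurable n)]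
    rfl
  have hm' : (P'.map fun w => g (Z w)) C = (P'.map Z) (g ⁻¹' C) := by
    rw [← Measure.map_apply hg hC.measurableSet,
      AEMeasurable.map_map_of_aemeasurable hg.aemeasurable h.aemeasurable_limit]
    rfl
  simp only [ProbabilityMeasure.coe_mk, hm, hm']
  -- The preimage of `C` need not be closed, but its closure adds points only outside `O`, where the
  -- limit has no mass.
  have hsub : closure (g ⁻¹' C) ∩ O ⊆ g ⁻¹' C := by
    rintro x ⟨hx, hxO⟩
    have hc : ContinuousAt g x := hgO.continuousAt (hO.mem_nhds hxO)
    have := hc.continuousWithinAt.mem_closure hx (Set.mapsTo_preimage g C)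
    rwa [hC.closure_eq] at this
  have hae : (P'.map Z) (closure (g ⁻¹' C)) ≤ (P'.map Z) (g ⁻¹' C) := by
    refine measure_mono_ae ?_
    have : ∀ᵐ x ∂(P'.map Z), x ∈ O :=
      (ae_map_iff h.aemeasurable_limit hO.measurableSet).mpr hZ
    filter_upwards [this] with x hx hxc using hsub ⟨hxc, hx⟩
  refine le_trans ?_ hae
  refine le_trans (limsup_le_limsup (Eventually.of_forall fun n =>
    measure_mono (μ := (P n).map (X n)) subset_closure)) ?_
  exact ProbabilityMeasure.limsup_measure_closed_le_of_tendsto h.tendsto isClosed_closure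

end WeakConvergence


/-! ### Ranked values and counts above levels. -/

section Ranked

/-- The bridge from ranking to counting. Only finitely many values lie in `[t / 2, t)`, so some
interval `[m, t)` contains none, and the supremum defining `ranked` cannot reach `t` without being
attained. -/
theorem le_ranked_iff {ι : Type*} {x : ι → ℝ} (hfin : ∀ s : ℝ, 0 < s → {i | s ≤ x i}.Finite)
    (k : ℕ) {t : ℝ} (ht : 0 < t) : t ≤ ranked x k ↔ k < {i | t ≤ x i}.ncard := by
  have hcast : k < {i | t ≤ x i}.ncard ↔ (k : ℕ∞) < {i | t ≤ x i}.encard := by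
    rw [← (hfin t ht).cast_ncard_eq]
    exact Nat.cast_lt.symm
  rw [hcast]
  constructor
  · intro h
    by_contra hlt
    have hG : {i | t / 2 ≤ x i ∧ x i < t}.Finite :=
      (hfin (t / 2) (by positivity)).subset fun i hi => hi.1
    have hev : ∀ᶠ m in 𝓝[<] t, ∀ i ∈ {i | t / 2 ≤ x i ∧ x i < t}, x i < m :=
      (eventually_all_finite hG).mpr fun i hi =>
        mem_of_superset (Ioo_mem_nhdsLT hi.2) fun m hm => hm.1
    have hev2 : ∀ᶠ m in 𝓝[<] t, m ∈ Set.Ioo (t / 2) t := Ioo_mem_nhdsLT (by linarith)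
    obtain ⟨m, hm, hm2⟩ := (hev.and hev2).exists
    have : ranked x k ≤ m := by
      refine Real.sSup_le (fun s hs => ?_) (by linarith [hm2.1])
      by_contra hsm
      refine hlt (lt_of_lt_of_le hs (Set.encard_le_encard fun i hi => ?_))
      by_contra hti
      have h1 : x i < t := not_le.mp hti
      have h2 : s ≤ x i := hi
      have h3 := hm i ⟨by linarith [hm2.1], h1⟩
      linarith
    linarith [hm2.2]
  · intro h
    refine le_csSup ?_ h
    obtain ⟨B, hB⟩ := ((hfin 1 one_pos).image x).bddAbove
    refine ⟨max B 1, fun s hs => ?_⟩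
    have hne : {i | s ≤ x i}.Nonempty := by
      rw [← Set.encard_pos]
      exact lt_of_le_of_lt (zero_le) hs
    obtain ⟨i, hi⟩ := hne
    rcases le_or_gt 1 (x i) with h1 | h1
    · exact (le_trans hi (hB ⟨i, h1, rfl⟩)).trans (le_max_left _ _)
    · exact (le_trans hi h1.le).trans (le_max_right _ _)

theorem ranked_mem_Icc {ι : Type*} {x : ι → ℝ} (hx : ∀ i, x i ∈ Set.Icc (0 : ℝ) 1) (k : ℕ) :
    ranked x k ∈ Set.Icc (0 : ℝ) 1 := by
  constructor
  · by_cases h0 : (k : ℕ∞) < {i | 0 ≤ x i}.encard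
    · have hbdd : BddAbove {t : ℝ | (k : ℕ∞) < {i | t ≤ x i}.encard} := by
        refine ⟨1, fun s hs => ?_⟩
        have hne : {i | s ≤ x i}.Nonempty := by
          rw [← Set.encard_pos]
          exact lt_of_le_of_lt (zero_le) hs
        obtain ⟨i, hi⟩ := hne
        exact le_trans hi (hx i).2
      exact le_csSup hbdd h0
    -- Here the family has at most `k` members, so no level qualifies and the supremum of the empty
    -- set is `0`.
    · refine Real.sSup_nonneg fun s hs => absurd (lt_of_lt_of_le hs ?_) h0
      exact Set.encard_le_encard fun i _ => (hx i).1
  · refine Real.sSup_le (fun s hs => ?_) zero_le_one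
    have hne : {i | s ≤ x i}.Nonempty := by
      rw [← Set.encard_pos]
      exact lt_of_le_of_lt (zero_le) hs
    obtain ⟨i, hi⟩ := hne
    exact le_trans hi (hx i).2

theorem measurable_setOf_mem {Ω ι : Type*} [MeasurableSpace Ω] {p : ι → Set Ω}
    (hp : ∀ i, MeasurableSet (p i)) : Measurable fun w => {i | w ∈ p i} :=
  measurable_set_iff.mpr fun i => measurable_mem.mpr (hp i)

theorem measurable_ncard_le {Ω ι : Type*} [Countable ι] [MeasurableSpace Ω] {y : ι → Ω → ℝ}
    (hy : ∀ i, Measurable (y i)) (t : ℝ) : Measurable fun w => {i | t ≤ y i w}.ncard :=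
  measurable_ncard.comp
    (measurable_setOf_mem fun i => measurableSet_le measurable_const (hy i))

theorem aemeasurable_ranked {Ω ι : Type*} [Countable ι] [MeasurableSpace Ω] {Q : Measure Ω}
    {y : ι → Ω → ℝ} (hy : ∀ i, Measurable (y i))
    (h01 : ∀ᵐ w ∂Q, ∀ i, y i w ∈ Set.Icc (0 : ℝ) 1)
    (hfin : ∀ᵐ w ∂Q, ∀ s : ℝ, 0 < s → {i | s ≤ y i w}.Finite) (k : ℕ) :
    AEMeasurable (fun w => ranked (fun i => y i w) k) Q := by
  have h : ∀ t : ℝ, NullMeasurableSet ((fun w => ranked (fun i => y i w) k) ⁻¹' Set.Ici t) Q := by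
    intro t
    rcases le_or_gt t 0 with ht | ht
    · refine NullMeasurableSet.congr nullMeasurableSet_univ ?_
      filter_upwards [h01] with w hw
      exact eq_iff_iff.mpr ⟨fun _ => ht.trans (ranked_mem_Icc hw k).1, fun _ => trivial⟩
    · have hm : MeasurableSet {w | k < {i | t ≤ y i w}.ncard} :=
        measurableSet_lt measurable_const (measurable_ncard_le hy t)
      refine NullMeasurableSet.congr hm.nullMeasurableSet ?_
      filter_upwards [hfin] with w hw
      exact eq_iff_iff.mpr (le_ranked_iff hw k ht).symm
  have hnm : NullMeasurable (fun w => ranked (fun i => y i w) k) Q :=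
    @measurable_of_Ici ℝ (NullMeasurableSpace Ω Q) _ _ _ _ _ _ _ _ h
  exact hnm.aemeasurable

/-- Order the indices by decreasing value, ties by index. Every index has finitely many
predecessors, and their number `r` is its rank: `r` is injective because the order is total, and
surjective because the predecessors of `i` fill the initial segment below `r i`. The inverse of `r`
does the sorting. -/
theorem exists_perm_antitone {y : ℕ → ℝ} (hpos : ∀ i, 0 < y i)
    (hfin : ∀ s : ℝ, 0 < s → {i | s ≤ y i}.Finite) : ∃ τ : Equiv.Perm ℕ, Antitone (y ∘ τ) := by
  let pre : ℕ → Set ℕ := fun i => {j | y i < y j ∨ (y i = y j ∧ j < i)}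
  have hpre : ∀ i, (pre i).Finite := fun i =>
    (hfin (y i) (hpos i)).subset fun j hj => hj.elim (fun h => h.le) fun h => h.1.le
  have hsub : ∀ {i j}, j ∈ pre i → pre j ⊆ pre i := by
    intro i j hj l hl
    simp only [pre, Set.mem_ofPred_eq] at *
    grind
  have hirr : ∀ i, i ∉ pre i := fun i => by simp [pre]
  let r : ℕ → ℕ := fun i => (pre i).ncard
  have hlt : ∀ {i j}, j ∈ pre i → r j < r i := fun {i j} hj =>
    Set.ncard_lt_ncard ⟨hsub hj, fun h => hirr j (h hj)⟩ (hpre i)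
  have htot : ∀ {i j}, i ≠ j → j ∈ pre i ∨ i ∈ pre j := by
    intro i j hij
    simp only [pre, Set.mem_ofPred_eq]
    grind
  have hinj : Function.Injective r := by
    intro i j hij
    by_contra hne
    rcases htot hne with h | h
    · exact absurd hij (hlt h).ne'
    · exact absurd hij (hlt h).ne
  have himg : ∀ i, r '' pre i = Set.Iio (r i) := by
    intro i
    refine Set.eq_of_subset_of_ncard_le ?_ ?_ (Set.finite_Iio _)
    · rintro _ ⟨j, hj, rfl⟩
      exact hlt hj
    · rw [Set.ncard_image_of_injective _ hinj]
      simp [r, Set.ncard_eq_toFinset_card']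
  have hsurj : Function.Surjective r := by
    intro m
    obtain ⟨_, ⟨i, rfl⟩, hi⟩ := (Set.infinite_range_of_injective hinj).exists_gt m
    have : m ∈ r '' pre i := by rw [himg]; exact hi
    obtain ⟨j, _, hj⟩ := this
    exact ⟨j, hj⟩
  let e := Equiv.ofBijective r ⟨hinj, hsurj⟩
  refine ⟨e.symm, fun a b hab => ?_⟩
  simp only [Function.comp]
  by_contra hcon
  have hmem : e.symm b ∈ pre (e.symm a) := Or.inl (not_le.mp hcon)
  have := hlt hmem
  have ha : r (e.symm a) = a := e.apply_symm_apply a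
  have hb : r (e.symm b) = b := e.apply_symm_apply b
  omega

/-- Counting the grid levels below `y` rounds `y` down to the grid. The level `1` is left out, so
that all levels lie in the open interval; at `y = 1` this costs exactly one mesh. -/
theorem abs_sub_discretization_le (K : ℕ) {y : ℝ} (hy : y ∈ Set.Icc (0 : ℝ) 1) :
    |y - (∑ l : Fin K, if ((l : ℝ) + 1) / (K + 1) ≤ y then (1 : ℝ) else 0) / (K + 1)|
      ≤ 1 / (K + 1) := by
  have hK : (0 : ℝ) < K + 1 := by positivity
  have hz0 : 0 ≤ y * (K + 1) := mul_nonneg hy.1 hK.le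
  have hz1 : y * (K + 1) ≤ K + 1 := mul_le_of_le_one_left hK.le hy.2
  have hsum : (∑ l : Fin K, if ((l : ℝ) + 1) / (K + 1) ≤ y then (1 : ℝ) else 0) =
      (min ⌊y * (K + 1)⌋₊ K : ℕ) := by
    rw [Fin.sum_univ_eq_sum_range (fun l => if ((l : ℝ) + 1) / (K + 1) ≤ y then (1 : ℝ) else 0) K,
      Finset.sum_boole]
    have : (Finset.range K).filter (fun l : ℕ => ((l : ℝ) + 1) / (K + 1) ≤ y) =
        Finset.range (min ⌊y * (K + 1)⌋₊ K) := by
      ext l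
      simp only [Finset.mem_filter, Finset.mem_range, lt_min_iff]
      rw [div_le_iff₀ hK, and_comm]
      refine and_congr_left fun _ => ?_
      rw [← Nat.succ_le_iff, Nat.le_floor_iff hz0]
      push_cast
      rfl
    rw [this, Finset.card_range]
  rw [hsum]
  have h1 : y - ((min ⌊y * (K + 1)⌋₊ K : ℕ) : ℝ) / (K + 1) =
      (y * (K + 1) - ((min ⌊y * (K + 1)⌋₊ K : ℕ) : ℝ)) / (K + 1) := by field_simp
  rw [h1, abs_div, abs_of_pos hK]
  refine div_le_div_of_nonneg_right ?_ hK.le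
  have hf1 := Nat.floor_le hz0
  have hf2 := Nat.lt_floor_add_one (y * (K + 1))
  rw [abs_le]
  rcases le_total ⌊y * ((K : ℝ) + 1)⌋₊ K with h | h
  · rw [min_eq_left h]
    constructor <;> linarith
  · rw [min_eq_right h]
    have : (K : ℝ) ≤ ⌊y * ((K : ℝ) + 1)⌋₊ := by exact_mod_cast h
    constructor <;> linarith

end Ranked


/-! ### From convergence of counts to convergence of ranked values. -/

section RankedConvergence

/-- A continuous function which separates `exp (-N)`, `N ≤ i`, from `exp (-N)`, `N > i`. -/
noncomputable def expStep (i : ℕ) (v : ℝ) : ℝ :=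
  max 0 (min 1 ((Real.exp (-i) - v) / (Real.exp (-i) - Real.exp (-(i + 1)))))

theorem continuous_expStep (i : ℕ) : Continuous (expStep i) := by
  unfold expStep
  fun_prop

theorem expStep_exp_neg (i N : ℕ) : expStep i (Real.exp (-N)) = if i < N then 1 else 0 := by
  have hd : 0 < Real.exp (-(i : ℝ)) - Real.exp (-(i + 1 : ℝ)) :=
    sub_pos.mpr (Real.exp_lt_exp.mpr (by linarith))
  unfold expStep
  split_ifs with h
  · have h1 : Real.exp (-(N : ℝ)) ≤ Real.exp (-(i + 1 : ℝ)) := by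
      refine Real.exp_le_exp.mpr (neg_le_neg ?_)
      exact_mod_cast h
    have h2 : 1 ≤ (Real.exp (-(i : ℝ)) - Real.exp (-(N : ℝ))) /
        (Real.exp (-(i : ℝ)) - Real.exp (-(i + 1 : ℝ))) := by
      rw [one_le_div hd]
      linarith
    rw [min_eq_left h2]
    simp
  · have h1 : Real.exp (-(i : ℝ)) ≤ Real.exp (-(N : ℝ)) := by
      refine Real.exp_le_exp.mpr (neg_le_neg ?_)
      exact_mod_cast not_lt.mp h
    have h2 : (Real.exp (-(i : ℝ)) - Real.exp (-(N : ℝ))) /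
        (Real.exp (-(i : ℝ)) - Real.exp (-(i + 1 : ℝ))) ≤ 0 :=
      div_nonpos_of_nonpos_of_nonneg (by linarith) hd.le
    rw [min_eq_right (h2.trans zero_le_one), max_eq_left h2]

/-- The vector of the first `k` ranked values, up to an error `1 / (K + 1)`, as a function of
`exp (-N l)`, `N l` being the number of values above the level `(l + 1) / (K + 1)`. -/
noncomputable def rankedOfCounts (k K : ℕ) (v : Fin K → ℝ) : Fin k → ℝ := fun i =>
  (∑ l, expStep i (v l)) / (K + 1)

theorem continuous_rankedOfCounts (k K : ℕ) : Continuous (rankedOfCounts k K) := by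
  refine continuous_pi fun i => Continuous.div_const ?_ _
  exact continuous_finsetSum _ fun l _ => (continuous_expStep i).comp (continuous_apply l)

theorem norm_ranked_sub_rankedOfCounts_le {ι : Type*} {x : ι → ℝ}
    (h01 : ∀ i, x i ∈ Set.Icc (0 : ℝ) 1) (hfin : ∀ s : ℝ, 0 < s → {i | s ≤ x i}.Finite)
    (k K : ℕ) : ‖(fun i : Fin k => ranked x i) - rankedOfCounts k K fun l =>
      Real.exp (-({i | ((l : ℝ) + 1) / (K + 1) ≤ x i}.ncard : ℝ))‖ ≤ 1 / (K + 1) := by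
  refine (pi_norm_le_iff_of_nonneg (by positivity)).mpr fun i => ?_
  have := abs_sub_discretization_le K (ranked_mem_Icc h01 i)
  have hl : ∀ l : Fin K, ((l : ℝ) + 1) / (K + 1) ≤ ranked x i ↔
      (i : ℕ) < {i | ((l : ℝ) + 1) / (K + 1) ≤ x i}.ncard :=
    fun l => le_ranked_iff hfin _ (by positivity)
  simp only [hl] at this
  simpa only [Pi.sub_apply, rankedOfCounts, expStep_exp_neg, Real.norm_eq_abs] using this

theorem measurable_exp_neg_ncard {Θ ι : Type*} [Countable ι] [MeasurableSpace Θ] {z : ι → Θ → ℝ}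
    (hz : ∀ i, Measurable (z i)) (t : ℝ) :
    Measurable fun w => Real.exp (-({i | t ≤ z i w}.ncard : ℝ)) := by
  have h1 := measurable_ncard_le hz t
  fun_prop

theorem measureReal_eq_zero_of_ae {Θ : Type*} [MeasurableSpace Θ] {Q : Measure Θ} {A : Set Θ}
    (h : ∀ᵐ w ∂Q, w ∉ A) : Q.real A = 0 := by
  rw [measureReal_def, measure_eq_zero_iff_ae_notMem.mpr h, ENNReal.toReal_zero]

variable {Ω : ℕ → Type*} [∀ n, MeasurableSpace (Ω n)] {P : ∀ n, Measure (Ω n)}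
  [∀ n, IsProbabilityMeasure (P n)] {Ω' : Type*} [MeasurableSpace Ω'] {P' : Measure Ω'}
  [IsProbabilityMeasure P']

/-- If the joint laws of the numbers of values above finitely many levels converge (in terms of
their Laplace transforms), then the ranked values converge in distribution. -/
theorem tendstoInDistribution_ranked {ι : ℕ → Type*} [∀ n, Countable (ι n)] {ι' : Type*}
    [Countable ι'] {y : ∀ n, ι n → Ω n → ℝ} {y' : ι' → Ω' → ℝ}
    (hy : ∀ n i, Measurable (y n i)) (hy' : ∀ i, Measurable (y' i))
    (h01 : ∀ n, ∀ᵐ w ∂P n, ∀ i, y n i w ∈ Set.Icc (0 : ℝ) 1)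
    (h01' : ∀ᵐ w ∂P', ∀ i, y' i w ∈ Set.Icc (0 : ℝ) 1)
    (hfin : ∀ n, ∀ᵐ w ∂P n, ∀ s : ℝ, 0 < s → {i | s ≤ y n i w}.Finite)
    (hfin' : ∀ᵐ w ∂P', ∀ s : ℝ, 0 < s → {i | s ≤ y' i w}.Finite)
    (hcounts : ∀ (m : ℕ) (t : Fin m → ℝ), (∀ j, t j ∈ Set.Ioo (0 : ℝ) 1) → ∀ p : Fin m → ℕ,
      Tendsto (fun n => ∫ w, ∏ j, Real.exp (-({i | t j ≤ y n i w}.ncard : ℝ)) ^ p j ∂P n) atTop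
        (𝓝 (∫ w, ∏ j, Real.exp (-({i | t j ≤ y' i w}.ncard : ℝ)) ^ p j ∂P')))
    (k : ℕ) : TendstoInDistribution (fun n w (i : Fin k) => ranked (fun j => y n j w) i) atTop
      (fun w (i : Fin k) => ranked (fun j => y' j w) i) P P' := by
  refine tendstoInDistribution_of_forall_approx
    (fun n => aemeasurable_pi_lambda _ fun i => aemeasurable_ranked (hy n) (h01 n) (hfin n) i)
    (aemeasurable_pi_lambda _ fun i => aemeasurable_ranked hy' h01' hfin' i) fun ε hε => ?_
  obtain ⟨K, hK⟩ := exists_nat_one_div_lt hε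
  have h01exp : ∀ N : ℕ, Real.exp (-(N : ℝ)) ∈ Set.Icc (0 : ℝ) 1 := fun N =>
    ⟨(Real.exp_pos _).le, Real.exp_le_one_iff.mpr (by simp)⟩
  -- The counts enter as `exp (-N)`, which stays in the cube; the moments are then the Laplace
  -- transforms of `hcounts`.
  have hV := tendstoInDistribution_of_moments (P := P) (P' := P')
    (V := fun n w (l : Fin K) => Real.exp (-({i | ((l : ℝ) + 1) / (K + 1) ≤ y n i w}.ncard : ℝ)))
    (V' := fun w (l : Fin K) => Real.exp (-({i | ((l : ℝ) + 1) / (K + 1) ≤ y' i w}.ncard : ℝ)))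
    (fun n => (measurable_pi_lambda _ fun l => measurable_exp_neg_ncard (hy n) _).aemeasurable)
    (measurable_pi_lambda _ fun l => measurable_exp_neg_ncard hy' _).aemeasurable
    (fun n => ae_of_all _ fun w l => h01exp _) (ae_of_all _ fun w l => h01exp _)
    (fun p => hcounts K (fun l => ((l : ℝ) + 1) / (K + 1)) (fun l => ⟨by positivity, by
      rw [div_lt_one (by positivity)]
      have : (l : ℝ) < K := by exact_mod_cast l.2
      linarith⟩) p)
  refine ⟨_, _, hV.continuous_comp (continuous_rankedOfCounts k K), Eventually.of_forall fun n => ?_,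
    ?_⟩
  · refine (measureReal_eq_zero_of_ae ?_).trans_le hε.le
    filter_upwards [h01 n, hfin n] with w hw hf
    exact not_lt.mpr ((norm_ranked_sub_rankedOfCounts_le hw hf k K).trans hK.le)
  · refine (measureReal_eq_zero_of_ae ?_).trans_le hε.le
    filter_upwards [h01', hfin'] with w hw hf
    exact not_lt.mpr ((norm_ranked_sub_rankedOfCounts_le hw hf k K).trans hK.le)

end RankedConvergence


/-! ### Tails of the intensity measure. -/

section Intensity

instance sigmaFinite_pppIntensity (α : ℝ) : SigmaFinite (pppIntensity α) := by
  unfold pppIntensity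
  exact SigmaFinite.withDensity_ofReal _

theorem pppIntensity_Iic_zero (α : ℝ) : pppIntensity α (Set.Iic 0) = 0 := by
  unfold pppIntensity
  rw [withDensity_apply _ measurableSet_Iic, Measure.restrict_restrict measurableSet_Iic,
    Set.Iic_inter_Ioi, Set.Ioc_self, Measure.restrict_empty, lintegral_zero_measure]

theorem pppIntensity_Ici {α : ℝ} (hα : 0 < α) {t : ℝ} (ht : 0 < t) :
    pppIntensity α (Set.Ici t) = ENNReal.ofReal (t ^ (-α)) := by
  unfold pppIntensity
  rw [withDensity_apply _ measurableSet_Ici, Measure.restrict_restrict measurableSet_Ici,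
    Set.inter_eq_left.mpr (show Set.Ici t ⊆ Set.Ioi 0 from fun x hx => ht.trans_le hx),
    Measure.restrict_congr_set Ioi_ae_eq_Ici.symm,
    ← ofReal_integral_eq_lintegral_ofReal]
  · rw [integral_const_mul, integral_Ioi_rpow_of_lt (by linarith) ht]
    congr 1
    rw [show -α - 1 + 1 = -α by ring]
    field_simp
  · exact (integrableOn_Ioi_rpow_of_lt (by linarith) ht).const_mul α
  · filter_upwards [ae_restrict_mem measurableSet_Ioi] with x hx
    exact mul_nonneg hα.le (Real.rpow_nonneg (ht.trans hx).le _)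

end Intensity

/-! ### Poisson point processes: Campbell's formula and simple functions. -/

section Poisson

theorem lintegral_natCast_poissonMeasure (r : NNReal) :
    ∫⁻ n, (n : ENNReal) ∂(poissonMeasure r) = r := by
  have h1 : ∑' n : ℕ, ENNReal.ofReal (Real.exp (-r) * r ^ n / n.factorial) = 1 := by
    rw [← ENNReal.ofReal_tsum_of_nonneg (fun n => by positivity)
      (hasSum_one_poissonMeasure r).summable, (hasSum_one_poissonMeasure r).tsum_eq,
      ENNReal.ofReal_one]
  unfold poissonMeasure
  simp only [lintegral_sum_measure, lintegral_smul_measure, lintegral_dirac, smul_eq_mul]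
  rw [tsum_eq_zero_add' ENNReal.summable]
  have h2 : ∀ n : ℕ, ENNReal.ofReal (Real.exp (-r) * r ^ (n + 1) / (n + 1).factorial) *
      ((n + 1 : ℕ) : ENNReal) =
      r * ENNReal.ofReal (Real.exp (-r) * r ^ n / n.factorial) := by
    intro n
    rw [← ENNReal.ofReal_natCast, ← ENNReal.ofReal_mul (by positivity),
      ← ENNReal.ofReal_coe_nnreal, ← ENNReal.ofReal_mul (by positivity)]
    congr 1
    rw [Nat.factorial_succ]
    push_cast
    field_simp
    rw [pow_succ, mul_comm]
  simp only [h2, ENNReal.tsum_mul_left, h1]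
  simp

theorem integral_pow_poissonMeasure (r : NNReal) (b : ℝ) :
    ∫ n, b ^ n ∂(poissonMeasure r) = Real.exp (-(r * (1 - b))) := by
  rw [integral_poissonMeasure]
  have h := (NormedSpace.expSeries_div_hasSum_exp (r * b : ℝ)).mul_left (Real.exp (-r))
  rw [← Real.exp_eq_exp_ℝ, ← Real.exp_add] at h
  rw [show -((r : ℝ) * (1 - b)) = -r + r * b by ring, ← h.tsum_eq]
  congr 1
  ext n
  rw [smul_eq_mul, mul_pow]
  ring

/-- Turns products over points into powers of counts. Working with truncations `i < K` avoids
infinite products. -/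
theorem eventually_prod_range_eq {m : ℕ} {B : Fin m → Set ℕ} (hB : ∀ j, (B j).Finite)
    (b : Fin m → ℝ) [∀ i j, Decidable (i ∈ B j)] : ∀ᶠ K in atTop,
      ∏ i ∈ Finset.range K, ∏ j, (if i ∈ B j then b j else 1) = ∏ j, b j ^ (B j).ncard := by
  have h : ∀ᶠ K in atTop, ∀ j, B j ⊆ Set.Iio K := by
    refine eventually_all.mpr fun j => ?_
    obtain ⟨M, hM⟩ := (hB j).bddAbove
    filter_upwards [eventually_gt_atTop M] with K hK i hi using (hM hi).trans_lt hK
  filter_upwards [h] with K hK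
  rw [Finset.prod_comm]
  refine Finset.prod_congr rfl fun j _ => ?_
  rw [Finset.prod_ite, Finset.prod_const, Finset.prod_const_one, mul_one,
    ← Set.ncard_coe_finset]
  congr 2
  ext i
  simp only [Finset.coe_filter, Finset.mem_range]
  exact ⟨fun h => h.2, fun h => ⟨hK j h, h⟩⟩

theorem abs_prod_sub_prod_le {ι : Type*} (s : Finset ι) {a b : ι → ℝ}
    (ha : ∀ i, a i ∈ Set.Icc (0 : ℝ) 1) (hb : ∀ i, b i ∈ Set.Icc (0 : ℝ) 1) :
    |∏ i ∈ s, a i - ∏ i ∈ s, b i| ≤ ∑ i ∈ s, |a i - b i| := by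
  classical
  induction s using Finset.induction_on with
  | empty => simp
  | insert i s hi ih =>
    rw [Finset.prod_insert hi, Finset.prod_insert hi, Finset.sum_insert hi]
    have h1 : a i * ∏ j ∈ s, a j - b i * ∏ j ∈ s, b j =
        (a i - b i) * ∏ j ∈ s, a j + b i * (∏ j ∈ s, a j - ∏ j ∈ s, b j) := by ring
    rw [h1]
    refine (abs_add_le _ _).trans (add_le_add ?_ ?_)
    · rw [abs_mul]
      refine mul_le_of_le_one_right (abs_nonneg _) ?_
      rw [abs_of_nonneg (Finset.prod_nonneg fun j _ => (ha j).1)]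
      exact Finset.prod_le_one (fun j _ => (ha j).1) fun j _ => (ha j).2
    · rw [abs_mul, abs_of_nonneg (hb i).1]
      exact (mul_le_of_le_one_left (abs_nonneg _) (hb i).2).trans ih

variable {Ω E : Type*} [MeasurableSpace Ω] [MeasurableSpace E] {P : Measure Ω}
  {ν : Measure E}

/-- Both sides are the expected number of points in `A`: by summing indicators, and as the mean of a
Poisson law. -/
theorem IsPoissonPointProcess.tsum_measure_eq {ι : Type*} [Countable ι] {ξ : ι → Ω → E}
    (h : IsPoissonPointProcess ξ ν P) {A : Set E} (hA : MeasurableSet A) (hνA : ν A ≠ ⊤) :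
    ∑' i, P (ξ i ⁻¹' A) = ν A := by
  have h1 : ∀ i, P (ξ i ⁻¹' A) = ∫⁻ w, (ξ i ⁻¹' A).indicator 1 w ∂P := fun i =>
    (lintegral_indicator_one (h.measurable i hA)).symm
  simp only [h1]
  rw [← lintegral_tsum fun i => (measurable_one.indicator (h.measurable i hA)).aemeasurable]
  have h2 : ∀ w, ∑' i, (ξ i ⁻¹' A).indicator (1 : Ω → ENNReal) w =
      (({i | ξ i w ∈ A}.encard : ℕ∞) : ENNReal) := by
    intro w
    rw [← ENNReal.tsum_set_one]
    exact (tsum_subtype {i | ξ i w ∈ A} fun _ => (1 : ENNReal)).symm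
  simp only [h2]
  rw [(h.law A hA hνA).lintegral_comp (f := fun n : ℕ∞ => (n : ENNReal)) (by fun_prop),
    lintegral_map (by fun_prop) (by fun_prop)]
  simp only [ENat.toENNReal_coe]
  rw [lintegral_natCast_poissonMeasure, ENNReal.coe_toNNReal hνA]

/-- Campbell's formula: the laws of the points of a Poisson point process add up to the intensity
measure. -/
theorem IsPoissonPointProcess.sum_map {ι : Type*} [Countable ι] [SigmaFinite ν] {ξ : ι → Ω → E}
    (h : IsPoissonPointProcess ξ ν P) : Measure.sum (fun i => P.map (ξ i)) = ν := by
  have hfin : ∀ A : Set E, MeasurableSet A → ν A ≠ ⊤ → Measure.sum (fun i => P.map (ξ i)) A = ν A := by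
    intro A hA hνA
    rw [Measure.sum_apply _ hA, ← h.tsum_measure_eq hA hνA]
    exact tsum_congr fun i => Measure.map_apply (h.measurable i) hA
  ext A hA
  -- The defining property concerns sets of finite measure only; σ-finiteness extends it to all
  -- measurable sets.
  have hU : A = ⋃ n, A ∩ spanningSets ν n := by
    rw [← Set.inter_iUnion, iUnion_spanningSets, Set.inter_univ]
  have hmono : Monotone fun n => A ∩ spanningSets ν n := fun a b hab =>
    Set.inter_subset_inter_right _ (monotone_spanningSets ν hab)
  rw [hU, hmono.measure_iUnion, hmono.measure_iUnion]
  exact iSup_congr fun n => hfin _ (hA.inter (measurableSet_spanningSets ν n))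
    (ne_top_of_le_ne_top (measure_spanningSets_lt_top ν n).ne (measure_mono Set.inter_subset_right))

theorem IsPoissonPointProcess.ae_finite {ξ : ℕ → Ω → E}
    (h : IsPoissonPointProcess ξ ν P) {A : Set E} (hA : MeasurableSet A) (hνA : ν A ≠ ⊤) :
    ∀ᵐ w ∂P, {i | ξ i w ∈ A}.Finite :=
  ae_finite_setOfPred_mem (s := fun i => ξ i ⁻¹' A) (by rwa [h.tsum_measure_eq hA hνA])

variable [IsProbabilityMeasure P]

-- The Laplace functional of a simple function: in the limit the product is `∏ b j ^ N j` with
-- independent Poisson counts `N j`, whose generating functions multiply.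
open Classical in
theorem IsPoissonPointProcess.tendsto_integral_prod_ite {ξ : ℕ → Ω → E}
    (h : IsPoissonPointProcess ξ ν P) {m : ℕ} {A : Fin m → Set E} (hA : ∀ j, MeasurableSet (A j))
    (hνA : ∀ j, ν (A j) ≠ ⊤) (hdisj : Pairwise fun j l => Disjoint (A j) (A l)) {b : Fin m → ℝ}
    (hb : ∀ j, b j ∈ Set.Icc (0 : ℝ) 1) :
    Tendsto (fun K => ∫ w, ∏ i ∈ Finset.range K, ∏ j, (if ξ i w ∈ A j then b j else 1) ∂P) atTop
      (𝓝 (Real.exp (-∑ j, ν.real (A j) * (1 - b j)))) := by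
  have hval : ∫ w, ∏ j, b j ^ {i | ξ i w ∈ A j}.ncard ∂P =
      Real.exp (-∑ j, ν.real (A j) * (1 - b j)) := by
    have := (h.indep m A hA hdisj).integral_fun_prod_comp
      (f := fun j (n : ℕ∞) => b j ^ n.toNat)
      (fun j => (h.law (A j) (hA j) (hνA j)).aemeasurable)
      (fun j => (Measurable.of_discrete (f := fun n : ℕ => b j ^ n)).comp
        (by fun_prop) |>.aestronglyMeasurable)
    rw [show (fun w => ∏ j, b j ^ {i | ξ i w ∈ A j}.ncard) =
      fun w => ∏ j, b j ^ ({i | ξ i w ∈ A j}.encard).toNat from rfl, this, ← Finset.sum_neg_distrib,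
      Real.exp_sum]
    refine Finset.prod_congr rfl fun j _ => ?_
    have hm : Measurable fun n : ℕ∞ => b j ^ n.toNat :=
      (Measurable.of_discrete (f := fun n : ℕ => b j ^ n)).comp (by fun_prop)
    refine ((h.law (A j) (hA j) (hνA j)).integral_comp (f := fun n : ℕ∞ => b j ^ n.toNat)
      hm.aestronglyMeasurable).trans ?_
    rw [integral_map (by fun_prop) hm.aestronglyMeasurable]
    simp only [ENat.toNat_natCast]
    rw [integral_pow_poissonMeasure]
    rfl
  rw [← hval]
  refine tendsto_integral_of_dominated_convergence (fun _ => 1) (fun K => ?_) (integrable_const _)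
    (fun K => ae_of_all _ fun w => ?_) ?_
  · refine (Finset.measurable_fun_prod _ fun i _ => Finset.measurable_fun_prod _ fun j _ =>
      Measurable.ite (h.measurable i (hA j)) measurable_const measurable_const).aestronglyMeasurable
  · have h01 : ∀ i, ∀ j, (if ξ i w ∈ A j then b j else 1) ∈ Set.Icc (0 : ℝ) 1 := by
      intro i j
      split_ifs
      exacts [hb j, ⟨zero_le_one, le_rfl⟩]
    rw [Real.norm_eq_abs, abs_of_nonneg
      (Finset.prod_nonneg fun i _ => Finset.prod_nonneg fun j _ => (h01 i j).1)]
    exact Finset.prod_le_one (fun i _ => Finset.prod_nonneg fun j _ => (h01 i j).1)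
      fun i _ => Finset.prod_le_one (fun j _ => (h01 i j).1) fun j _ => (h01 i j).2
  · filter_upwards [ae_all_iff.mpr fun j => h.ae_finite (hA j) (hνA j)] with w hw
    refine tendsto_const_nhds.congr' ?_
    filter_upwards [eventually_prod_range_eq hw b] with K hK
    exact hK.symm

end Poisson


/-! ### The Laplace functional by discretization. -/

section LaplaceFunctional

/-- At most one factor differs from `1`. This puts a discretized function into the form required by
`IsPoissonPointProcess.tendsto_integral_prod_ite`. -/
theorem prod_ite_floor_eq {m : ℕ} (hm : 0 < m) {u : ℝ} (hu : u ∈ Set.Icc (0 : ℝ) 1) :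
    ∏ j : Fin m, (if ⌊m * u⌋₊ = (j : ℕ) + 1 then 1 - ((j : ℝ) + 1) / m else 1) =
      1 - (⌊m * u⌋₊ : ℝ) / m := by
  have hle : ⌊m * u⌋₊ ≤ m := by
    refine Nat.floor_le_of_le ?_
    exact mul_le_of_le_one_right (by positivity) hu.2
  rcases Nat.eq_zero_or_pos ⌊m * u⌋₊ with h0 | h0
  · rw [h0]
    simp
  · rw [Finset.prod_eq_single (⟨⌊m * u⌋₊ - 1, by omega⟩ : Fin m)]
    · have h1 : ⌊(m : ℝ) * u⌋₊ = (⌊m * u⌋₊ - 1) + 1 := by omega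
      rw [if_pos h1]
      have h2 : ((⌊(m : ℝ) * u⌋₊ - 1 : ℕ) : ℝ) + 1 = ⌊m * u⌋₊ := by exact_mod_cast h1.symm
      rw [h2]
    · intro j _ hj
      refine if_neg fun h => hj (Fin.ext ?_)
      simp only
      omega
    · simp

theorem abs_sub_floor_div_le {m : ℕ} (hm : 0 < m) {u : ℝ} (hu : u ∈ Set.Icc (0 : ℝ) 1) :
    |u - (⌊m * u⌋₊ : ℝ) / m| ≤ u ∧ |u - (⌊m * u⌋₊ : ℝ) / m| ≤ 1 / m ∧
      1 - (⌊m * u⌋₊ : ℝ) / m ∈ Set.Icc (0 : ℝ) 1 := by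
  have hm' : (0 : ℝ) < m := by exact_mod_cast hm
  have h0 : 0 ≤ m * u := mul_nonneg hm'.le hu.1
  have h1 : (⌊m * u⌋₊ : ℝ) / m ≤ u := by
    rw [div_le_iff₀ hm', mul_comm u]
    exact Nat.floor_le h0
  have h2 : u ≤ (⌊m * u⌋₊ : ℝ) / m + 1 / m := by
    rw [← add_div, le_div_iff₀ hm', mul_comm u]
    exact (Nat.lt_floor_add_one _).le
  have h3 : 0 ≤ (⌊m * u⌋₊ : ℝ) / m := by positivity
  rw [abs_of_nonneg (by linarith)]
  exact ⟨by linarith, by linarith, by linarith [hu.2], by linarith⟩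

variable {Ω E : Type*} [MeasurableSpace Ω] [MeasurableSpace E] {P : Measure Ω}
  {ν : Measure E}

theorem IsPoissonPointProcess.sum_integral_le [SigmaFinite ν] {ξ : ℕ → Ω → E}
    (h : IsPoissonPointProcess ξ ν P) {f : E → ℝ} (hf : Integrable f ν) (hf0 : ∀ x, 0 ≤ f x)
    (K : ℕ) : (∀ i, Integrable (fun w => f (ξ i w)) P) ∧
      ∑ i ∈ Finset.range K, ∫ w, f (ξ i w) ∂P ≤ ∫ x, f x ∂ν := by
  have hs := h.sum_map
  have hf' : Integrable f (Measure.sum fun i => P.map (ξ i)) := by rwa [hs]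
  have hi : ∀ i, Integrable f (P.map (ξ i)) := fun i => hf'.mono_measure (Measure.le_sum _ i)
  have hmap : ∀ i, ∫ x, f x ∂(P.map (ξ i)) = ∫ w, f (ξ i w) ∂P := fun i =>
    integral_map (h.measurable i).aemeasurable (hi i).aestronglyMeasurable
  refine ⟨fun i => (hi i).comp_measurable (h.measurable i), ?_⟩
  have hsum := hasSum_integral_measure hf'
  rw [hs] at hsum
  simp only [hmap] at hsum
  exact sum_le_hasSum _ (fun i _ => integral_nonneg fun w => hf0 _) hsum

/-- The difference of the products is at most the sum of `|ψ - φ|` over the points, which Campbell's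
formula integrates. The bound is uniform in `K`, so the discretization can be fixed before `K` tends
to infinity. -/
theorem IsPoissonPointProcess.abs_integral_prod_sub_le [IsProbabilityMeasure P] [SigmaFinite ν]
    {ξ : ℕ → Ω → E}
    (h : IsPoissonPointProcess ξ ν P) {ψ φ : E → ℝ} (hψm : Measurable ψ) (hφm : Measurable φ)
    (hψ : ∀ x, ψ x ∈ Set.Icc (0 : ℝ) 1) (hφ : ∀ x, φ x ∈ Set.Icc (0 : ℝ) 1)
    (hint : Integrable (fun x => |ψ x - φ x|) ν) (K : ℕ) :
    |∫ w, ∏ i ∈ Finset.range K, ψ (ξ i w) ∂P - ∫ w, ∏ i ∈ Finset.range K, φ (ξ i w) ∂P| ≤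
      ∫ x, |ψ x - φ x| ∂ν := by
  have hI : ∀ {χ : E → ℝ}, Measurable χ → (∀ x, χ x ∈ Set.Icc (0 : ℝ) 1) →
      Integrable (fun w => ∏ i ∈ Finset.range K, χ (ξ i w)) P := by
    intro χ hχm hχ
    refine Integrable.of_bound (C := 1) (Finset.measurable_fun_prod _ fun i _ =>
      hχm.comp (h.measurable i)).aestronglyMeasurable (ae_of_all _ fun w => ?_)
    rw [Real.norm_eq_abs, abs_of_nonneg (Finset.prod_nonneg fun i _ => (hχ _).1)]
    exact Finset.prod_le_one (fun i _ => (hχ _).1) fun i _ => (hχ _).2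
  have hs := h.sum_integral_le hint (fun x => abs_nonneg _) K
  rw [← integral_sub (hI hψm hψ) (hI hφm hφ), ← Real.norm_eq_abs]
  refine le_trans (norm_integral_le_of_norm_le (integrable_finsetSum _ fun i _ => hs.1 i)
    (ae_of_all _ fun w => ?_)) ((integral_finsetSum _ fun i _ => hs.1 i).trans_le hs.2)
  exact abs_prod_sub_prod_le _ (fun i => hψ _) fun i => hφ _

theorem IsPoissonPointProcess.tendsto_integral_prod_floor [IsProbabilityMeasure P]
    {ξ : ℕ → Ω → E}
    (h : IsPoissonPointProcess ξ ν P) {f : E → ℝ} (hfm : Measurable f)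
    (hf : ∀ x, f x ∈ Set.Icc (0 : ℝ) 1) (hint : Integrable f ν) {m : ℕ} (hm : 0 < m) :
    Tendsto (fun K => ∫ w, ∏ i ∈ Finset.range K, (1 - (⌊m * f (ξ i w)⌋₊ : ℝ) / m) ∂P) atTop
      (𝓝 (Real.exp (-∫ x, (⌊m * f x⌋₊ : ℝ) / m ∂ν))) := by
  classical
  have hm' : (0 : ℝ) < m := by exact_mod_cast hm
  -- The level set of `0` is omitted, since its measure may be infinite; the others lie in `{f ≥ 1 /
  -- m}`, which is of finite measure because `f` is integrable.
  let A : Fin m → Set E := fun j => {x | ⌊m * f x⌋₊ = (j : ℕ) + 1}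
  have hfl : Measurable fun x => ⌊m * f x⌋₊ := Nat.measurable_floor.comp (hfm.const_mul _)
  have hA : ∀ j, MeasurableSet (A j) := fun j => hfl (measurableSet_singleton _)
  have hνA : ∀ j, ν (A j) ≠ ⊤ := by
    intro j
    refine ((measure_mono ?_).trans_lt
      (hint.measure_norm_ge_lt_top (show (0 : ℝ) < 1 / m by positivity))).ne
    intro x hx
    have h1 : (1 : ℝ) ≤ m * f x := by
      rw [← Nat.one_le_floor_iff, show ⌊m * f x⌋₊ = (j : ℕ) + 1 from hx]
      omega
    rw [Set.mem_ofPred_eq, Real.norm_eq_abs, abs_of_nonneg (hf x).1, div_le_iff₀ hm', mul_comm]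
    exact h1
  have hdisj : Pairwise fun j l => Disjoint (A j) (A l) := by
    intro j l hjl
    refine Set.disjoint_left.mpr fun x hx hx' => hjl (Fin.ext ?_)
    have h1 : ⌊m * f x⌋₊ = (j : ℕ) + 1 := hx
    have h2 : ⌊m * f x⌋₊ = (l : ℕ) + 1 := hx'
    omega
  have hb : ∀ j : Fin m, 1 - ((j : ℝ) + 1) / m ∈ Set.Icc (0 : ℝ) 1 := by
    intro j
    have h1 : ((j : ℝ) + 1) / m ≤ 1 := by
      rw [div_le_one hm']
      exact_mod_cast j.2
    have h2 : 0 ≤ ((j : ℝ) + 1) / m := by positivity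
    exact ⟨by linarith, by linarith⟩
  have key := h.tendsto_integral_prod_ite hA hνA hdisj hb
  have hsum : ∑ j, ν.real (A j) * (1 - (1 - ((j : ℝ) + 1) / m)) =
      ∫ x, (⌊m * f x⌋₊ : ℝ) / m ∂ν := by
    have hi : ∀ j : Fin m, Integrable ((A j).indicator fun _ => ((j : ℝ) + 1) / m) ν := fun j =>
      (integrable_indicator_iff (hA j)).mpr (integrableOn_const (hνA j))
    have heq : ∀ x, (⌊m * f x⌋₊ : ℝ) / m =
        ∑ j : Fin m, (A j).indicator (fun _ => ((j : ℝ) + 1) / m) x := by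
      intro x
      by_cases hx : ∃ j, x ∈ A j
      · obtain ⟨j, hj⟩ := hx
        rw [Finset.sum_eq_single j]
        · rw [Set.indicator_of_mem hj, show ⌊m * f x⌋₊ = (j : ℕ) + 1 from hj]
          push_cast
          rfl
        · intro l _ hl
          exact Set.indicator_of_notMem
            (fun hx => Set.disjoint_left.mp (hdisj hl) hx hj) _
        · simp
      · push Not at hx
        rw [Finset.sum_eq_zero fun j _ => Set.indicator_of_notMem (hx j) _]
        have hle : ⌊m * f x⌋₊ ≤ m :=
          Nat.floor_le_of_le (mul_le_of_le_one_right (by positivity) (hf x).2)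
        have : ⌊m * f x⌋₊ = 0 := by
          by_contra hne
          refine hx ⟨⌊m * f x⌋₊ - 1, by omega⟩ ?_
          change ⌊m * f x⌋₊ = ⌊m * f x⌋₊ - 1 + 1
          omega
        rw [this]
        simp
    simp only [heq]
    rw [integral_finsetSum _ fun j _ => hi j]
    refine Finset.sum_congr rfl fun j _ => ?_
    rw [integral_indicator_const _ (hA j)]
    simp
  rw [hsum] at key
  refine key.congr fun K => integral_congr_ae (ae_of_all _ fun w => ?_)
  refine Finset.prod_congr rfl fun i _ => ?_
  refine Eq.trans ?_ (prod_ite_floor_eq hm (hf (ξ i w)))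
  refine Finset.prod_congr rfl fun j _ => ?_
  by_cases hij : ⌊m * f (ξ i w)⌋₊ = (j : ℕ) + 1
  · exact (if_pos hij).trans (if_pos hij).symm
  · exact (if_neg hij).trans (if_neg hij).symm

/-- The Laplace functional of a Poisson point process. -/
theorem IsPoissonPointProcess.tendsto_integral_prod [IsProbabilityMeasure P] [SigmaFinite ν]
    {ξ : ℕ → Ω → E}
    (h : IsPoissonPointProcess ξ ν P) {ψ : E → ℝ} (hψm : Measurable ψ)
    (hψ : ∀ x, ψ x ∈ Set.Icc (0 : ℝ) 1) (hint : Integrable (fun x => 1 - ψ x) ν) :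
    Tendsto (fun K => ∫ w, ∏ i ∈ Finset.range K, ψ (ξ i w) ∂P) atTop
      (𝓝 (Real.exp (-∫ x, (1 - ψ x) ∂ν))) := by
  let f : E → ℝ := fun x => 1 - ψ x
  have hfm : Measurable f := measurable_const.sub hψm
  have hf : ∀ x, f x ∈ Set.Icc (0 : ℝ) 1 := fun x =>
    ⟨sub_nonneg.mpr (hψ x).2, sub_le_self _ (hψ x).1⟩
  let φ : ℕ → E → ℝ := fun m x => 1 - (⌊m * f x⌋₊ : ℝ) / m
  have hφm : ∀ m, Measurable (φ m) := fun m =>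
    measurable_const.sub ((measurable_from_top.comp
      (Nat.measurable_floor.comp (hfm.const_mul _))).div_const _)
  have hdiff : ∀ m x, |ψ x - φ m x| = |f x - (⌊m * f x⌋₊ : ℝ) / m| := by
    intro m x
    rw [← abs_neg]
    congr 1
    simp only [φ, f]
    ring
  have hintd : ∀ m, 0 < m → Integrable (fun x => |ψ x - φ m x|) ν := by
    intro m hm
    refine hint.mono' (hψm.sub (hφm m)).abs.aestronglyMeasurable (ae_of_all _ fun x => ?_)
    rw [Real.norm_eq_abs, abs_abs, hdiff]
    exact (abs_sub_floor_div_le hm (hf x)).1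
  have hintφ : ∀ m : ℕ, 0 < m → Integrable (fun x => (⌊m * f x⌋₊ : ℝ) / m) ν := by
    intro m hm
    refine hint.mono' ((measurable_from_top.comp
      (Nat.measurable_floor.comp (hfm.const_mul _))).div_const _).aestronglyMeasurable
      (ae_of_all _ fun x => ?_)
    have h1 := (abs_sub_floor_div_le hm (hf x)).2.2
    have h2 := (abs_sub_floor_div_le hm (hf x)).1
    rw [Real.norm_eq_abs, abs_of_nonneg (by positivity)]
    change _ ≤ f x
    have hm' : (0 : ℝ) < m := by exact_mod_cast hm
    rw [div_le_iff₀ hm', mul_comm (f x)]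
    exact Nat.floor_le (mul_nonneg hm'.le (hf x).1)
  have hlim : Tendsto (fun m => ∫ x, |ψ x - φ m x| ∂ν) atTop (𝓝 0) := by
    have := tendsto_integral_filter_of_dominated_convergence (μ := ν) (l := atTop)
      (F := fun m x => |ψ x - φ m x|) (f := fun _ => 0) f
      (Eventually.of_forall fun m => (hψm.sub (hφm m)).abs.aestronglyMeasurable)
      (by
        filter_upwards [eventually_gt_atTop 0] with m hm
        refine ae_of_all _ fun x => ?_
        rw [Real.norm_eq_abs, abs_abs, hdiff]
        exact (abs_sub_floor_div_le hm (hf x)).1) hint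
      (ae_of_all _ fun x => by
        refine squeeze_zero' (Eventually.of_forall fun m => abs_nonneg _) ?_
          tendsto_one_div_atTop_nhds_zero_nat
        filter_upwards [eventually_gt_atTop 0] with m hm
        rw [hdiff]
        exact (abs_sub_floor_div_le hm (hf x)).2.1)
    simpa using this
  have hIlim : Tendsto (fun m : ℕ => Real.exp (-∫ x, (⌊m * f x⌋₊ : ℝ) / m ∂ν)) atTop
      (𝓝 (Real.exp (-∫ x, (1 - ψ x) ∂ν))) := by
    refine (Real.continuous_exp.tendsto _).comp (Tendsto.neg ?_)
    rw [tendsto_iff_norm_sub_tendsto_zero]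
    refine squeeze_zero' (Eventually.of_forall fun m => norm_nonneg _) ?_ hlim
    filter_upwards [eventually_gt_atTop 0] with m hm
    rw [← integral_sub (hintφ m hm) hint]
    refine (norm_integral_le_integral_norm _).trans (le_of_eq ?_)
    congr 1
    ext x
    rw [hdiff, Real.norm_eq_abs, abs_sub_comm]
  rw [Metric.tendsto_atTop]
  intro ε hε
  obtain ⟨m, hm1, hm2, hm0⟩ := ((Metric.tendsto_nhds.mp hlim (ε / 3) (by positivity)).and
    ((Metric.tendsto_nhds.mp hIlim (ε / 3) (by positivity)).and (eventually_gt_atTop 0))).exists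
  obtain ⟨N, hN⟩ := Metric.tendsto_atTop.mp
    (h.tendsto_integral_prod_floor hfm hf hint hm0) (ε / 3) (by positivity)
  refine ⟨N, fun K hK => ?_⟩
  have h1 := h.abs_integral_prod_sub_le hψm (hφm m) hψ
    (fun x => (abs_sub_floor_div_le hm0 (hf x)).2.2) (hintd m hm0) K
  have h2 := hN K hK
  rw [Real.dist_eq] at hm1 hm2 h2 ⊢
  rw [sub_zero, abs_of_nonneg (integral_nonneg fun x => abs_nonneg _)] at hm1
  rw [abs_le] at h1
  rw [abs_lt] at hm2 h2 ⊢
  simp only [φ] at h1 hm1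
  constructor <;> linarith [h1.1, h1.2, hm2.1, hm2.2, h2.1, h2.2]

end LaplaceFunctional


/-! ### Independent marks and the joint law of counts. -/

section Marking

/-- The points `ξ i` form a Poisson point process with intensity `ν`, and the marks `S i` are
i.i.d. with law `κ` and independent of the points. -/
structure IsMarkedPoisson {Ω E F : Type*} [MeasurableSpace Ω] [MeasurableSpace E]
    [MeasurableSpace F] (ξ : ℕ → Ω → E) (S : ℕ → Ω → F) (ν : Measure E) (κ : Measure F)
    (P : Measure Ω) : Prop where
  poisson : IsPoissonPointProcess ξ ν P
  measurable_mark : ∀ i, Measurable (S i)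
  law_mark : ∀ i, P.map (S i) = κ
  indep_mark : iIndepFun S P
  indep : IndepFun (fun w i => ξ i w) (fun w i => S i w) P

/-- The weight `∏ exp (-p j)`, over the levels `t j` which do not exceed `y`. -/
noncomputable def levelWeight {m : ℕ} (t : Fin m → ℝ) (p : Fin m → ℕ) (y : ℝ) : ℝ :=
  ∏ j, if t j ≤ y then Real.exp (-(p j : ℝ)) else 1

variable {m : ℕ} {t : Fin m → ℝ} {p : Fin m → ℕ}

theorem levelWeight_factor_mem (t : Fin m → ℝ) (p : Fin m → ℕ) (y : ℝ) (j : Fin m) :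
    (if t j ≤ y then Real.exp (-(p j : ℝ)) else 1) ∈ Set.Icc (0 : ℝ) 1 := by
  split_ifs
  · exact ⟨(Real.exp_pos _).le, Real.exp_le_one_iff.mpr (by simp)⟩
  · exact ⟨zero_le_one, le_rfl⟩

theorem levelWeight_mem_Icc (t : Fin m → ℝ) (p : Fin m → ℕ) (y : ℝ) :
    levelWeight t p y ∈ Set.Icc (0 : ℝ) 1 :=
  ⟨Finset.prod_nonneg fun j _ => (levelWeight_factor_mem t p y j).1,
    Finset.prod_le_one (fun j _ => (levelWeight_factor_mem t p y j).1)
      fun j _ => (levelWeight_factor_mem t p y j).2⟩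

theorem measurable_levelWeight (t : Fin m → ℝ) (p : Fin m → ℕ) : Measurable (levelWeight t p) :=
  Finset.measurable_fun_prod _ fun _ _ =>
    Measurable.ite measurableSet_Ici measurable_const measurable_const

/-- `levelWeight` is `1` below all levels, so `1 - levelWeight` is integrable against any measure
with finite tails at the levels, even if its total mass is infinite. -/
theorem one_sub_levelWeight_le (t : Fin m → ℝ) (p : Fin m → ℕ) (y : ℝ) :
    1 - levelWeight t p y ≤ ∑ j, (Set.Ici (t j)).indicator (fun _ => (1 : ℝ)) y := by
  by_cases h : ∃ j, t j ≤ y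
  · obtain ⟨j, hj⟩ := h
    refine (sub_le_self _ (levelWeight_mem_Icc t p y).1).trans ?_
    have h1 : (Set.Ici (t j)).indicator (fun _ => (1 : ℝ)) y = 1 := Set.indicator_of_mem hj _
    refine h1.ge.trans ?_
    exact Finset.single_le_sum (f := fun j => (Set.Ici (t j)).indicator (fun _ => (1 : ℝ)) y)
      (fun l _ => Set.indicator_nonneg (fun _ _ => zero_le_one) _) (Finset.mem_univ j)
  · push Not at h
    have : levelWeight t p y = 1 :=
      Finset.prod_eq_one fun j _ => if_neg (not_le.mpr (h j))
    rw [this, sub_self]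
    exact Finset.sum_nonneg fun j _ => Set.indicator_nonneg (fun _ _ => zero_le_one) _

theorem integrable_one_sub_levelWeight {μ : Measure ℝ} (ht : ∀ j, μ (Set.Ici (t j)) ≠ ⊤)
    (p : Fin m → ℕ) : Integrable (fun y => 1 - levelWeight t p y) μ := by
  refine Integrable.mono' (g := fun y => ∑ j, (Set.Ici (t j)).indicator (fun _ => (1 : ℝ)) y)
    (integrable_finsetSum _ fun j _ => (integrable_indicator_iff measurableSet_Ici).mpr
      (integrableOn_const (ht j)))
    (measurable_const.sub (measurable_levelWeight t p)).aestronglyMeasurable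
    (ae_of_all _ fun y => ?_)
  rw [Real.norm_eq_abs, abs_of_nonneg (sub_nonneg.mpr (levelWeight_mem_Icc t p y).2)]
  exact one_sub_levelWeight_le t p y

variable {Ω E F : Type*} [MeasurableSpace Ω] [MeasurableSpace E] [MeasurableSpace F]
  {P : Measure Ω} [IsProbabilityMeasure P] {ν : Measure E} {κ : Measure F}
  [IsProbabilityMeasure κ] {ξ : ℕ → Ω → E} {S : ℕ → Ω → F}

/-- Each point is independent of its mark, so the pair has law `P.map (ξ i)` times `κ`; Campbell's
formula sums these laws. -/
theorem IsMarkedPoisson.tsum_measure_eq [SigmaFinite ν] (h : IsMarkedPoisson ξ S ν κ P) {B : Set (E × F)}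
    (hB : MeasurableSet B) : ∑' i, P {w | (ξ i w, S i w) ∈ B} = (ν.prod κ) B := by
  have hlaw : ∀ i, P {w | (ξ i w, S i w) ∈ B} = ∫⁻ x, κ (Prod.mk x ⁻¹' B) ∂(P.map (ξ i)) := by
    intro i
    have hi : IndepFun (ξ i) (S i) P := h.indep.comp (measurable_pi_apply i) (measurable_pi_apply i)
    have := (indepFun_iff_map_prod_eq_prod_map_map (h.poisson.measurable i).aemeasurable
      (h.measurable_mark i).aemeasurable).mp hi
    rw [h.law_mark i] at this
    rw [← Measure.prod_apply hB, ← this,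
      Measure.map_apply ((h.poisson.measurable i).prodMk (h.measurable_mark i)) hB]
    rfl
  simp only [hlaw]
  rw [← lintegral_sum_measure, h.poisson.sum_map, Measure.prod_apply hB]

theorem IsMarkedPoisson.ae_finite [SigmaFinite ν] (h : IsMarkedPoisson ξ S ν κ P) {B : Set (E × F)}
    (hB : MeasurableSet B) (hfin : (ν.prod κ) B ≠ ⊤) :
    ∀ᵐ w ∂P, {i | (ξ i w, S i w) ∈ B}.Finite :=
  ae_finite_setOfPred_mem (s := fun i => {w | (ξ i w, S i w) ∈ B})
    ((h.tsum_measure_eq hB).trans_ne hfin)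

/-- Integrates the marks out with the points frozen: the marks are then still i.i.d., so the
integral of the product splits. -/
theorem IsMarkedPoisson.integral_prod_eq (h : IsMarkedPoisson ξ S ν κ P) {G : E × F → ℝ}
    (hGm : Measurable G) (hG : ∀ z, G z ∈ Set.Icc (0 : ℝ) 1) (K : ℕ) :
    ∫ w, ∏ i ∈ Finset.range K, G (ξ i w, S i w) ∂P =
      ∫ w, ∏ i ∈ Finset.range K, ∫ s, G (ξ i w, s) ∂κ ∂P := by
  have hξ : Measurable fun w i => ξ i w := measurable_pi_lambda _ h.poisson.measurable
  have hS : Measurable fun w i => S i w := measurable_pi_lambda _ h.measurable_mark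
  have hpair := (indepFun_iff_map_prod_eq_prod_map_map hξ.aemeasurable hS.aemeasurable).mp h.indep
  let H : (ℕ → E) × (ℕ → F) → ℝ := fun z => ∏ i ∈ Finset.range K, G (z.1 i, z.2 i)
  have hHm : Measurable H := Finset.measurable_fun_prod _ fun i _ => hGm.comp
    (((measurable_pi_apply i).comp measurable_fst).prodMk
      ((measurable_pi_apply i).comp measurable_snd))
  have : IsProbabilityMeasure (P.map fun w i => ξ i w) :=
    Measure.isProbabilityMeasure_map hξ.aemeasurable
  have : IsProbabilityMeasure (P.map fun w i => S i w) :=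
    Measure.isProbabilityMeasure_map hS.aemeasurable
  have hHi : Integrable H ((P.map fun w i => ξ i w).prod (P.map fun w i => S i w)) := by
    refine Integrable.of_bound (C := 1) hHm.aestronglyMeasurable (ae_of_all _ fun z => ?_)
    rw [Real.norm_eq_abs, abs_of_nonneg (Finset.prod_nonneg fun i _ => (hG _).1)]
    exact Finset.prod_le_one (fun i _ => (hG _).1) fun i _ => (hG _).2
  have h1 : ∫ w, ∏ i ∈ Finset.range K, G (ξ i w, S i w) ∂P =
      ∫ z, H z ∂((P.map fun w i => ξ i w).prod (P.map fun w i => S i w)) := by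
    rw [← hpair, integral_map (hξ.prodMk hS).aemeasurable hHm.aestronglyMeasurable]
  have hκm : Measurable fun x => ∫ s, G (x, s) ∂κ :=
    (hGm.stronglyMeasurable.integral_prod_right').measurable
  have h2 : ∀ x : ℕ → E, ∫ s, H (x, s) ∂(P.map fun w i => S i w) =
      ∏ i ∈ Finset.range K, ∫ s, G (x i, s) ∂κ := by
    intro x
    refine (integral_map hS.aemeasurable
      (hHm.comp measurable_prodMk_left).aestronglyMeasurable).trans ?_
    simp only [H, Finset.prod_range]
    have hind : iIndepFun (fun i : Fin K => S i) P := h.indep_mark.precomp Fin.val_injective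
    refine (hind.integral_fun_prod_comp (X := fun i : Fin K => S i)
      (f := fun i s => G (x i, s)) (fun i => (h.measurable_mark i).aemeasurable)
      (fun i => (hGm.comp measurable_prodMk_left).aestronglyMeasurable)).trans ?_
    refine Finset.prod_congr rfl fun i _ => ?_
    rw [← h.law_mark i]
    exact (integral_map (h.measurable_mark i).aemeasurable
      (hGm.comp measurable_prodMk_left).aestronglyMeasurable).symm
  rw [h1, integral_prod _ hHi]
  simp only [h2]
  rw [integral_map hξ.aemeasurable]
  exact (Finset.measurable_fun_prod _ fun i _ =>
    hκm.comp (measurable_pi_apply i)).aestronglyMeasurable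

/-- The marking theorem, in terms of Laplace functionals. -/
theorem IsMarkedPoisson.tendsto_integral_prod [SigmaFinite ν] (h : IsMarkedPoisson ξ S ν κ P)
    {G : E × F → ℝ}
    (hGm : Measurable G) (hG : ∀ z, G z ∈ Set.Icc (0 : ℝ) 1)
    (hint : Integrable (fun z => 1 - G z) (ν.prod κ)) :
    Tendsto (fun K => ∫ w, ∏ i ∈ Finset.range K, G (ξ i w, S i w) ∂P) atTop
      (𝓝 (Real.exp (-∫ z, (1 - G z) ∂(ν.prod κ)))) := by
  have hi : ∀ x, Integrable (fun s => G (x, s)) κ := fun x =>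
    Integrable.of_bound (C := 1) (hGm.comp measurable_prodMk_left).aestronglyMeasurable
      (ae_of_all _ fun s => by rw [Real.norm_eq_abs, abs_of_nonneg (hG _).1]; exact (hG _).2)
  have hsub : ∀ x, ∫ s, (1 - G (x, s)) ∂κ = 1 - ∫ s, G (x, s) ∂κ := fun x => by
    rw [integral_sub (integrable_const _) (hi x)]
    simp
  have h1 := hint.integral_prod_left
  simp only [hsub] at h1
  -- The average of `G` over the mark is a function of the point with values in `[0, 1]`, so the
  -- unmarked theorem applies to it.
  have h2 := h.poisson.tendsto_integral_prod
    (hGm.stronglyMeasurable.integral_prod_right').measurable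
    (fun x => ⟨integral_nonneg fun s => (hG _).1, by
      have := integral_nonneg (μ := κ) (f := fun s => 1 - G (x, s)) fun s =>
        sub_nonneg.mpr (hG _).2
      rw [hsub] at this
      linarith⟩) h1
  rw [integral_prod _ hint]
  simp only [hsub, h.integral_prod_eq hGm hG]
  exact h2

/-- The limit of the truncated products of `levelWeight` is computed twice: dominated convergence
gives the counts, the marking theorem gives the exponential. -/
theorem IsMarkedPoisson.integral_counts_eq [SigmaFinite ν] (h : IsMarkedPoisson ξ S ν κ P)
    {φ : E × F → ℝ}
    (hφ : Measurable φ) (ht : ∀ j, ((ν.prod κ).map φ) (Set.Ici (t j)) ≠ ⊤) (p : Fin m → ℕ) :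
    ∫ w, ∏ j, Real.exp (-({i | t j ≤ φ (ξ i w, S i w)}.ncard : ℝ)) ^ p j ∂P =
      Real.exp (-∫ y, (1 - levelWeight t p y) ∂((ν.prod κ).map φ)) := by
  classical
  have hB : ∀ j, MeasurableSet {z | t j ≤ φ z} := fun j => hφ measurableSet_Ici
  have hint := integrable_one_sub_levelWeight ht p
  have hGm : Measurable fun z => levelWeight t p (φ z) := (measurable_levelWeight t p).comp hφ
  have hlim := h.tendsto_integral_prod hGm (fun z => levelWeight_mem_Icc t p _)
    (hint.comp_measurable hφ)
  rw [integral_map hφ.aemeasurable hint.aestronglyMeasurable]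
  refine tendsto_nhds_unique ?_ hlim
  refine tendsto_integral_of_dominated_convergence (fun _ => 1) (fun K => ?_) (integrable_const _)
    (fun K => ae_of_all _ fun w => ?_) ?_
  · exact (Finset.measurable_fun_prod _ fun i _ => hGm.comp
      ((h.poisson.measurable i).prodMk (h.measurable_mark i))).aestronglyMeasurable
  · rw [Real.norm_eq_abs, abs_of_nonneg
      (Finset.prod_nonneg fun i _ => (levelWeight_mem_Icc t p _).1)]
    exact Finset.prod_le_one (fun i _ => (levelWeight_mem_Icc t p _).1)
      fun i _ => (levelWeight_mem_Icc t p _).2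
  · have hae : ∀ j, ∀ᵐ w ∂P, {i | (ξ i w, S i w) ∈ {z | t j ≤ φ z}}.Finite := fun j =>
      h.ae_finite (hB j) ((Measure.map_apply hφ measurableSet_Ici).symm.trans_ne (ht j))
    filter_upwards [ae_all_iff.mpr hae] with w hw
    refine tendsto_const_nhds.congr' ?_
    filter_upwards [eventually_prod_range_eq hw fun j => Real.exp (-(p j : ℝ))] with K hK
    refine Eq.trans ?_ hK.symm
    refine Finset.prod_congr rfl fun j _ => ?_
    rw [← Real.exp_nat_mul, ← Real.exp_nat_mul]
    congr 1
    ring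

end Marking


/-! ### Half-line indicators as test functions. -/

section Levels

/-- The span of the indicators of the half-lines `[T, ∞)`, `0 < T < 1`. -/
def levelSpan : Submodule ℝ (ℝ → ℝ) :=
  Submodule.span ℝ ((fun T => (Set.Ici T).indicator fun _ => (1 : ℝ)) '' Set.Ioo (0 : ℝ) 1)

theorem indicator_mem_levelSpan {T : ℝ} (hT : T ∈ Set.Ioo (0 : ℝ) 1) :
    ((Set.Ici T).indicator fun _ => (1 : ℝ)) ∈ levelSpan :=
  Submodule.subset_span ⟨T, hT, rfl⟩

theorem mul_mem_levelSpan {f g : ℝ → ℝ} (hf : f ∈ levelSpan) (hg : g ∈ levelSpan) :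
    f * g ∈ levelSpan := by
  induction hf, hg using Submodule.span_induction₂ with
  | mem_mem x y hx hy =>
    obtain ⟨T, hT, rfl⟩ := hx
    obtain ⟨U, hU, rfl⟩ := hy
    have : ((Set.Ici T).indicator fun _ => (1 : ℝ)) * ((Set.Ici U).indicator fun _ => (1 : ℝ)) =
        (Set.Ici (max T U)).indicator fun _ => (1 : ℝ) := by
      ext y
      simp only [Pi.mul_apply, Set.indicator_apply, Set.mem_Ici, sup_le_iff]
      split_ifs <;> simp_all
    rw [this]
    refine indicator_mem_levelSpan ?_
    rcases max_choice T U with h | h <;> rw [h] <;> assumption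
  | zero_left y hy => simp
  | zero_right x hx => simp
  | add_left x y z hx hy hz h1 h2 => rw [add_mul]; exact add_mem h1 h2
  | add_right x y z hx hy hz h1 h2 => rw [mul_add]; exact add_mem h1 h2
  | smul_left r x y hx hy h => rw [smul_mul_assoc]; exact Submodule.smul_mem _ _ h
  | smul_right r x y hx hy h => rw [mul_smul_comm]; exact Submodule.smul_mem _ _ h

/-- Induction over the factors: if `F` is the product so far and `I` the new indicator, then `1 - (1
- d I) F = (1 - F) + d (I - I (1 - F))`, and the span is closed under products. -/
theorem one_sub_levelWeight_mem_levelSpan {m : ℕ} {t : Fin m → ℝ}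
    (ht : ∀ j, t j ∈ Set.Ioo (0 : ℝ) 1) (p : Fin m → ℕ) :
    (fun y => 1 - levelWeight t p y) ∈ levelSpan := by
  have h : ∀ s : Finset (Fin m), (fun y => 1 - ∏ j ∈ s,
      if t j ≤ y then Real.exp (-(p j : ℝ)) else 1) ∈ levelSpan := by
    intro s
    induction s using Finset.induction_on with
    | empty =>
      simp only [Finset.prod_empty, sub_self]
      exact levelSpan.zero_mem
    | insert j s hj ih =>
      have hind := indicator_mem_levelSpan (ht j)
      have := add_mem ih (Submodule.smul_mem _ (1 - Real.exp (-(p j : ℝ)))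
        (sub_mem hind (mul_mem_levelSpan hind ih)))
      convert this using 1
      ext y
      simp only [Finset.prod_insert hj, Pi.add_apply, Pi.smul_apply, Pi.sub_apply, Pi.mul_apply,
        Set.indicator_apply, Set.mem_Ici, smul_eq_mul]
      split_ifs <;> ring
  exact h Finset.univ

/-- Tail convergence at every level extends by linearity, so no continuity of the test function is
needed. Integrability is carried through the induction to make the integrals additive. -/
theorem tendsto_integral_of_mem_levelSpan {μ : ℕ → Measure ℝ} {μ' : Measure ℝ} {c : ℕ → ℝ}
    (hμ : ∀ n, ∀ T ∈ Set.Ioo (0 : ℝ) 1, μ n (Set.Ici T) ≠ ⊤)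
    (hμ' : ∀ T ∈ Set.Ioo (0 : ℝ) 1, μ' (Set.Ici T) ≠ ⊤)
    (h : ∀ T ∈ Set.Ioo (0 : ℝ) 1, Tendsto (fun n => c n * (μ n).real (Set.Ici T)) atTop
      (𝓝 (μ'.real (Set.Ici T)))) {f : ℝ → ℝ} (hf : f ∈ levelSpan) :
    Tendsto (fun n => c n * ∫ y, f y ∂(μ n)) atTop (𝓝 (∫ y, f y ∂μ')) := by
  have key : (∀ n, Integrable f (μ n)) ∧ Integrable f μ' ∧
      Tendsto (fun n => c n * ∫ y, f y ∂(μ n)) atTop (𝓝 (∫ y, f y ∂μ')) := by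
    induction hf using Submodule.span_induction with
    | mem x hx =>
      obtain ⟨T, hT, rfl⟩ := hx
      refine ⟨fun n => (integrable_indicator_iff measurableSet_Ici).mpr
        (integrableOn_const (hμ n T hT)), (integrable_indicator_iff measurableSet_Ici).mpr
        (integrableOn_const (hμ' T hT)), ?_⟩
      simpa [integral_indicator_const _ (measurableSet_Ici : MeasurableSet (Set.Ici T))] using h T hT
    | zero => simp
    | add x y hx hy h1 h2 =>
      refine ⟨fun n => (h1.1 n).add (h2.1 n), h1.2.1.add h2.2.1, ?_⟩
      have h3 := h1.2.2.add h2.2.2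
      simp only [Pi.add_apply, integral_add h1.2.1 h2.2.1]
      refine h3.congr fun n => ?_
      rw [integral_add (h1.1 n) (h2.1 n)]
      ring
    | smul r x hx h1 =>
      refine ⟨fun n => (h1.1 n).smul r, h1.2.1.smul r, ?_⟩
      simp only [Pi.smul_apply, smul_eq_mul, integral_const_mul]
      refine (h1.2.2.const_mul r).congr fun n => ?_
      ring
  exact key.2.2

end Levels

/-! ### The ratios `x / (x + s)` of a marked Poisson process. -/

section Ratio

/-- The law of `x / (x + s)` under `pppIntensity α ⊗ κ`. -/
noncomputable def ratioIntensity (α : ℝ) (κ : Measure ℝ) : Measure ℝ :=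
  ((pppIntensity α).prod κ).map fun z => z.1 / (z.1 + z.2)

theorem measurable_fst_div_add : Measurable fun z : ℝ × ℝ => z.1 / (z.1 + z.2) :=
  measurable_fst.div (measurable_fst.add measurable_snd)

theorem le_div_add_iff {T x s : ℝ} (hT : T ∈ Set.Ioo (0 : ℝ) 1) (hxs : 0 < x + s) :
    T ≤ x / (x + s) ↔ s * (T / (1 - T)) ≤ x := by
  have h1 : 0 < 1 - T := sub_pos.mpr hT.2
  rw [le_div_iff₀ hxs, ← mul_div_assoc, div_le_iff₀ h1]
  constructor <;> intro h <;> linarith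

/-- For a fixed mark `s` the condition is `x ≥ s T / (1 - T)`, and the power-law tail separates `s`
from `T`. The marks thus matter only through their moment of order `-α`. -/
theorem ratioIntensity_Ici {α : ℝ} (hα : 0 < α) {κ : Measure ℝ} [SFinite κ]
    (hκ : ∀ᵐ s ∂κ, 0 < s) {T : ℝ} (hT : T ∈ Set.Ioo (0 : ℝ) 1) :
    ratioIntensity α κ (Set.Ici T) =
      ENNReal.ofReal ((T / (1 - T)) ^ (-α)) * ∫⁻ s, ENNReal.ofReal (s ^ (-α)) ∂κ := by
  have h1 : 0 < T / (1 - T) := div_pos hT.1 (sub_pos.mpr hT.2)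
  have hm : Measurable fun s : ℝ => ENNReal.ofReal (s ^ (-α)) := by fun_prop
  unfold ratioIntensity
  rw [Measure.map_apply measurable_fst_div_add measurableSet_Ici,
    Measure.prod_apply_symm (measurable_fst_div_add measurableSet_Ici), ← lintegral_const_mul _ hm]
  refine lintegral_congr_ae ?_
  filter_upwards [hκ] with s hs
  have hpos : ∀ᵐ x ∂(pppIntensity α), 0 < x := by
    rw [ae_iff]
    simp only [not_lt]
    exact pppIntensity_Iic_zero α
  have h2 : pppIntensity α ((fun x => (x, s)) ⁻¹'
      ((fun z : ℝ × ℝ => z.1 / (z.1 + z.2)) ⁻¹' Set.Ici T)) =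
      pppIntensity α (Set.Ici (s * (T / (1 - T)))) := by
    refine measure_congr ?_
    filter_upwards [hpos] with x hx
    exact eq_iff_iff.mpr (le_div_add_iff hT (add_pos hx hs))
  rw [h2, pppIntensity_Ici hα (mul_pos hs h1), Real.mul_rpow hs.le h1.le, mul_comm,
    ENNReal.ofReal_mul (Real.rpow_nonneg h1.le _)]

theorem IsMarkedPoisson.measurable_ratio {Ω : Type*} [MeasurableSpace Ω] {P : Measure Ω} {α : ℝ}
    {κ : Measure ℝ} {ξ S : ℕ → Ω → ℝ} (h : IsMarkedPoisson ξ S (pppIntensity α) κ P) (i : ℕ) :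
    Measurable fun w => ξ i w / (ξ i w + S i w) :=
  (h.poisson.measurable i).div ((h.poisson.measurable i).add (h.measurable_mark i))

variable {Ω : Type*} [MeasurableSpace Ω] {P : Measure Ω} [IsProbabilityMeasure P] {α : ℝ}
  {κ : Measure ℝ} [IsProbabilityMeasure κ] {ξ S : ℕ → Ω → ℝ}

/-- By Campbell's formula the law of each point is dominated by the intensity, which does not charge
`(-∞, 0]`. -/
theorem IsMarkedPoisson.ae_pos {Ω : Type*} [MeasurableSpace Ω] {P : Measure Ω} {α : ℝ}
    {κ : Measure ℝ} {ξ S : ℕ → Ω → ℝ} (h : IsMarkedPoisson ξ S (pppIntensity α) κ P)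
    (hκ : ∀ᵐ s ∂κ, 0 < s) : ∀ᵐ w ∂P, ∀ i, 0 < ξ i w ∧ 0 < S i w := by
  refine ae_all_iff.mpr fun i => ?_
  have h1 : ∀ᵐ w ∂P, 0 < ξ i w := by
    have h0 : (Measure.sum fun i => P.map (ξ i)) (Set.Iic 0) = 0 := by
      rw [h.poisson.sum_map]
      exact pppIntensity_Iic_zero α
    have h2 : (P.map (ξ i)) (Set.Iic 0) = 0 := le_antisymm
      ((Measure.le_sum (fun i => P.map (ξ i)) i _).trans h0.le) zero_le
    rw [Measure.map_apply (h.poisson.measurable i) measurableSet_Iic] at h2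
    rw [ae_iff]
    simp only [not_lt]
    exact h2
  have h3 : ∀ᵐ w ∂P, 0 < S i w := by
    refine (ae_map_iff (h.measurable_mark i).aemeasurable measurableSet_Ioi).mp ?_
    rw [h.law_mark i]
    exact hκ
  filter_upwards [h1, h3] with w h1 h3 using ⟨h1, h3⟩

theorem div_add_mem_Ioo {x s : ℝ} (hx : 0 < x) (hs : 0 < s) : x / (x + s) ∈ Set.Ioo (0 : ℝ) 1 :=
  ⟨by positivity, by rw [div_lt_one (by positivity)]; linarith⟩

theorem IsMarkedPoisson.ae_finite_ratio (h : IsMarkedPoisson ξ S (pppIntensity α) κ P)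
    (hfin : ∀ T ∈ Set.Ioo (0 : ℝ) 1, ratioIntensity α κ (Set.Ici T) ≠ ⊤) :
    ∀ᵐ w ∂P, ∀ s : ℝ, 0 < s → {i | s ≤ ξ i w / (ξ i w + S i w)}.Finite := by
  -- Countably many levels suffice; `n + 2` keeps them strictly below `1`.
  have h1 : ∀ n : ℕ, ∀ᵐ w ∂P, {i | 1 / ((n : ℝ) + 2) ≤ ξ i w / (ξ i w + S i w)}.Finite := by
    intro n
    refine h.ae_finite (B := (fun z : ℝ × ℝ => z.1 / (z.1 + z.2)) ⁻¹' Set.Ici (1 / ((n : ℝ) + 2)))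
      (measurable_fst_div_add measurableSet_Ici) ?_
    rw [← Measure.map_apply measurable_fst_div_add measurableSet_Ici]
    refine hfin _ ⟨by positivity, ?_⟩
    rw [div_lt_one (by positivity)]
    linarith [(Nat.cast_nonneg n : (0 : ℝ) ≤ n)]
  filter_upwards [ae_all_iff.mpr h1] with w hw s hs
  obtain ⟨n, hn⟩ := exists_nat_one_div_lt hs
  refine (hw n).subset fun i (hi : s ≤ _) => show _ ≤ _ from le_trans (le_trans ?_ hn.le) hi
  exact one_div_le_one_div_of_le (by positivity) (by linarith)

theorem IsMarkedPoisson.integral_counts_ratio_eq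
    (h : IsMarkedPoisson ξ S (pppIntensity α) κ P)
    (hfin : ∀ T ∈ Set.Ioo (0 : ℝ) 1, ratioIntensity α κ (Set.Ici T) ≠ ⊤) {m : ℕ} {t : Fin m → ℝ}
    (ht : ∀ j, t j ∈ Set.Ioo (0 : ℝ) 1) (p : Fin m → ℕ) :
    ∫ w, ∏ j, Real.exp (-({i | t j ≤ ξ i w / (ξ i w + S i w)}.ncard : ℝ)) ^ p j ∂P =
      Real.exp (-∫ y, (1 - levelWeight t p y) ∂(ratioIntensity α κ)) :=
  h.integral_counts_eq measurable_fst_div_add (fun j => hfin _ (ht j)) p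

/-- A ranking criterion for convergence to the ratios of a marked Poisson point process. -/
theorem IsMarkedPoisson.tendstoInDistribution_ranked
    (h : IsMarkedPoisson ξ S (pppIntensity α) κ P) (hκ : ∀ᵐ s ∂κ, 0 < s)
    (hfin : ∀ T ∈ Set.Ioo (0 : ℝ) 1, ratioIntensity α κ (Set.Ici T) ≠ ⊤)
    {Θ : ℕ → Type*} [∀ n, MeasurableSpace (Θ n)] {Q : ∀ n, Measure (Θ n)}
    [∀ n, IsProbabilityMeasure (Q n)] {ι : ℕ → Type*} [∀ n, Countable (ι n)]
    {y : ∀ n, ι n → Θ n → ℝ} (hy : ∀ n i, Measurable (y n i))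
    (h01 : ∀ n, ∀ᵐ w ∂Q n, ∀ i, y n i w ∈ Set.Icc (0 : ℝ) 1)
    (hyfin : ∀ n, ∀ᵐ w ∂Q n, ∀ s : ℝ, 0 < s → {i | s ≤ y n i w}.Finite)
    (hcounts : ∀ (m : ℕ) (t : Fin m → ℝ), (∀ j, t j ∈ Set.Ioo (0 : ℝ) 1) → ∀ p : Fin m → ℕ,
      Tendsto (fun n => ∫ w, ∏ j, Real.exp (-({i | t j ≤ y n i w}.ncard : ℝ)) ^ p j ∂Q n) atTop
        (𝓝 (Real.exp (-∫ y, (1 - levelWeight t p y) ∂(ratioIntensity α κ)))))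
    (k : ℕ) : TendstoInDistribution (fun n w (i : Fin k) => ranked (fun j => y n j w) i) atTop
      (fun w (i : Fin k) => ranked (fun j => ξ j w / (ξ j w + S j w)) i) Q P := by
  refine _root_.tendstoInDistribution_ranked hy (h.measurable_ratio) h01 ?_ hyfin
    (h.ae_finite_ratio hfin) (fun m t ht p => ?_) k
  · filter_upwards [h.ae_pos hκ] with w hw i
    exact Set.Ioo_subset_Icc_self (div_add_mem_Ioo (hw i).1 (hw i).2)
  · rw [h.integral_counts_ratio_eq hfin ht p]
    exact hcounts m t ht p

end Ratio


/-! ### Dependence of the ranked ratios on the marks. -/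

section Identification

variable {Ω : Type*} [MeasurableSpace Ω] {P : Measure Ω} [IsProbabilityMeasure P] {α : ℝ}
  {κ κ' : Measure ℝ} [IsProbabilityMeasure κ] [IsProbabilityMeasure κ'] {ξ S S' : ℕ → Ω → ℝ}

theorem identDistrib_of_forall_fin {X Y : Ω → ℕ → ℝ} (hX : ∀ i, AEMeasurable (fun w => X w i) P)
    (hY : ∀ i, AEMeasurable (fun w => Y w i) P)
    (h : ∀ k : ℕ, P.map (fun w (i : Fin k) => X w i) = P.map (fun w (i : Fin k) => Y w i)) :
    IdentDistrib X Y P P := by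
  have hX' : AEMeasurable X P := aemeasurable_pi_lambda _ hX
  have hY' : AEMeasurable Y P := aemeasurable_pi_lambda _ hY
  refine (identDistrib_iff_forall_finset_identDistrib (X := fun i w => X w i)
    (Y := fun i w => Y w i) hX' hY').mpr fun I => ?_
  obtain ⟨k, hk⟩ := I.bddAbove
  let g : (Fin (k + 1) → ℝ) → I → ℝ := fun v i => v ⟨i, Nat.lt_succ_of_le (hk i.2)⟩
  have hg : Measurable g := measurable_pi_lambda _ fun i => measurable_pi_apply _
  have hXY : IdentDistrib (fun w (i : Fin (k + 1)) => X w i)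
      (fun w (i : Fin (k + 1)) => Y w i) P P :=
    ⟨aemeasurable_pi_lambda _ fun i => hX i, aemeasurable_pi_lambda _ fun i => hY i, h _⟩
  exact hXY.comp hg

/-- The law of the ranked ratios depends only on the tails of the intensity of the ratios. -/
theorem IsMarkedPoisson.identDistrib_ranked (h : IsMarkedPoisson ξ S (pppIntensity α) κ P)
    (h' : IsMarkedPoisson ξ S' (pppIntensity α) κ' P) (hκ : ∀ᵐ s ∂κ, 0 < s)
    (hκ' : ∀ᵐ s ∂κ', 0 < s)
    (hfin : ∀ T ∈ Set.Ioo (0 : ℝ) 1, ratioIntensity α κ (Set.Ici T) ≠ ⊤)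
    (heq : ∀ T ∈ Set.Ioo (0 : ℝ) 1,
      ratioIntensity α κ (Set.Ici T) = ratioIntensity α κ' (Set.Ici T)) :
    IdentDistrib (fun w => ranked fun i => ξ i w / (ξ i w + S i w))
      (fun w => ranked fun i => ξ i w / (ξ i w + S' i w)) P P := by
  have hfin' : ∀ T ∈ Set.Ioo (0 : ℝ) 1, ratioIntensity α κ' (Set.Ici T) ≠ ⊤ := fun T hT =>
    (heq T hT) ▸ hfin T hT
  have h01 : ∀ {U : ℕ → Ω → ℝ} {μ : Measure ℝ}, IsMarkedPoisson ξ U (pppIntensity α) μ P →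
      (∀ᵐ s ∂μ, 0 < s) → ∀ᵐ w ∂P, ∀ i, ξ i w / (ξ i w + U i w) ∈ Set.Icc (0 : ℝ) 1 := by
    intro U μ hU hμ
    filter_upwards [hU.ae_pos hμ] with w hw i
    exact Set.Ioo_subset_Icc_self (div_add_mem_Ioo (hw i).1 (hw i).2)
  refine identDistrib_of_forall_fin
    (fun i => aemeasurable_ranked h.measurable_ratio (h01 h hκ) (h.ae_finite_ratio hfin) i)
    (fun i => aemeasurable_ranked h'.measurable_ratio (h01 h' hκ') (h'.ae_finite_ratio hfin') i)
    fun k => ?_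
  -- The ratios with marks `S'` are treated as a constant sequence. Equal tails make its counts
  -- match those of the marks `S`, so it converges to the ranked ratios with marks `S`; it also
  -- converges to itself, and limits in law are unique.
  have hlim := h.tendstoInDistribution_ranked hκ hfin (Θ := fun _ => Ω) (Q := fun _ => P)
    (ι := fun _ => ℕ) (y := fun _ i w => ξ i w / (ξ i w + S' i w))
    (fun _ => h'.measurable_ratio) (fun _ => h01 h' hκ') (fun _ => h'.ae_finite_ratio hfin')
    (fun m t ht p => by
      rw [h'.integral_counts_ratio_eq hfin' ht p]
      have := tendsto_integral_of_mem_levelSpan (μ := fun _ => ratioIntensity α κ')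
        (c := fun _ => 1) (fun _ => hfin') hfin (fun T hT => by
          simp only [one_mul, measureReal_def, heq T hT]
          exact tendsto_const_nhds) (one_sub_levelWeight_mem_levelSpan ht p)
      rw [← tendsto_nhds_unique tendsto_const_nhds this, one_mul]
      exact tendsto_const_nhds) k
  exact tendstoInDistribution_unique _ hlim
    (tendstoInDistribution_const (hlim.forall_aemeasurable 0))

/-- Deterministic marks bring `ξ / (ξ + q)` under the same theory: mark `q` for the identification,
mark `1` for the rescaled first column. -/
theorem isMarkedPoisson_const {E : Type*} [MeasurableSpace E] {ν : Measure E} {ξ : ℕ → Ω → E}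
    (hξ : IsPoissonPointProcess ξ ν P) (q : ℝ) :
    IsMarkedPoisson ξ (fun _ _ => q) ν (Measure.dirac q) P where
  poisson := hξ
  measurable_mark _ := measurable_const
  law_mark _ := by simp [Measure.map_const]
  indep_mark := by
    refine iIndepFun_iff_measure_inter_preimage_eq_mul.mpr fun s A _ => ?_
    by_cases hq : ∀ i ∈ s, q ∈ A i
    · have h1 : (⋂ i ∈ s, (fun _ : Ω => q) ⁻¹' A i) = Set.univ :=
        Set.eq_univ_of_forall fun w => Set.mem_iInter₂.mpr fun i hi => hq i hi
      rw [h1, measure_univ]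
      refine (Finset.prod_eq_one fun i hi => ?_).symm
      rw [Set.preimage_const_of_mem (hq i hi), measure_univ]
    · push Not at hq
      obtain ⟨i, hi, hqi⟩ := hq
      have h1 : (fun _ : Ω => q) ⁻¹' A i = ∅ := Set.preimage_const_of_notMem hqi
      rw [Finset.prod_eq_zero hi (by rw [h1, measure_empty])]
      refine measure_mono_null (Set.biInter_subset_of_mem hi) ?_
      rw [h1, measure_empty]
  indep := indepFun_const_right _ _

/-- An antitone sequence of points with a constant mark is already ranked. -/
theorem ranked_ratio_const {x : ℕ → ℝ} {q : ℝ} (hx : Antitone x) (hpos : ∀ i, 0 < x i)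
    (hq : 0 < q) : (ranked fun i => x i / (x i + q)) = fun i => x i / (x i + q) := by
  ext k
  refine ranked_eq_of_nat _ (Equiv.refl ℕ) (fun i j hij => ?_) k
  have h1 := hpos i
  have h2 := hpos j
  simp only [Function.comp, Equiv.refl_apply]
  rw [div_le_div_iff₀ (by positivity) (by positivity)]
  nlinarith [hx hij]

end Identification


/-! ### One-sided stable variables. -/

section Stable

variable {Ω : Type*} [MeasurableSpace Ω] {P : Measure Ω} [IsProbabilityMeasure P] {α : ℝ}

theorem prod_unit_exp_neg_pow (x : ℝ) (p : Unit → ℕ) :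
    ∏ i : Unit, Real.exp (-x) ^ p i = Real.exp (-(p () : ℝ) * x) := by
  rw [Finset.univ_unique, Finset.prod_singleton, ← Real.exp_nat_mul]
  congr 1
  ring

theorem exp_neg_mem_Icc {x : ℝ} (hx : 0 ≤ x) : Real.exp (-x) ∈ Set.Icc (0 : ℝ) 1 :=
  ⟨(Real.exp_pos _).le, Real.exp_le_one_iff.mpr (by linarith)⟩

/-- The law of a one-sided stable variable is determined by its Laplace transform. -/
theorem IsOneSidedStable.map_eq {S T : Ω → ℝ} (hS : IsOneSidedStable α S P)
    (hT : IsOneSidedStable α T P) : P.map S = P.map T := by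
  have hSm : Measurable fun w (_ : Unit) => Real.exp (-S w) :=
    measurable_pi_lambda _ fun _ => hS.measurable.neg.exp
  have hTm : Measurable fun w (_ : Unit) => Real.exp (-T w) :=
    measurable_pi_lambda _ fun _ => hT.measurable.neg.exp
  -- The Laplace transform at the integers gives the moments of `exp (-S)`, which determine its law
  -- on `[0, 1]`; the logarithm then recovers `S`.
  have h := tendstoInDistribution_of_moments (Ω := fun _ => Ω) (P := fun _ => P) (P' := P)
    (V := fun _ w (_ : Unit) => Real.exp (-S w)) (V' := fun w (_ : Unit) => Real.exp (-T w))
    (fun _ => hSm.aemeasurable) hTm.aemeasurable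
    (fun _ => by filter_upwards [hS.nonneg] with w hw using fun _ => exp_neg_mem_Icc hw)
    (by filter_upwards [hT.nonneg] with w hw using fun _ => exp_neg_mem_Icc hw)
    (fun p => by
      simp only [prod_unit_exp_neg_pow, hS.laplace _ (Nat.cast_nonneg _),
        hT.laplace _ (Nat.cast_nonneg _)]
      exact tendsto_const_nhds)
  have heq := tendstoInDistribution_unique _ (tendstoInDistribution_const hSm.aemeasurable) h
  have hg : Measurable fun v : Unit → ℝ => -Real.log (v ()) :=
    (Real.measurable_log.comp (measurable_pi_apply ())).neg
  have := congrArg (Measure.map fun v : Unit → ℝ => -Real.log (v ())) heq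
  rw [Measure.map_map hg hSm, Measure.map_map hg hTm] at this
  simpa [Function.comp_def, Real.log_exp] using this

/-- An atom at `0` would bound the Laplace transform from below, whereas it tends to `0` as `θ → ∞`.
-/
theorem IsOneSidedStable.ae_pos (hα₀ : 0 < α) (hα₁ : α < 1) {S : Ω → ℝ}
    (hS : IsOneSidedStable α S P) : ∀ᵐ w ∂P, 0 < S w := by
  have hΓ : 0 < Real.Gamma (1 - α) := Real.Gamma_pos_of_pos (by linarith)
  have hA : MeasurableSet {w | S w ≤ 0} := measurableSet_le hS.measurable measurable_const
  have hle : ∀ θ : ℝ, 0 ≤ θ → P.real {w | S w ≤ 0} ≤ Real.exp (-Real.Gamma (1 - α) * θ ^ α) := by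
    intro θ hθ
    rw [← hS.laplace θ hθ, ← integral_indicator_one hA]
    refine integral_mono_ae ((integrable_const (1 : ℝ)).indicator hA) ?_ ?_
    · refine Integrable.of_bound (C := 1) (hS.measurable.const_mul _).exp.aestronglyMeasurable ?_
      filter_upwards [hS.nonneg] with w hw
      rw [Real.norm_eq_abs, abs_of_pos (Real.exp_pos _), Real.exp_le_one_iff]
      nlinarith
    · filter_upwards [hS.nonneg] with w hw
      by_cases h0 : S w ≤ 0
      · have : S w = 0 := le_antisymm h0 hw
        simp [Set.indicator, this]
      · rw [Set.indicator_of_notMem (show w ∉ {w | S w ≤ 0} from h0)]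
        exact (Real.exp_pos _).le
  have hlim : Tendsto (fun θ : ℝ => Real.exp (-Real.Gamma (1 - α) * θ ^ α)) atTop (𝓝 0) := by
    refine Real.tendsto_exp_atBot.comp ?_
    exact (tendsto_rpow_atTop hα₀).const_mul_atTop_of_neg (by linarith)
  have h0 : P.real {w | S w ≤ 0} ≤ 0 := ge_of_tendsto hlim (by
    filter_upwards [eventually_ge_atTop 0] with θ hθ using hle θ hθ)
  have h1 : P {w | S w ≤ 0} = 0 := by
    have := le_antisymm h0 measureReal_nonneg
    rwa [measureReal_eq_zero_iff] at this
  rw [ae_iff]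
  simp only [not_lt]
  exact h1

theorem lintegral_rpow_mul_exp_neg_mul {a s : ℝ} (ha : 0 < a) (hs : 0 < s) :
    ∫⁻ θ in Set.Ioi (0 : ℝ), ENNReal.ofReal (θ ^ (a - 1)) * ENNReal.ofReal (Real.exp (-θ * s)) =
      ENNReal.ofReal (Real.Gamma a) * ENNReal.ofReal (s ^ (-a)) := by
  have h1 := Real.integral_rpow_mul_exp_neg_mul_Ioi ha hs
  have hΓ := Real.Gamma_pos_of_pos ha
  have h2 : Integrable (fun t : ℝ => t ^ (a - 1) * Real.exp (-(s * t)))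
      (volume.restrict (Set.Ioi 0)) := by
    -- A non-integrable function has integral `0` by convention, so a nonzero value proves
    -- integrability.
    refine Integrable.of_integral_ne_zero ?_
    rw [h1]
    positivity
  have h3 : ∀ θ ∈ Set.Ioi (0 : ℝ), ENNReal.ofReal (θ ^ (a - 1)) *
      ENNReal.ofReal (Real.exp (-θ * s)) = ENNReal.ofReal (θ ^ (a - 1) * Real.exp (-(s * θ))) := by
    intro θ hθ
    rw [← ENNReal.ofReal_mul (Real.rpow_nonneg (le_of_lt hθ) _)]
    congr 3
    ring
  rw [setLIntegral_congr_fun measurableSet_Ioi h3, ← ofReal_integral_eq_lintegral_ofReal h2, h1,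
    ← ENNReal.ofReal_mul hΓ.le]
  · congr 1
    rw [one_div, Real.inv_rpow hs.le, Real.rpow_neg hs.le, mul_comm]
  · filter_upwards [ae_restrict_mem measurableSet_Ioi] with θ hθ
    exact mul_nonneg (Real.rpow_nonneg (le_of_lt hθ) _) (Real.exp_pos _).le

theorem qConst_pos (hα₀ : 0 < α) (hα₁ : α < 1) : 0 < qConst α := by
  have h1 : 0 < Real.Gamma (1 - α) := Real.Gamma_pos_of_pos (by linarith)
  have h2 : 0 < Real.Gamma (1 + α) := Real.Gamma_pos_of_pos (by linarith)
  exact Real.rpow_pos_of_pos (mul_pos h2 h1) _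

/-- The moment of order `-α` of a one-sided stable variable. -/
theorem IsOneSidedStable.lintegral_rpow_neg (hα₀ : 0 < α) (hα₁ : α < 1) {S : Ω → ℝ}
    (hS : IsOneSidedStable α S P) :
    ∫⁻ w, ENNReal.ofReal (S w ^ (-α)) ∂P = ENNReal.ofReal (qConst α ^ (-α)) := by
  have hΓ : 0 < Real.Gamma (1 - α) := Real.Gamma_pos_of_pos (by linarith)
  have hΓα : 0 < Real.Gamma α := Real.Gamma_pos_of_pos hα₀
  have hΓ1 : 0 < Real.Gamma (1 + α) := Real.Gamma_pos_of_pos (by linarith)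
  have hSm := hS.measurable
  -- Gamma integral for `S ^ (-α)`. After Tonelli the inner expectation is the Laplace transform,
  -- and `∫ θ ^ (α - 1) exp (-Γ(1 - α) θ ^ α) dθ = 1 / (α Γ(1 - α))`; finally `α Γ(α) = Γ(1 + α)`.
  have h1 : ENNReal.ofReal (Real.Gamma α) * ∫⁻ w, ENNReal.ofReal (S w ^ (-α)) ∂P =
      ∫⁻ w, (∫⁻ θ in Set.Ioi (0 : ℝ), ENNReal.ofReal (θ ^ (α - 1)) *
        ENNReal.ofReal (Real.exp (-θ * S w))) ∂P := by
    rw [← lintegral_const_mul _ (by fun_prop)]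
    refine lintegral_congr_ae ?_
    filter_upwards [hS.ae_pos hα₀ hα₁] with w hw
    exact (lintegral_rpow_mul_exp_neg_mul hα₀ hw).symm
  have hint := integral_rpow_mul_exp_neg_mul_rpow (p := α) (q := α - 1) hα₀ (by linarith) hΓ
  have hval : (Real.Gamma (1 - α)) ^ (-(α - 1 + 1) / α) * (1 / α) * Real.Gamma ((α - 1 + 1) / α) =
      Real.Gamma α * qConst α ^ (-α) := by
    have e1 : (α - 1 + 1) / α = 1 := by rw [sub_add_cancel, div_self hα₀.ne']
    have e2 : -(α - 1 + 1) / α = -1 := by rw [neg_div, e1]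
    have e3 : Real.Gamma (1 + α) = α * Real.Gamma α := by
      rw [add_comm, Real.Gamma_add_one hα₀.ne']
    have e4 : qConst α ^ (-α) = (Real.Gamma (1 + α) * Real.Gamma (1 - α))⁻¹ := by
      unfold qConst
      rw [← Real.rpow_mul (mul_pos hΓ1 hΓ).le, show 1 / α * -α = -1 by field_simp, Real.rpow_neg_one]
    rw [e1, e2, e4, e3, Real.Gamma_one, Real.rpow_neg_one]
    field_simp
  rw [hval] at hint
  have hq := qConst_pos hα₀ hα₁
  have h2 : ∫⁻ w, (∫⁻ θ in Set.Ioi (0 : ℝ), ENNReal.ofReal (θ ^ (α - 1)) *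
        ENNReal.ofReal (Real.exp (-θ * S w))) ∂P =
      ENNReal.ofReal (Real.Gamma α * qConst α ^ (-α)) := by
    rw [lintegral_lintegral_swap (by fun_prop), ← hint, ofReal_integral_eq_lintegral_ofReal]
    · refine setLIntegral_congr_fun measurableSet_Ioi fun θ hθ => ?_
      have hθ0 : 0 ≤ θ := le_of_lt hθ
      rw [lintegral_const_mul _ (by fun_prop), ENNReal.ofReal_mul (Real.rpow_nonneg hθ0 _),
        ← hS.laplace θ hθ0, ofReal_integral_eq_lintegral_ofReal]
      · refine Integrable.of_bound (C := 1) (hSm.const_mul _).exp.aestronglyMeasurable ?_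
        filter_upwards [hS.nonneg] with w hw
        rw [Real.norm_eq_abs, abs_of_pos (Real.exp_pos _), Real.exp_le_one_iff]
        nlinarith
      · exact ae_of_all _ fun w => (Real.exp_pos _).le
    · refine Integrable.of_integral_ne_zero ?_
      rw [hint]
      positivity
    · filter_upwards [ae_restrict_mem measurableSet_Ioi] with θ hθ
      exact mul_nonneg (Real.rpow_nonneg (le_of_lt hθ) _) (Real.exp_pos _).le
  rw [h2, ENNReal.ofReal_mul hΓα.le] at h1
  exact (ENNReal.mul_right_inj (by simpa using hΓα) ENNReal.ofReal_ne_top).mp h1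

end Stable


/-! ### Tails and Laplace transforms of the weights. -/

section Tails

/-- The order of magnitude of the largest of `n + 1` variables with tail `c t ^ (-α)`. -/
noncomputable def tailScale (α c : ℝ) (n : ℕ) : ℝ := (c * (n + 1)) ^ (1 / α)

variable {α c : ℝ} {L : Measure ℝ} [IsProbabilityMeasure L]

theorem tailScale_pos (hc : 0 < c) (n : ℕ) : 0 < tailScale α c n :=
  Real.rpow_pos_of_pos (by positivity) _

theorem tailScale_rpow (hα : 0 < α) (hc : 0 < c) (n : ℕ) :
    tailScale α c n ^ α = c * (n + 1) := by
  rw [tailScale, ← Real.rpow_mul (by positivity), one_div, inv_mul_cancel₀ hα.ne', Real.rpow_one]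

theorem tendsto_tailScale (hα : 0 < α) (hc : 0 < c) :
    Tendsto (tailScale α c) atTop atTop := by
  have h1 : Tendsto (fun n : ℕ => c * ((n : ℝ) + 1)) atTop atTop :=
    (tendsto_atTop_add_const_right _ _ tendsto_natCast_atTop_atTop).const_mul_atTop hc
  exact (tendsto_rpow_atTop (one_div_pos.mpr hα)).comp h1

theorem HeavyTailedLaw.tendsto_mul_tail (hL : HeavyTailedLaw α c L) (hα : 0 < α) {y : ℝ}
    (hy : 0 < y) : Tendsto (fun n : ℕ => ((n : ℝ) + 1) * L.real (Set.Ici (tailScale α c n * y)))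
      atTop (𝓝 (y ^ (-α))) := by
  have hc := hL.pos
  have h1 : Tendsto (fun n => tailScale α c n * y) atTop atTop :=
    (tendsto_tailScale hα hc).atTop_mul_const hy
  have h2 := (hL.tail.comp h1).const_mul ((c * y ^ α)⁻¹)
  have hy' : 0 < y ^ α := Real.rpow_pos_of_pos hy _
  have e : (c * y ^ α)⁻¹ * c = y ^ (-α) := by
    rw [Real.rpow_neg hy.le]; field_simp
  rw [e] at h2
  refine h2.congr fun n => ?_
  simp only [Function.comp]
  rw [Real.mul_rpow (tailScale_pos hc n).le hy.le, tailScale_rpow hα hc]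
  field_simp

theorem antitone_tail : Antitone fun y => L.real (Set.Ici y) := fun _ _ h =>
  measureReal_mono (Set.Ici_subset_Ici.mpr h)

theorem HeavyTailedLaw.exists_tail_le (hL : HeavyTailedLaw α c L) (hα : 0 < α) :
    ∃ C, 0 < C ∧ ∀ y, 0 < y → L.real (Set.Ici y) ≤ C * y ^ (-α) := by
  have h := hL.tail.eventually (eventually_le_nhds (lt_add_one c))
  obtain ⟨T, hT⟩ := (h.and (eventually_ge_atTop 1)).exists_forall_of_atTop
  have hT1 : 0 < max T 1 := by positivity
  have hTα : 0 < max T 1 ^ α := Real.rpow_pos_of_pos hT1 _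
  -- `c + 1` serves beyond `max T 1`; below it the tail is at most `1` and `y ^ α ≤ max T 1 ^ α`.
  refine ⟨c + 1 + max T 1 ^ α, by have := hL.pos; positivity, fun y hy => ?_⟩
  have hy' : 0 < y ^ α := Real.rpow_pos_of_pos hy _
  rw [Real.rpow_neg hy.le, ← div_eq_mul_inv, le_div_iff₀ hy', mul_comm]
  rcases le_total (max T 1) y with h1 | h1
  · have := (hT y (le_trans (le_max_left _ _) h1)).1
    linarith
  · have h2 : y ^ α ≤ max T 1 ^ α := Real.rpow_le_rpow hy.le h1 hα.le
    have h3 : L.real (Set.Ici y) ≤ 1 := measureReal_le_one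
    have := hL.pos
    nlinarith

theorem HeavyTailedLaw.exists_le_tail (hL : HeavyTailedLaw α c L) (hα : 0 < α) :
    ∃ C, 0 < C ∧ ∀ y, 0 < y → C * min 1 (y ^ (-α)) ≤ L.real (Set.Ici y) := by
  have hc := hL.pos
  have h := hL.tail.eventually (eventually_ge_nhds (half_lt_self hc))
  obtain ⟨T, hT⟩ := (h.and (eventually_ge_atTop 1)).exists_forall_of_atTop
  have hT1 : 1 ≤ max T 1 := le_max_right _ _
  have hT0 : 0 < max T 1 := by positivity
  have hTα : 0 < max T 1 ^ (-α) := Real.rpow_pos_of_pos hT0 _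
  have hTα1 : max T 1 ^ (-α) ≤ 1 := Real.rpow_le_one_of_one_le_of_nonpos hT1 (by linarith)
  have key : ∀ y, max T 1 ≤ y → c / 2 * y ^ (-α) ≤ L.real (Set.Ici y) := by
    intro y hy
    have hy0 : 0 < y := hT0.trans_le hy
    have h1 := (hT y (le_trans (le_max_left _ _) hy)).1
    rw [Real.rpow_neg hy0.le, ← div_eq_mul_inv, div_le_iff₀ (Real.rpow_pos_of_pos hy0 _)]
    linarith
  -- `c / 2` serves beyond `max T 1`; below it the tail is at least its value at `max T 1`.
  refine ⟨c / 2 * max T 1 ^ (-α), by positivity, fun y hy => ?_⟩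
  rcases le_total (max T 1) y with h1 | h1
  · refine le_trans ?_ (key y h1)
    have h2 : min 1 (y ^ (-α)) ≤ y ^ (-α) := min_le_right _ _
    have h3 : 0 < y ^ (-α) := Real.rpow_pos_of_pos hy _
    calc c / 2 * max T 1 ^ (-α) * min 1 (y ^ (-α)) ≤ c / 2 * max T 1 ^ (-α) * y ^ (-α) := by gcongr
      _ ≤ c / 2 * 1 * y ^ (-α) := by gcongr
      _ = _ := by ring
  · refine le_trans ?_ ((key _ le_rfl).trans (antitone_tail h1))
    calc c / 2 * max T 1 ^ (-α) * min 1 (y ^ (-α)) ≤ c / 2 * max T 1 ^ (-α) * 1 := by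
          gcongr; exact min_le_left _ _
      _ = _ := by ring

/-- Layer-cake formula for `1 - exp (-p t)`, whose derivative is `p exp (-p t)`; it expresses the
Laplace transform through the tail. -/
theorem integral_one_sub_exp_neg_div (hL : ∀ᵐ x ∂L, 0 ≤ x) {a p : ℝ} (ha : 0 < a) (hp : 0 < p) :
    ∫ x, (1 - Real.exp (-p * (x / a))) ∂L =
      ∫ t in Set.Ioi 0, L.real (Set.Ici (a * t)) * (p * Real.exp (-p * t)) := by
  have hint : ∀ y : ℝ, ∫ t in (0 : ℝ)..y, p * Real.exp (-p * t) = 1 - Real.exp (-p * y) := by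
    intro y
    have hd : ∀ t ∈ Set.uIcc 0 y, HasDerivAt (fun t => -Real.exp (-p * t))
        (p * Real.exp (-p * t)) t := by
      intro t _
      have := (((hasDerivAt_id t).const_mul (-p)).exp).neg
      simp only [id, mul_one] at this
      exact HasDerivAt.congr_deriv (f' := -(Real.exp (-p * t) * -p)) this (by ring)
    rw [intervalIntegral.integral_eq_sub_of_hasDerivAt hd
      (by apply Continuous.intervalIntegrable; fun_prop)]
    simp [sub_eq_neg_add, add_comm]
  have key := lintegral_comp_eq_lintegral_meas_le_mul L (f := fun x => x / a)
    (g := fun t => p * Real.exp (-p * t))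
    (by filter_upwards [hL] with x hx; exact div_nonneg hx ha.le) (by fun_prop)
    (fun t _ => by apply Continuous.intervalIntegrable; fun_prop)
    (ae_of_all _ fun t => by positivity)
  have hset : ∀ t : ℝ, {x : ℝ | t ≤ x / a} = Set.Ici (a * t) := by
    intro t; ext x
    simp only [Set.mem_ofPred_eq, Set.mem_Ici]
    rw [le_div_iff₀ ha, mul_comm]
  simp only [hint, hset] at key
  rw [integral_eq_lintegral_of_nonneg_ae, key, integral_eq_lintegral_of_nonneg_ae]
  · congr 1
    refine lintegral_congr fun t => ?_
    rw [ENNReal.ofReal_mul measureReal_nonneg, ofReal_measureReal]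
  · exact ae_of_all _ fun t => by positivity
  · have : Measurable fun t => L.real (Set.Ici (a * t)) :=
      (antitone_tail.measurable).comp (measurable_const_mul a)
    exact (this.mul (by fun_prop)).aestronglyMeasurable
  · filter_upwards [hL] with x hx
    have : Real.exp (-p * (x / a)) ≤ 1 := Real.exp_le_one_iff.mpr (by
      have := div_nonneg hx ha.le; nlinarith)
    simpa using this
  · fun_prop

/-- Dominated convergence in the layer-cake formula: `n + 1` times the rescaled tail is at most `(C
/ c) t ^ (-α)`, integrable at `0` since `α < 1`, and the limit is a Gamma integral. -/
theorem HeavyTailedLaw.tendsto_mul_integral_one_sub_exp (hL : HeavyTailedLaw α c L) (hα₀ : 0 < α)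
    (hα₁ : α < 1) {p : ℝ} (hp : 0 < p) :
    Tendsto (fun n : ℕ => ((n : ℝ) + 1) * ∫ x, (1 - Real.exp (-p * (x / tailScale α c n))) ∂L)
      atTop (𝓝 (Real.Gamma (1 - α) * p ^ α)) := by
  have hc := hL.pos
  obtain ⟨C, hC, hCL⟩ := hL.exists_tail_le hα₀
  have e : Real.Gamma (1 - α) * p ^ α =
      ∫ t in Set.Ioi 0, t ^ (-α) * (p * Real.exp (-p * t)) := by
    have h1 := Real.integral_rpow_mul_exp_neg_mul_Ioi (a := 1 - α) (r := p) (by linarith) hp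
    have h2 : ∀ t : ℝ, t ^ (-α) * (p * Real.exp (-p * t)) =
        p * (t ^ (1 - α - 1) * Real.exp (-(p * t))) := by
      intro t
      rw [show 1 - α - 1 = -α by ring, neg_mul]; ring
    simp only [h2]
    rw [integral_const_mul, h1, one_div, Real.inv_rpow hp.le, Real.rpow_sub hp, Real.rpow_one]
    have := Real.rpow_pos_of_pos hp α
    field_simp
  rw [e]
  have hbi : IntegrableOn (fun t : ℝ => C / c * (t ^ (-α) * (p * Real.exp (-p * t))))
      (Set.Ioi 0) := by
    refine Integrable.const_mul (Integrable.of_integral_ne_zero ?_) _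
    rw [← e]
    have := Real.Gamma_pos_of_pos (show 0 < 1 - α by linarith)
    have := Real.rpow_pos_of_pos hp α
    positivity
  simp only [integral_one_sub_exp_neg_div hL.nonneg (tailScale_pos hc _) hp, ← integral_const_mul]
  refine tendsto_integral_of_dominated_convergence _ (fun n => ?_) hbi (fun n => ?_) ?_
  · have : Measurable fun t => L.real (Set.Ici (tailScale α c n * t)) :=
      (antitone_tail.measurable).comp (measurable_const_mul _)
    exact (this.mul (by fun_prop)).const_mul _ |>.aestronglyMeasurable
  · filter_upwards [ae_restrict_mem measurableSet_Ioi] with t ht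
    have ht0 : 0 < t := ht
    have ha := tailScale_pos (α := α) hc n
    have h1 := hCL _ (mul_pos ha ht0)
    have ha' : tailScale α c n ^ (-α) = (c * (n + 1))⁻¹ := by
      rw [Real.rpow_neg ha.le, tailScale_rpow hα₀ hc]
    rw [Real.mul_rpow ha.le ht0.le, ha'] at h1
    rw [Real.norm_of_nonneg (by positivity)]
    calc ((n : ℝ) + 1) * (L.real (Set.Ici (tailScale α c n * t)) * (p * Real.exp (-p * t)))
        ≤ ((n : ℝ) + 1) * (C * ((c * (n + 1))⁻¹ * t ^ (-α)) * (p * Real.exp (-p * t))) := by gcongr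
      _ = _ := by field_simp
  · filter_upwards [ae_restrict_mem measurableSet_Ioi] with t ht
    refine ((hL.tendsto_mul_tail hα₀ ht).mul_const (p * Real.exp (-p * t))).congr fun n => ?_
    ring

theorem HeavyTailedLaw.integrable_exp (hL : HeavyTailedLaw α c L) {p a : ℝ} (hp : 0 ≤ p)
    (ha : 0 < a) : Integrable (fun x => Real.exp (-p * (x / a))) L := by
  refine Integrable.of_bound (C := 1) (by fun_prop) ?_
  filter_upwards [hL.nonneg] with x hx
  rw [Real.norm_of_nonneg (Real.exp_pos _).le, Real.exp_le_one_iff]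
  have := div_nonneg hx ha.le
  nlinarith

theorem HeavyTailedLaw.tendsto_laplace_pow (hL : HeavyTailedLaw α c L) (hα₀ : 0 < α)
    (hα₁ : α < 1) {p : ℝ} (hp : 0 ≤ p) :
    Tendsto (fun n : ℕ => (∫ x, Real.exp (-p * (x / tailScale α c n)) ∂L) ^ n)
      atTop (𝓝 (Real.exp (-Real.Gamma (1 - α) * p ^ α))) := by
  rcases hp.eq_or_lt with rfl | hp
  · simp [Real.zero_rpow hα₀.ne']
  have h1 := (hL.tendsto_mul_integral_one_sub_exp hα₀ hα₁ hp).neg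
  -- The power is `n`, one row without its first entry, while the scale is that of `n + 1`
  -- variables.
  have h2 : Tendsto (fun n : ℕ => (n : ℝ) / (n + 1)) atTop (𝓝 1) := tendsto_natCast_div_add_atTop 1
  have h3 := h2.mul h1
  rw [one_mul, ← neg_mul] at h3
  have h4 : Tendsto (fun n : ℕ => (n : ℝ) *
      ((∫ x, Real.exp (-p * (x / tailScale α c n)) ∂L) - 1)) atTop
      (𝓝 (-Real.Gamma (1 - α) * p ^ α)) := by
    refine h3.congr fun n => ?_
    rw [integral_sub (integrable_const _) (hL.integrable_exp hp.le (tailScale_pos hL.pos n))]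
    simp only [integral_const, probReal_univ, smul_eq_mul, mul_one]
    field_simp
    ring
  refine (Real.tendsto_one_add_pow_exp_of_tendsto h4).congr fun n => ?_
  ring

end Tails

/-! ### Sums of independent weights. -/

section Sums

/-- The law of the sum of `n` independent variables with law `L`. -/
noncomputable def sumLaw (L : Measure ℝ) (n : ℕ) : Measure ℝ :=
  (Measure.pi fun _ : Fin n => L).map fun x => ∑ i, x i

variable {α c : ℝ} {L : Measure ℝ} [IsProbabilityMeasure L]

instance isProbabilityMeasure_sumLaw (n : ℕ) : IsProbabilityMeasure (sumLaw L n) :=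
  Measure.isProbabilityMeasure_map (by fun_prop)

theorem ae_pi_nonneg (hL : ∀ᵐ x ∂L, 0 ≤ x) (n : ℕ) :
    ∀ᵐ x ∂(Measure.pi fun _ : Fin n => L), ∀ i, 0 ≤ x i :=
  ae_all_iff.mpr fun i =>
    (measurePreserving_eval (fun _ : Fin n => L) i).quasiMeasurePreserving.ae hL

theorem ae_sumLaw_nonneg (hL : ∀ᵐ x ∂L, 0 ≤ x) (n : ℕ) : ∀ᵐ r ∂sumLaw L n, 0 ≤ r := by
  rw [sumLaw, ae_map_iff (by fun_prop) measurableSet_Ici]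
  filter_upwards [ae_pi_nonneg hL n] with x hx
  exact Finset.sum_nonneg fun i _ => hx i

theorem integral_exp_sumLaw (n : ℕ) (p a : ℝ) :
    ∫ r, Real.exp (-p * (r / a)) ∂sumLaw L n = (∫ x, Real.exp (-p * (x / a)) ∂L) ^ n := by
  rw [sumLaw, integral_map (by fun_prop) (by fun_prop)]
  have h1 : ∀ x : Fin n → ℝ, Real.exp (-p * ((∑ i, x i) / a)) =
      ∏ i, Real.exp (-p * (x i / a)) := by
    intro x
    rw [← Real.exp_sum, Finset.sum_div, Finset.mul_sum]
  simp only [h1]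
  rw [integral_fintype_prod_eq_prod (fun _ x => Real.exp (-p * (x / a)))]
  simp

/-- A sum of non-negative terms below `y` has all its terms below `y`. This is the source of every
lower-tail estimate on row sums. -/
theorem sumLaw_Iio_le (hL : ∀ᵐ x ∂L, 0 ≤ x) (n : ℕ) (y : ℝ) :
    (sumLaw L n).real (Set.Iio y) ≤ (1 - L.real (Set.Ici y)) ^ n := by
  have h1 : (Measure.pi fun _ : Fin n => L).real (Set.pi Set.univ fun _ => Set.Iio y) =
      (1 - L.real (Set.Ici y)) ^ n := by
    have : L.real (Set.Iio y) = 1 - L.real (Set.Ici y) := by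
      rw [← Set.compl_Ici, probReal_compl_eq_one_sub measurableSet_Ici]
    rw [← this, measureReal_def, Measure.pi_pi, ENNReal.toReal_prod]
    simp [measureReal_def]
  rw [← h1, sumLaw, map_measureReal_apply (by fun_prop) measurableSet_Iio]
  refine ENNReal.toReal_mono (measure_ne_top _ _) (measure_mono_ae ?_)
  filter_upwards [ae_pi_nonneg hL n] with x hx hlt
  intro i _
  exact lt_of_le_of_lt (Finset.single_le_sum (fun j _ => hx j) (Finset.mem_univ i)) hlt

end Sums


/-! ### Half-lines under convergence in distribution. -/

section Portmanteau

variable {Ω : ℕ → Type*} [∀ n, MeasurableSpace (Ω n)] {P : ∀ n, Measure (Ω n)}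
  [∀ n, IsProbabilityMeasure (P n)] {Ω' : Type*} [MeasurableSpace Ω'] {P' : Measure Ω'}
  [IsProbabilityMeasure P'] {X : ∀ n, Ω n → ℝ} {Z : Ω' → ℝ}

theorem MeasureTheory.TendstoInDistribution.eventually_measure_Iic_lt
    (h : TendstoInDistribution X atTop Z P P') {z : ℝ} {b : ENNReal}
    (hb : P' {w | Z w ≤ z} < b) : ∀ᶠ n in atTop, P n {w | X n w ≤ z} < b := by
  have h1 := ProbabilityMeasure.limsup_measure_closed_le_of_tendsto h.tendsto
    (isClosed_Iic (a := z))
  have h2 := eventually_lt_of_limsup_lt (lt_of_le_of_lt h1 (by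
    simp only [ProbabilityMeasure.coe_mk]
    rw [Measure.map_apply_of_aemeasurable h.aemeasurable_limit measurableSet_Iic]
    exact hb))
  filter_upwards [h2] with n hn
  simp only [ProbabilityMeasure.coe_mk] at hn
  rwa [Measure.map_apply_of_aemeasurable (h.forall_aemeasurable n) measurableSet_Iic] at hn

theorem MeasureTheory.TendstoInDistribution.eventually_lt_measure_Iio
    (h : TendstoInDistribution X atTop Z P P') {z : ℝ} {b : ENNReal}
    (hb : b < P' {w | Z w < z}) : ∀ᶠ n in atTop, b < P n {w | X n w < z} := by
  have h1 := ProbabilityMeasure.le_liminf_measure_open_of_tendsto h.tendsto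
    (isOpen_Iio (a := z))
  have h2 := eventually_lt_of_lt_liminf (lt_of_lt_of_le (by
    simp only [ProbabilityMeasure.coe_mk]
    rw [Measure.map_apply_of_aemeasurable h.aemeasurable_limit measurableSet_Iio]
    exact hb) h1)
  filter_upwards [h2] with n hn
  simp only [ProbabilityMeasure.coe_mk] at hn
  rwa [Measure.map_apply_of_aemeasurable (h.forall_aemeasurable n) measurableSet_Iio] at hn

/-- Continuity from above leaves room to the right of `z`; it absorbs the fact that the rescaled
tail is only asymptotically a power. -/
theorem exists_gt_measure_Iic_lt (hZ : Measurable Z) {z : ℝ} {b : ENNReal}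
    (hb : P' {w | Z w ≤ z} < b) : ∃ y > z, P' {w | Z w ≤ y} < b := by
  have h1 := tendsto_measure_biInter_gt (μ := P') (s := fun y => {w | Z w ≤ y}) (a := z)
    (fun r _ => (measurableSet_le hZ measurable_const).nullMeasurableSet)
    (fun i j _ hij w hw => le_trans hw hij) ⟨z + 1, by simp, measure_ne_top _ _⟩
  have h2 : (⋂ r > z, {w | Z w ≤ r}) = {w | Z w ≤ z} := by
    ext w
    simp only [Set.mem_iInter, Set.mem_ofPred_eq]
    exact ⟨fun h => le_of_forall_gt_imp_ge_of_dense h, fun h r hr => h.trans hr.le⟩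
  rw [h2] at h1
  obtain ⟨y, hy, hy'⟩ := ((h1.eventually_lt_const hb).and self_mem_nhdsWithin).exists
  exact ⟨y, hy', hy⟩

theorem exists_lt_measure_Iio_gt {z a : ℝ} (ha : a < z) {b : ENNReal}
    (hb : b < P' {w | Z w < z}) : ∃ y ∈ Set.Ioo a z, b < P' {w | Z w < y} := by
  obtain ⟨u, hu, hul, hut⟩ := exists_seq_strictMono_tendsto' ha
  have h1 : (⋃ n, {w | Z w < u n}) = {w | Z w < z} := by
    ext w
    simp only [Set.mem_iUnion, Set.mem_ofPred_eq]
    exact ⟨fun ⟨n, hn⟩ => hn.trans (hul n).2, fun h => (hut.eventually (lt_mem_nhds h)).exists⟩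
  have h2 := tendsto_measure_iUnion_atTop (μ := P') (s := fun n => {w | Z w < u n})
    (fun i j hij w hw => lt_of_lt_of_le hw (hu.monotone hij))
  rw [h1] at h2
  obtain ⟨n, hn⟩ := (h2.eventually_const_lt hb).exists
  exact ⟨u n, hul n, hn⟩

end Portmanteau

/-! ### The tail evaluated at a row sum. -/

section RowSums

variable {α c : ℝ} {L : Measure ℝ} [IsProbabilityMeasure L] {Ω' : Type*} [MeasurableSpace Ω']
  {P' : Measure Ω'} [IsProbabilityMeasure P'] {S : Ω' → ℝ}

/-- The row sums belong to the domain of attraction of the one-sided stable law. -/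
theorem HeavyTailedLaw.tendstoInDistribution_sumLaw (hL : HeavyTailedLaw α c L) (hα₀ : 0 < α)
    (hα₁ : α < 1) (hS : IsOneSidedStable α S P') :
    TendstoInDistribution (fun n r => r / tailScale α c n) atTop S (sumLaw L) P' := by
  have hSm : Measurable fun w (_ : Unit) => Real.exp (-S w) :=
    measurable_pi_lambda _ fun _ => hS.measurable.neg.exp
  have h := tendstoInDistribution_of_moments (P := sumLaw L) (P' := P')
    (V := fun n r (_ : Unit) => Real.exp (-(r / tailScale α c n)))
    (V' := fun w (_ : Unit) => Real.exp (-S w))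
    (fun n => (measurable_pi_lambda _ fun _ => by fun_prop).aemeasurable) hSm.aemeasurable
    (fun n => by
      filter_upwards [ae_sumLaw_nonneg hL.nonneg n] with r hr using fun _ =>
        exp_neg_mem_Icc (div_nonneg hr (tailScale_pos hL.pos n).le))
    (by filter_upwards [hS.nonneg] with w hw using fun _ => exp_neg_mem_Icc hw)
    (fun p => by
      simp only [prod_unit_exp_neg_pow, hS.laplace _ (Nat.cast_nonneg _), integral_exp_sumLaw]
      exact hL.tendsto_laplace_pow hα₀ hα₁ (Nat.cast_nonneg _))
  have hg : Measurable fun v : Unit → ℝ => -Real.log (v ()) :=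
    (Real.measurable_log.comp (measurable_pi_apply ())).neg
  -- `-log` is continuous away from `0`, a value which `exp (-S)` never takes.
  have h2 := h.comp_of_continuousOn hg (O := {v | v () ≠ 0})
    (isOpen_ne_fun (continuous_apply ()) continuous_const)
    (((continuous_apply ()).continuousOn.log fun _ hv => hv).neg)
    (ae_of_all _ fun w => (Real.exp_pos _).ne')
  simpa [Real.log_exp] using h2

/-- By monotonicity of the tail, for large `n` the event contains `{r / a_n < y}` for `y < z` and is
contained in `{r / a_n ≤ y}` for `y > z`. The absence of an atom at `z` closes the gap. -/
theorem HeavyTailedLaw.tendsto_measure_lt_tail (hL : HeavyTailedLaw α c L) (hα₀ : 0 < α)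
    (hα₁ : α < 1) (hS : IsOneSidedStable α S P') {s z : ℝ} (hs : 0 < s) (hz : 0 < z)
    (hSz : P' {w | S w = z} = 0) :
    Tendsto (fun n : ℕ => sumLaw L n {r | (s * z) ^ (-α) < ((n : ℝ) + 1) * L.real (Set.Ici (s * r))})
      atTop (𝓝 (P' {w | S w < z})) := by
  have hc := hL.pos
  have hR := hL.tendstoInDistribution_sumLaw hα₀ hα₁ hS
  have hmono : ∀ n : ℕ, ∀ r y : ℝ, r / tailScale α c n ≤ y →
      L.real (Set.Ici (tailScale α c n * (s * y))) ≤ L.real (Set.Ici (s * r)) := by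
    intro n r y h
    apply antitone_tail
    rw [div_le_iff₀ (tailScale_pos hc n)] at h
    nlinarith
  have hmono' : ∀ n : ℕ, ∀ r y : ℝ, y ≤ r / tailScale α c n →
      L.real (Set.Ici (s * r)) ≤ L.real (Set.Ici (tailScale α c n * (s * y))) := by
    intro n r y h
    apply antitone_tail
    rw [le_div_iff₀ (tailScale_pos hc n)] at h
    nlinarith
  rw [tendsto_order]
  constructor
  · intro b hb
    obtain ⟨y, hy, hby⟩ := exists_lt_measure_Iio_gt hz hb
    have hlt : (s * z) ^ (-α) < (s * y) ^ (-α) :=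
      Real.rpow_lt_rpow_of_neg (mul_pos hs hy.1) (by nlinarith [hy.2]) (by linarith)
    filter_upwards [hR.eventually_lt_measure_Iio hby,
      (hL.tendsto_mul_tail hα₀ (mul_pos hs hy.1)).eventually_const_lt hlt] with n h1 h2
    refine h1.trans_le (measure_mono fun r hr => h2.trans_le ?_)
    have := hmono n r y (le_of_lt hr)
    gcongr
  · intro b hb
    have hb' : P' {w | S w ≤ z} < b := by
      refine lt_of_le_of_lt ?_ hb
      calc P' {w | S w ≤ z} ≤ P' ({w | S w < z} ∪ {w | S w = z}) :=
            measure_mono fun w (hw : S w ≤ z) => hw.lt_or_eq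
        _ ≤ _ := measure_union_le _ _
        _ = _ := by rw [hSz, add_zero]
    obtain ⟨y, hy, hby⟩ := exists_gt_measure_Iic_lt hS.measurable hb'
    have hy0 : 0 < y := hz.trans hy
    have hlt : (s * y) ^ (-α) < (s * z) ^ (-α) :=
      Real.rpow_lt_rpow_of_neg (mul_pos hs hz) (by nlinarith) (by linarith)
    filter_upwards [hR.eventually_measure_Iic_lt hby,
      (hL.tendsto_mul_tail hα₀ (mul_pos hs hy0)).eventually_lt_const hlt] with n h1 h2
    refine lt_of_le_of_lt (measure_mono fun r hr => ?_) h1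
    by_contra hlt'
    have h3 := hmono' n r y (le_of_lt (not_le.mp hlt'))
    have h4 : ((n : ℝ) + 1) * L.real (Set.Ici (s * r)) ≤
        ((n : ℝ) + 1) * L.real (Set.Ici (tailScale α c n * (s * y))) := by gcongr
    exact absurd (lt_of_lt_of_le hr (h4.trans h2.le)) (lt_irrefl _)

/-- The values which are often exceeded by the tail at a row sum have exponentially decaying
probabilities. -/
theorem HeavyTailedLaw.exists_measure_lt_tail_le (hL : HeavyTailedLaw α c L) (hα : 0 < α) {s : ℝ}
    (hs : 0 < s) : ∃ C, 0 < C ∧ ∀ n : ℕ, 1 ≤ n → ∀ u, 0 < u →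
      (sumLaw L n).real {r | u < ((n : ℝ) + 1) * L.real (Set.Ici (s * r))} ≤ Real.exp (-C * u) := by
  obtain ⟨C, hC, hCL⟩ := hL.exists_tail_le hα
  obtain ⟨c₀, hc₀, hcL⟩ := hL.exists_le_tail hα
  have hsα : 0 < s ^ α := Real.rpow_pos_of_pos hs _
  -- With `y` as below, `m * (u / (n + 1))` bounds `min 1 (y ^ (-α))` from below for `u ≤ n + 1`.
  -- The factor `1 / 2` in the constant is a lower bound for `n / (n + 1)` when `n ≥ 1`.
  set m := min 1 (s ^ α / C) with hm
  have hm0 : 0 < m := lt_min one_pos (by positivity)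
  refine ⟨c₀ * m / 2, by positivity, fun n hn u hu => ?_⟩
  have hn1 : (0 : ℝ) < (n : ℝ) + 1 := by positivity
  -- `n + 1` times a probability never exceeds `n + 1`, so the event is empty in the first case.
  rcases le_total ((n : ℝ) + 1) u with h | h
  · have : {r | u < ((n : ℝ) + 1) * L.real (Set.Ici (s * r))} = ∅ := by
      ext r
      simp only [Set.mem_ofPred_eq, Set.mem_empty_iff_false, iff_false, not_lt]
      have : L.real (Set.Ici (s * r)) ≤ 1 := measureReal_le_one
      nlinarith
    rw [this, measureReal_empty]
    exact (Real.exp_pos _).le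
  -- Solves `(n + 1) C (s y) ^ (-α) = u`: by the upper tail bound, the event forces `r < y`.
  · set y := ((n + 1) * C / u) ^ (1 / α) / s with hy
    have hq : 0 < ((n : ℝ) + 1) * C / u := by positivity
    have hy0 : 0 < y := div_pos (Real.rpow_pos_of_pos hq _) hs
    have hyα : y ^ (-α) = s ^ α / C * (u / (n + 1)) := by
      rw [hy, Real.div_rpow (Real.rpow_pos_of_pos hq _).le hs.le, ← Real.rpow_mul hq.le,
        show 1 / α * -α = -1 by field_simp, Real.rpow_neg_one, Real.rpow_neg hs.le]
      field_simp
    have hsub : {r | u < ((n : ℝ) + 1) * L.real (Set.Ici (s * r))} ⊆ Set.Iio y := by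
      intro r hr
      by_contra hlt
      have hyr : y ≤ r := not_lt.mp hlt
      have h1 : L.real (Set.Ici (s * r)) ≤ C * (s * y) ^ (-α) :=
        (antitone_tail (mul_le_mul_of_nonneg_left hyr hs.le)).trans (hCL _ (mul_pos hs hy0))
      rw [Real.mul_rpow hs.le hy0.le, hyα, Real.rpow_neg hs.le] at h1
      have h2 : ((n : ℝ) + 1) * L.real (Set.Ici (s * r)) ≤
          ((n : ℝ) + 1) * (C * ((s ^ α)⁻¹ * (s ^ α / C * (u / (n + 1))))) := by gcongr
      have h3 : ((n : ℝ) + 1) * (C * ((s ^ α)⁻¹ * (s ^ α / C * (u / (n + 1))))) = u := by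
        field_simp
      rw [h3] at h2
      exact absurd hr (not_lt.mpr h2)
    have hG : c₀ * (m * (u / (n + 1))) ≤ L.real (Set.Ici y) := by
      refine le_trans ?_ (hcL y hy0)
      have hu1 : u / ((n : ℝ) + 1) ≤ 1 := (div_le_one hn1).mpr h
      have hu0 : 0 < u / ((n : ℝ) + 1) := by positivity
      rw [hyα]
      gcongr
      refine le_min ?_ ?_
      · have : m ≤ 1 := min_le_left _ _
        nlinarith
      · gcongr
        exact min_le_right _ _
    have hG1 : L.real (Set.Ici y) ≤ 1 := measureReal_le_one
    calc (sumLaw L n).real {r | u < ((n : ℝ) + 1) * L.real (Set.Ici (s * r))}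
        ≤ (sumLaw L n).real (Set.Iio y) := measureReal_mono hsub
      _ ≤ (1 - L.real (Set.Ici y)) ^ n := sumLaw_Iio_le hL.nonneg n y
      _ ≤ (Real.exp (-L.real (Set.Ici y))) ^ n := by
          have := Real.add_one_le_exp (-L.real (Set.Ici y))
          exact pow_le_pow_left₀ (by linarith) (by linarith) n
      _ = Real.exp (-(n * L.real (Set.Ici y))) := by rw [← Real.exp_nat_mul]; ring_nf
      _ ≤ Real.exp (-(c₀ * m / 2) * u) := by
          apply Real.exp_le_exp.mpr
          have hn' : (1 : ℝ) / 2 ≤ n / (n + 1) := by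
            rw [div_le_div_iff₀ two_pos hn1]
            have : (1 : ℝ) ≤ n := by exact_mod_cast hn
            linarith
          have h5 : (n : ℝ) * (c₀ * (m * (u / (n + 1)))) ≤ n * L.real (Set.Ici y) := by gcongr
          have h6 : (n : ℝ) * (c₀ * (m * (u / (n + 1)))) = c₀ * m * u * (n / (n + 1)) := by ring
          have h7 : c₀ * m * u * (1 / 2) ≤ c₀ * m * u * (n / (n + 1)) := by gcongr
          linarith

theorem measurable_tail_mul (s : ℝ) : Measurable fun r => L.real (Set.Ici (s * r)) :=
  antitone_tail.measurable.comp (measurable_const_mul s)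

/-- Convergence in law is upgraded to convergence of expectations. Both expectations are integrals
over `u` of the probability of exceeding `u`, and the exponential bound dominates uniformly in `n ≥
1`. -/
theorem HeavyTailedLaw.tendsto_mul_integral_tail (hL : HeavyTailedLaw α c L) (hα₀ : 0 < α)
    (hα₁ : α < 1) (hS : IsOneSidedStable α S P') {s : ℝ} (hs : 0 < s)
    (hint : Integrable (fun w => (s * S w) ^ (-α)) P') :
    Tendsto (fun n : ℕ => ((n : ℝ) + 1) * ∫ r, L.real (Set.Ici (s * r)) ∂sumLaw L n) atTop
      (𝓝 (∫ w, (s * S w) ^ (-α) ∂P')) := by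
  have hSpos := hS.ae_pos hα₀ hα₁
  have hSm := hS.measurable
  obtain ⟨C, hC, hbound⟩ := hL.exists_measure_lt_tail_le hα₀ hs
  rw [hint.integral_eq_integral_meas_lt (by
    filter_upwards [hSpos] with w hw using Real.rpow_nonneg (mul_pos hs hw).le _)]
  have hI : ∀ n : ℕ, ((n : ℝ) + 1) * ∫ r, L.real (Set.Ici (s * r)) ∂sumLaw L n =
      ∫ u in Set.Ioi 0, (sumLaw L n).real {r | u < ((n : ℝ) + 1) * L.real (Set.Ici (s * r))} := by
    intro n
    rw [← integral_const_mul]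
    refine Integrable.integral_eq_integral_meas_lt ?_ (ae_of_all _ fun r => by positivity)
    refine (Integrable.of_bound (C := 1) (measurable_tail_mul s).aestronglyMeasurable
      (ae_of_all _ fun r => ?_)).const_mul _
    rw [Real.norm_of_nonneg measureReal_nonneg]
    exact measureReal_le_one
  simp only [hI]
  refine tendsto_integral_filter_of_dominated_convergence (fun u => Real.exp (-C * u)) ?_ ?_
    (exp_neg_integrableOn_Ioi 0 hC) ?_
  · refine Eventually.of_forall fun n => Measurable.aestronglyMeasurable (Antitone.measurable ?_)
    intro u v huv
    exact measureReal_mono fun r hr => lt_of_le_of_lt huv hr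
  · filter_upwards [eventually_ge_atTop 1] with n hn
    filter_upwards [ae_restrict_mem measurableSet_Ioi] with u hu
    rw [Real.norm_of_nonneg measureReal_nonneg]
    exact hbound n hn u hu
  -- Only countably many `u` are atoms of the limit; they form a null set for `du`.
  · have hcount := Measure.countable_meas_level_set_pos (μ := P')
      (g := fun w => (s * S w) ^ (-α)) (by fun_prop)
    have hae := hcount.ae_notMem (volume.restrict (Set.Ioi (0 : ℝ)))
    filter_upwards [ae_restrict_mem measurableSet_Ioi, hae] with u hu hu'
    have hu0 : 0 < u := hu
    set z := u ^ (-(1 / α)) / s with hz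
    have hz0 : 0 < z := div_pos (Real.rpow_pos_of_pos hu0 _) hs
    have hzu : (s * z) ^ (-α) = u := by
      rw [hz, mul_div_cancel₀ _ hs.ne', ← Real.rpow_mul hu0.le,
        show -(1 / α) * -α = 1 by field_simp, Real.rpow_one]
    have hSz : P' {w | S w = z} = 0 := by
      simp only [not_lt, nonpos_iff_eq_zero] at hu'
      refine measure_mono_null (fun w hw => ?_) hu'
      rw [← hzu]
      simp only [Set.mem_ofPred_eq] at hw ⊢
      rw [hw]
    have h1 := hL.tendsto_measure_lt_tail hα₀ hα₁ hS hs hz0 hSz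
    rw [hzu] at h1
    have h2 : P' {w | S w < z} = P' {w | u < (s * S w) ^ (-α)} := by
      refine measure_congr ?_
      filter_upwards [hSpos] with w hw
      refine eq_iff_iff.mpr ?_
      change S w < z ↔ u < (s * S w) ^ (-α)
      rw [← hzu, Real.rpow_lt_rpow_iff_of_neg (mul_pos hs hz0) (mul_pos hs hw) (by linarith),
        mul_lt_mul_iff_right₀ hs]
    rw [h2] at h1
    exact (ENNReal.tendsto_toReal (measure_ne_top _ _)).comp h1

end RowSums


/-! ### Tails of an entry of the Markov matrix. -/

section RatioTails

variable {α c : ℝ} {L : Measure ℝ} [IsProbabilityMeasure L] {Ω' : Type*} [MeasurableSpace Ω']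
  {P' : Measure Ω'} [IsProbabilityMeasure P'] {S : Ω' → ℝ}

theorem IsOneSidedStable.ae_map_pos (hα₀ : 0 < α) (hα₁ : α < 1) (hS : IsOneSidedStable α S P') :
    ∀ᵐ s ∂(P'.map S), 0 < s :=
  (ae_map_iff hS.measurable.aemeasurable measurableSet_Ioi).mpr (hS.ae_pos hα₀ hα₁)

theorem IsOneSidedStable.ratioIntensity_Ici (hα₀ : 0 < α) (hα₁ : α < 1)
    (hS : IsOneSidedStable α S P') {T : ℝ} (hT : T ∈ Set.Ioo (0 : ℝ) 1) :
    ratioIntensity α (P'.map S) (Set.Ici T) =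
      ENNReal.ofReal ((T / (1 - T)) ^ (-α)) * ENNReal.ofReal (qConst α ^ (-α)) := by
  have hSp : IsProbabilityMeasure (P'.map S) :=
    Measure.isProbabilityMeasure_map hS.measurable.aemeasurable
  rw [_root_.ratioIntensity_Ici hα₀ (hS.ae_map_pos hα₀ hα₁) hT,
    lintegral_map (by fun_prop) hS.measurable, hS.lintegral_rpow_neg hα₀ hα₁]

theorem IsOneSidedStable.integrable_rpow_neg (hα₀ : 0 < α) (hα₁ : α < 1)
    (hS : IsOneSidedStable α S P') {s : ℝ} (hs : 0 < s) :
    Integrable (fun w => (s * S w) ^ (-α)) P' := by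
  have hSm := hS.measurable
  have h1 : Integrable (fun w => S w ^ (-α)) P' := by
    refine (lintegral_ofReal_ne_top_iff_integrable (hSm.pow_const _).aestronglyMeasurable ?_).mp ?_
    · filter_upwards [hS.ae_pos hα₀ hα₁] with w hw using Real.rpow_nonneg hw.le _
    · rw [hS.lintegral_rpow_neg hα₀ hα₁]
      exact ENNReal.ofReal_ne_top
  refine (h1.const_mul (s ^ (-α))).congr ?_
  filter_upwards [hS.ae_pos hα₀ hα₁] with w hw
  rw [Real.mul_rpow hs.le hw.le]

theorem IsOneSidedStable.ratioIntensity_real_Ici (hα₀ : 0 < α) (hα₁ : α < 1)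
    (hS : IsOneSidedStable α S P') {T : ℝ} (hT : T ∈ Set.Ioo (0 : ℝ) 1) :
    (ratioIntensity α (P'.map S)).real (Set.Ici T) =
      ∫ w, (T / (1 - T) * S w) ^ (-α) ∂P' := by
  have hs : 0 < T / (1 - T) := div_pos hT.1 (sub_pos.mpr hT.2)
  have hSm := hS.measurable
  rw [measureReal_def, hS.ratioIntensity_Ici hα₀ hα₁ hT, ← hS.lintegral_rpow_neg hα₀ hα₁,
    integral_eq_lintegral_of_nonneg_ae, ← lintegral_const_mul _ (by fun_prop)]
  · congr 1
    refine lintegral_congr_ae ?_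
    filter_upwards [hS.ae_pos hα₀ hα₁] with w hw
    rw [Real.mul_rpow hs.le hw.le, ENNReal.ofReal_mul (Real.rpow_nonneg hs.le _)]
  · filter_upwards [hS.ae_pos hα₀ hα₁] with w hw using Real.rpow_nonneg (mul_pos hs hw).le _
  · exact ((hSm.const_mul _).pow_const _).aestronglyMeasurable

theorem HeavyTailedLaw.tail_one_pos (hL : HeavyTailedLaw α c L) (hα : 0 < α) :
    0 < L.real (Set.Ici 1) := by
  obtain ⟨C, hC, h⟩ := hL.exists_le_tail hα
  have := h 1 one_pos
  simp only [Real.one_rpow, min_self, mul_one] at this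
  linarith

/-- The probability is exponentially small because `L [1, ∞) > 0`. This makes vanishing rows
negligible even after multiplication by `n + 1`. -/
theorem HeavyTailedLaw.tendsto_mul_sumLaw_Iio (hL : HeavyTailedLaw α c L) (hα : 0 < α) :
    Tendsto (fun n : ℕ => ((n : ℝ) + 1) * (sumLaw L n).real (Set.Iio 1)) atTop (𝓝 0) := by
  have h1 := hL.tail_one_pos hα
  have h2 : L.real (Set.Ici 1) ≤ 1 := measureReal_le_one
  have h3 := (tendsto_self_mul_const_pow_of_lt_one (r := 1 - L.real (Set.Ici 1))
    (by linarith) (by linarith)).add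
    (tendsto_pow_atTop_nhds_zero_of_lt_one (r := 1 - L.real (Set.Ici 1))
    (by linarith) (by linarith))
  rw [add_zero] at h3
  refine squeeze_zero (fun n => by positivity) (fun n => ?_) h3
  have := sumLaw_Iio_le hL.nonneg n 1
  calc ((n : ℝ) + 1) * (sumLaw L n).real (Set.Iio 1)
      ≤ ((n : ℝ) + 1) * (1 - L.real (Set.Ici 1)) ^ n := by gcongr
    _ = _ := by ring

/-- The law of an entry of the Markov matrix. -/
noncomputable def entryLaw (L : Measure ℝ) (n : ℕ) : Measure ℝ :=
  (L.prod (sumLaw L n)).map fun z => z.1 / (z.1 + z.2)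

instance isProbabilityMeasure_entryLaw (n : ℕ) : IsProbabilityMeasure (entryLaw L n) :=
  Measure.isProbabilityMeasure_map measurable_fst_div_add.aemeasurable

/-- `x / (x + r) ≥ T` amounts to `x ≥ s r`, of conditional probability the tail at `s r`. The two
events can differ only when `r = 0`, because of division by zero, and `{r < 1}` is negligible. -/
theorem HeavyTailedLaw.tendsto_mul_entryLaw (hL : HeavyTailedLaw α c L) (hα₀ : 0 < α)
    (hα₁ : α < 1) (hS : IsOneSidedStable α S P') {T : ℝ} (hT : T ∈ Set.Ioo (0 : ℝ) 1) :
    Tendsto (fun n : ℕ => ((n : ℝ) + 1) * (entryLaw L n).real (Set.Ici T)) atTop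
      (𝓝 ((ratioIntensity α (P'.map S)).real (Set.Ici T))) := by
  have hs : 0 < T / (1 - T) := div_pos hT.1 (sub_pos.mpr hT.2)
  set s := T / (1 - T) with hsdef
  rw [hS.ratioIntensity_real_Ici hα₀ hα₁ hT]
  have h1 := hL.tendsto_mul_integral_tail hα₀ hα₁ hS hs (hS.integrable_rpow_neg hα₀ hα₁ hs)
  have h0 := hL.tendsto_mul_sumLaw_Iio hα₀
  have hnn : ∀ n, ∀ᵐ z ∂(L.prod (sumLaw L n)), 0 ≤ z.1 ∧ 0 ≤ z.2 := by
    intro n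
    have a1 : ∀ᵐ z ∂(L.prod (sumLaw L n)), 0 ≤ z.1 :=
      Measure.quasiMeasurePreserving_fst.ae hL.nonneg
    have a2 : ∀ᵐ z ∂(L.prod (sumLaw L n)), 0 ≤ z.2 :=
      Measure.quasiMeasurePreserving_snd.ae (ae_sumLaw_nonneg hL.nonneg n)
    filter_upwards [a1, a2] with z h h' using ⟨h, h'⟩
  have hm : MeasurableSet {z : ℝ × ℝ | s * z.2 ≤ z.1} :=
    measurableSet_le (by fun_prop) (by fun_prop)
  have hE : ∀ n, ∫ r, L.real (Set.Ici (s * r)) ∂sumLaw L n =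
      (L.prod (sumLaw L n)).real {z | s * z.2 ≤ z.1} := by
    intro n
    rw [measureReal_def, Measure.prod_apply_symm hm, integral_eq_lintegral_of_nonneg_ae
      (ae_of_all _ fun r => measureReal_nonneg) (measurable_tail_mul s).aestronglyMeasurable]
    congr 1
    refine lintegral_congr fun r => ?_
    rw [ofReal_measureReal]
    rfl
  simp only [hE] at h1
  have hle : ∀ n, (entryLaw L n).real (Set.Ici T) ≤
      (L.prod (sumLaw L n)).real {z | s * z.2 ≤ z.1} := by
    intro n
    rw [entryLaw, map_measureReal_apply measurable_fst_div_add measurableSet_Ici]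
    refine ENNReal.toReal_mono (measure_ne_top _ _) (measure_mono_ae ?_)
    filter_upwards [hnn n] with z hz h
    have h' : T ≤ z.1 / (z.1 + z.2) := h
    rcases (add_nonneg hz.1 hz.2).eq_or_lt with h2 | h2
    · rw [← h2, div_zero] at h'
      exact absurd hT.1 (not_lt.mpr h')
    · exact (mul_comm s z.2).trans_le ((le_div_add_iff hT h2).mp h')
  have hge : ∀ n, (L.prod (sumLaw L n)).real {z | s * z.2 ≤ z.1} ≤
      (entryLaw L n).real (Set.Ici T) + (sumLaw L n).real (Set.Iio 1) := by
    intro n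
    have e1 : (sumLaw L n).real (Set.Iio 1) = (L.prod (sumLaw L n)).real (Prod.snd ⁻¹' Set.Iio 1) := by
      rw [← map_measureReal_apply measurable_snd measurableSet_Iio,
        ← Measure.snd, Measure.snd_prod]
    rw [entryLaw, map_measureReal_apply measurable_fst_div_add measurableSet_Ici, e1]
    refine le_trans (ENNReal.toReal_mono (measure_ne_top _ _) (measure_mono_ae ?_))
      (measureReal_union_le _ _)
    filter_upwards [hnn n] with z hz h
    rcases hz.2.eq_or_lt with h2 | h2
    · right
      change z.2 < 1
      rw [← h2]
      exact one_pos
    · left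
      exact (le_div_add_iff hT (by linarith [hz.1])).mpr (by rw [mul_comm]; exact h)
  refine tendsto_of_tendsto_of_tendsto_of_le_of_le (by simpa using h1.sub h0) h1
    (fun n => ?_) (fun n => ?_)
  · have := hge n
    have hn : (0 : ℝ) ≤ (n : ℝ) + 1 := by positivity
    simp only
    nlinarith
  · have := hle n
    simp only
    gcongr

end RatioTails

/-! ### Poisson limit of the counts over independent rows. -/

section Counts

theorem prod_exp_neg_ncard {ι : Type*} [Fintype ι] {m : ℕ} (t : Fin m → ℝ) (p : Fin m → ℕ)
    (y : ι → ℝ) : ∏ j, Real.exp (-({i | t j ≤ y i}.ncard : ℝ)) ^ p j =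
      ∏ i, levelWeight t p (y i) := by
  classical
  simp only [levelWeight]
  rw [Finset.prod_comm]
  refine Finset.prod_congr rfl fun j _ => ?_
  rw [Finset.prod_ite, Finset.prod_const, Finset.prod_const_one, mul_one,
    Set.ncard_eq_toFinset_card', ← Real.exp_nat_mul, ← Real.exp_nat_mul]
  congr 1
  rw [Set.toFinset_ofPred]
  ring

theorem tendsto_one_add_pow_succ {g : ℕ → ℝ} {x : ℝ}
    (h : Tendsto (fun n : ℕ => ((n : ℝ) + 1) * g n) atTop (𝓝 x)) :
    Tendsto (fun n => (1 + g n) ^ (n + 1)) atTop (𝓝 (Real.exp x)) := by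
  have h1 : Tendsto (fun n : ℕ => (n : ℝ) * g (n - 1)) atTop (𝓝 x) := by
    rw [← tendsto_add_atTop_iff_nat 1]
    simpa using h
  simpa using (tendsto_add_atTop_iff_nat 1).mpr (Real.tendsto_one_add_pow_exp_of_tendsto h1)

/-- The law of rare events: each row contributes a factor `1 - x_n`, where `(n + 1) x_n` converges.
-/
theorem tendsto_integral_levelWeight_pow {μ : ℕ → Measure ℝ} [∀ n, IsProbabilityMeasure (μ n)]
    {ν : Measure ℝ} (hν : ∀ T ∈ Set.Ioo (0 : ℝ) 1, ν (Set.Ici T) ≠ ⊤)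
    (h : ∀ T ∈ Set.Ioo (0 : ℝ) 1, Tendsto (fun n : ℕ => ((n : ℝ) + 1) * (μ n).real (Set.Ici T)) atTop
      (𝓝 (ν.real (Set.Ici T)))) {m : ℕ} {t : Fin m → ℝ} (ht : ∀ j, t j ∈ Set.Ioo (0 : ℝ) 1)
    (p : Fin m → ℕ) :
    Tendsto (fun n => (∫ y, levelWeight t p y ∂μ n) ^ (n + 1)) atTop
      (𝓝 (Real.exp (-∫ y, (1 - levelWeight t p y) ∂ν))) := by
  have h1 := tendsto_integral_of_mem_levelSpan (fun n T _ => measure_ne_top (μ n) _) hν h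
    (one_sub_levelWeight_mem_levelSpan ht p)
  have h2 : Tendsto (fun n : ℕ => ((n : ℝ) + 1) * -∫ y, (1 - levelWeight t p y) ∂μ n) atTop
      (𝓝 (-∫ y, (1 - levelWeight t p y) ∂ν)) := by
    simpa only [mul_neg] using h1.neg
  refine (tendsto_one_add_pow_succ h2).congr fun n => ?_
  congr 1
  have hi : Integrable (fun y => levelWeight t p y) (μ n) := by
    refine Integrable.of_bound (C := 1) (measurable_levelWeight t p).aestronglyMeasurable
      (ae_of_all _ fun y => ?_)
    rw [Real.norm_of_nonneg (levelWeight_mem_Icc t p y).1]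
    exact (levelWeight_mem_Icc t p y).2
  rw [integral_sub (integrable_const _) hi]
  simp

end Counts

/-! ### Joint law of the first column and the remaining row sums. -/

section RandomMatrix

variable {Ω : Type*} [MeasurableSpace Ω] {P : Measure Ω} [IsProbabilityMeasure P] {L : Measure ℝ}
  [IsProbabilityMeasure L] {n : ℕ}

theorem IsIIDMatrix.measurable_rows {m : ℕ} {X : Ω → Matrix (Fin m) (Fin m) ℝ}
    (hX : IsIIDMatrix X L P) : Measurable fun w (i j : Fin m) => X w i j :=
  measurable_pi_lambda _ fun i => measurable_pi_lambda _ fun j => hX.measurable i j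

theorem IsIIDMatrix.map_rows {m : ℕ} {X : Ω → Matrix (Fin m) (Fin m) ℝ}
    (hX : IsIIDMatrix X L P) : P.map (fun w (i j : Fin m) => X w i j) =
      Measure.pi fun _ : Fin m => Measure.pi fun _ : Fin m => L := by
  have hu : Measurable fun (x : Fin m → Fin m → ℝ) (p : Fin m × Fin m) => x p.1 p.2 := by fun_prop
  have hc : Measurable fun (x : Fin m × Fin m → ℝ) (i j : Fin m) => x (i, j) := by fun_prop
  have h1 : (Measure.pi fun _ : Fin m => Measure.pi fun _ : Fin m => L).map
      (fun x (p : Fin m × Fin m) => x p.1 p.2) = Measure.pi fun _ : Fin m × Fin m => L := by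
    symm
    refine Measure.pi_eq fun s hs => ?_
    rw [Measure.map_apply hu (MeasurableSet.univ_pi hs)]
    have : (fun (x : Fin m → Fin m → ℝ) (p : Fin m × Fin m) => x p.1 p.2) ⁻¹' Set.univ.pi s =
        Set.univ.pi fun i => Set.univ.pi fun j => s (i, j) := by
      ext x
      simp
    rw [this, Measure.pi_pi, Fintype.prod_prod_type]
    simp [Measure.pi_pi]
  have h2 : P.map (fun w (p : Fin m × Fin m) => X w p.1 p.2) =
      Measure.pi fun _ : Fin m × Fin m => L := by
    refine (hX.indep.map_fun_eq_pi_map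
      fun p : Fin m × Fin m => (hX.measurable p.1 p.2).aemeasurable).trans ?_
    congr 1
    funext p
    exact (hX.law p.1 p.2).map_eq
  have hm : Measurable fun w (p : Fin m × Fin m) => X w p.1 p.2 :=
    measurable_pi_lambda _ fun p => hX.measurable p.1 p.2
  have h3 := congrArg (Measure.map fun (x : Fin m × Fin m → ℝ) (i j : Fin m) => x (i, j))
    (h2.trans h1.symm)
  rw [Measure.map_map hc hm, Measure.map_map hc hu] at h3
  have h4 : (fun (x : Fin m × Fin m → ℝ) (i j : Fin m) => x (i, j)) ∘
      (fun (x : Fin m → Fin m → ℝ) (p : Fin m × Fin m) => x p.1 p.2) = id := rfl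
  rw [h4, Measure.map_id] at h3
  exact h3

theorem map_pi_head_sum (L : Measure ℝ) [IsProbabilityMeasure L] (n : ℕ) :
    (Measure.pi fun _ : Fin (n + 1) => L).map (fun x => (x 0, ∑ l : Fin n, x l.succ)) =
      L.prod (sumLaw L n) := by
  have h := (measurePreserving_piFinSuccAbove (fun _ : Fin (n + 1) => L) 0).map_eq
  have hg : Measurable fun x : Fin n → ℝ => ∑ l, x l := by fun_prop
  have h2 := congrArg (Measure.map (Prod.map id fun x : Fin n → ℝ => ∑ l, x l)) h
  rw [Measure.map_map (measurable_id.prodMap hg) (MeasurableEquiv.measurable _),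
    ← Measure.map_prod_map _ _ measurable_id hg, Measure.map_id] at h2
  exact h2

/-- The sum of the entries of the row `j` outside the first column. -/
def tailRowSum (X : Matrix (Fin (n + 1)) (Fin (n + 1)) ℝ) (j : Fin (n + 1)) : ℝ :=
  ∑ l : Fin n, X j l.succ

variable {X : Ω → Matrix (Fin (n + 1)) (Fin (n + 1)) ℝ}

theorem IsIIDMatrix.measurable_tailRowSum (hX : IsIIDMatrix X L P) (j : Fin (n + 1)) :
    Measurable fun w => tailRowSum (X w) j :=
  Finset.measurable_fun_sum _ fun l _ => hX.measurable j l.succ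

theorem IsIIDMatrix.map_head_tailRowSum (hX : IsIIDMatrix X L P) :
    P.map (fun w j => (X w j 0, tailRowSum (X w) j)) =
      Measure.pi fun _ : Fin (n + 1) => L.prod (sumLaw L n) := by
  have hg : Measurable fun x : Fin (n + 1) → ℝ => (x 0, ∑ l : Fin n, x l.succ) := by fun_prop
  have hG : Measurable fun (x : Fin (n + 1) → Fin (n + 1) → ℝ) j =>
    (x j 0, ∑ l : Fin n, x j l.succ) := by fun_prop
  have h := congrArg (Measure.map fun (x : Fin (n + 1) → Fin (n + 1) → ℝ) j =>
    (x j 0, ∑ l : Fin n, x j l.succ)) hX.map_rows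
  rw [Measure.map_map hG hX.measurable_rows] at h
  have hsf : ∀ _ : Fin (n + 1), SigmaFinite (((Measure.pi fun _ : Fin (n + 1) => L)).map
      fun x => (x 0, ∑ l : Fin n, x l.succ)) := fun _ => by
    rw [map_pi_head_sum]; infer_instance
  have h2 := Measure.pi_map_pi (μ := fun _ : Fin (n + 1) => Measure.pi fun _ : Fin (n + 1) => L)
    (f := fun _ x => (x 0, ∑ l : Fin n, x l.succ)) (fun _ => hg.aemeasurable)
  rw [h2] at h
  simp only [map_pi_head_sum] at h
  exact h

/-- Regroups the i.i.d. pairs into two independent vectors; a permutation read off from the column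
is then independent of the row sums. -/
theorem IsIIDMatrix.map_column_tailRowSum (hX : IsIIDMatrix X L P) :
    P.map (fun w => ((fun j => X w j 0), fun j => tailRowSum (X w) j)) =
      (Measure.pi fun _ : Fin (n + 1) => L).prod (Measure.pi fun _ : Fin (n + 1) => sumLaw L n) := by
  have h := (measurePreserving_arrowProdEquivProdArrow ℝ ℝ (Fin (n + 1)) (fun _ => L)
    (fun _ => sumLaw L n)).map_eq
  rw [← hX.map_head_tailRowSum, Measure.map_map (MeasurableEquiv.measurable _)
    (measurable_pi_lambda _ fun j => (hX.measurable j 0).prodMk (hX.measurable_tailRowSum j))] at h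
  exact h

end RandomMatrix


/-! ### Modification on events of vanishing probability. -/

section Approximation

variable {Ω : ℕ → Type*} [∀ n, MeasurableSpace (Ω n)] {P : ∀ n, Measure (Ω n)}
  [∀ n, IsProbabilityMeasure (P n)] {Ω' : Type*} [MeasurableSpace Ω'] {P' : Measure Ω'}
  [IsProbabilityMeasure P']

theorem MeasureTheory.TendstoInDistribution.congr_of_tendsto_measure_ne {E : Type*}
    [NormedAddCommGroup E] [SecondCountableTopology E] [MeasurableSpace E] [BorelSpace E]
    {Y D : ∀ n, Ω n → E} {Y' : Ω' → E} (h : TendstoInDistribution D atTop Y' P P')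
    (hY : ∀ n, AEMeasurable (Y n) (P n)) {b : ℕ → ℝ} (hb : Tendsto b atTop (𝓝 0))
    (hle : ∀ᶠ n in atTop, (P n).real {w | Y n w ≠ D n w} ≤ b n) :
    TendstoInDistribution Y atTop Y' P P' := by
  refine tendstoInDistribution_of_forall_approx hY h.aemeasurable_limit fun ε hε =>
    ⟨D, Y', h, ?_, ?_⟩
  · filter_upwards [hle, hb.eventually_le_const hε] with n h1 h2
    refine (measureReal_mono fun w hw => ?_).trans (h1.trans h2)
    intro heq
    simp only [Set.mem_ofPred_eq, heq, sub_self, norm_zero] at hw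
    exact absurd hw (not_lt.mpr hε.le)
  · simp [not_lt.mpr hε.le, hε.le]

end Approximation

/-! ### The first column of the Markov matrix. -/

section MarkovMatrix

variable {n : ℕ}

theorem div_add_mem_Icc {x r : ℝ} (hx : 0 ≤ x) (hr : 0 ≤ r) : x / (x + r) ∈ Set.Icc (0 : ℝ) 1 :=
  ⟨div_nonneg hx (add_nonneg hx hr), div_le_one_of_le₀ (by linarith) (add_nonneg hx hr)⟩

theorem sum_row_eq (X : Matrix (Fin (n + 1)) (Fin (n + 1)) ℝ) (j : Fin (n + 1)) :
    ∑ l, X j l = X j 0 + tailRowSum X j :=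
  Fin.sum_univ_succ _

/-- Only row `0` has to be nonzero: in any other vanishing row the prescribed entry `0` agrees with
division by zero. -/
theorem markovMatrix_column_eq {X : Matrix (Fin (n + 1)) (Fin (n + 1)) ℝ}
    (h : ∑ l, X 0 l ≠ 0) (j : Fin (n + 1)) :
    markovMatrix X j 0 = X j 0 / (X j 0 + tailRowSum X j) := by
  unfold markovMatrix
  rw [sum_row_eq]
  split_ifs with h1 h2
  · subst h2
    exact absurd ((sum_row_eq X 0).trans h1) h
  · rw [h1, div_zero]
  · rfl

theorem markovMatrix_mem_Icc {X : Matrix (Fin (n + 1)) (Fin (n + 1)) ℝ} (hX : ∀ i j, 0 ≤ X i j)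
    (i j : Fin (n + 1)) : markovMatrix X i j ∈ Set.Icc (0 : ℝ) 1 := by
  have h0 : 0 ≤ ∑ l, X i l := Finset.sum_nonneg fun l _ => hX i l
  unfold markovMatrix
  split_ifs
  · simp
  · simp
  · exact ⟨div_nonneg (hX i j) h0, div_le_one_of_le₀
      (Finset.single_le_sum (fun l _ => hX i l) (Finset.mem_univ j)) h0⟩

variable {Ω : Type*} [MeasurableSpace Ω] {P : Measure Ω} [IsProbabilityMeasure P] {α c : ℝ}
  {L : Measure ℝ} [IsProbabilityMeasure L] {X : Ω → Matrix (Fin (n + 1)) (Fin (n + 1)) ℝ}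

theorem IsIIDMatrix.ae_nonneg (hX : IsIIDMatrix X L P) (hL : ∀ᵐ x ∂L, 0 ≤ x) :
    ∀ᵐ w ∂P, ∀ i j, 0 ≤ X w i j :=
  ae_all_iff.mpr fun i => ae_all_iff.mpr fun j => by
    have h := (hX.law i j).map_eq
    rw [← h] at hL
    exact (ae_map_iff (hX.measurable i j).aemeasurable measurableSet_Ici).mp hL

theorem tailRowSum_nonneg {X : Matrix (Fin (n + 1)) (Fin (n + 1)) ℝ} (hX : ∀ i j, 0 ≤ X i j)
    (j : Fin (n + 1)) : 0 ≤ tailRowSum X j :=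
  Finset.sum_nonneg fun l _ => hX j l.succ

theorem IsIIDMatrix.measurable_markovMatrix (hX : IsIIDMatrix X L P) (i j : Fin (n + 1)) :
    Measurable fun w => markovMatrix (X w) i j := by
  have hs : Measurable fun w => ∑ l, X w i l :=
    Finset.measurable_fun_sum _ fun l _ => hX.measurable i l
  exact Measurable.ite (hs (measurableSet_singleton 0)) measurable_const ((hX.measurable i j).div hs)

theorem IsIIDMatrix.measureReal_row_eq_zero_le (hX : IsIIDMatrix X L P) (hL : ∀ᵐ x ∂L, 0 ≤ x) :
    P.real {w | ∑ l, X w 0 l = 0} ≤ (sumLaw L n).real (Set.Iio 1) := by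
  have h1 : P.map (fun w => tailRowSum (X w) 0) = sumLaw L n := by
    have h := congrArg (Measure.map fun z : Fin (n + 1) → ℝ × ℝ => (z 0).2) hX.map_head_tailRowSum
    rw [Measure.map_map (by fun_prop) (measurable_pi_lambda _ fun j =>
      (hX.measurable j 0).prodMk (hX.measurable_tailRowSum j))] at h
    refine h.trans ?_
    have h2 := (measurePreserving_eval (fun _ : Fin (n + 1) => L.prod (sumLaw L n)) 0).map_eq
    have h3 := congrArg (Measure.map Prod.snd) h2
    rw [Measure.map_map measurable_snd (measurable_pi_apply 0), ← Measure.snd,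
      Measure.snd_prod] at h3
    exact h3
  rw [← h1, map_measureReal_apply (hX.measurable_tailRowSum 0) measurableSet_Iio]
  refine ENNReal.toReal_mono (measure_ne_top _ _) (measure_mono_ae ?_)
  filter_upwards [hX.ae_nonneg hL] with w hw h
  have h' : ∑ l, X w 0 l = 0 := h
  rw [sum_row_eq] at h'
  change tailRowSum (X w) 0 < 1
  linarith [hw 0 0]

theorem integral_prod_counts_eq {E : Type*} [MeasurableSpace E] {m k : ℕ} {Z : Ω → Fin m → E}
    (hZ : Measurable Z) {ρ : Measure E} [IsProbabilityMeasure ρ]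
    (h : P.map Z = Measure.pi fun _ : Fin m => ρ) {g : E → ℝ} (hg : Measurable g) (t : Fin k → ℝ)
    (p : Fin k → ℕ) :
    ∫ w, ∏ j, Real.exp (-({i | t j ≤ g (Z w i)}.ncard : ℝ)) ^ p j ∂P =
      (∫ y, levelWeight t p y ∂(ρ.map g)) ^ m := by
  have hm := (measurable_levelWeight t p).comp hg
  have hm' : Measurable fun z : Fin m → E => ∏ i, levelWeight t p (g (z i)) :=
    Finset.measurable_fun_prod _ fun i _ => hm.comp (measurable_pi_apply i)
  simp only [prod_exp_neg_ncard]
  rw [← integral_map (f := fun z : Fin m → E => ∏ i, levelWeight t p (g (z i))) hZ.aemeasurable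
      hm'.aestronglyMeasurable, h,
    integral_fintype_prod_eq_prod (fun _ x => levelWeight t p (g x)),
    integral_map hg.aemeasurable (measurable_levelWeight t p).aestronglyMeasurable]
  simp

end MarkovMatrix

/-! ### The ranked first column and its limit. -/

section RankedLimit

variable {α c : ℝ} {L : Measure ℝ} [IsProbabilityMeasure L]
  {Ω : ℕ → Type*} [∀ n, MeasurableSpace (Ω n)] {P : ∀ n, Measure (Ω n)}
  [∀ n, IsProbabilityMeasure (P n)] {X : ∀ n, Ω n → Matrix (Fin (n + 1)) (Fin (n + 1)) ℝ}
  {Ω' : Type*} [MeasurableSpace Ω'] {P' : Measure Ω'} [IsProbabilityMeasure P']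
  {ξ S : ℕ → Ω' → ℝ}

theorem isMarkedPoisson_of_stable (hξ : IsPPP α ξ P') (hS : ∀ i, IsOneSidedStable α (S i) P')
    (hSindep : iIndepFun S P') (hξS : IndepFun (fun w i => ξ i w) (fun w i => S i w) P') :
    IsMarkedPoisson ξ S (pppIntensity α) (P'.map (S 0)) P' where
  poisson := hξ.poisson
  measurable_mark i := (hS i).measurable
  law_mark i := (hS i).map_eq (hS 0)
  indep_mark := hSindep
  indep := hξS

theorem IsOneSidedStable.ratioIntensity_ne_top (hα₀ : 0 < α) (hα₁ : α < 1) {S : Ω' → ℝ}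
    (hS : IsOneSidedStable α S P') : ∀ T ∈ Set.Ioo (0 : ℝ) 1,
      ratioIntensity α (P'.map S) (Set.Ici T) ≠ ⊤ := fun T hT => by
  rw [hS.ratioIntensity_Ici hα₀ hα₁ hT]
  exact ENNReal.mul_ne_top ENNReal.ofReal_ne_top ENNReal.ofReal_ne_top

theorem finite_setOf_le_fin {m : ℕ} (y : Fin m → ℝ) : ∀ s : ℝ, 0 < s → {i | s ≤ y i}.Finite :=
  fun _ _ => Set.toFinite _

theorem tendstoInDistribution_ranked_markovMatrix (hα₀ : 0 < α) (hα₁ : α < 1)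
    (hL : HeavyTailedLaw α c L) (hX : ∀ n, IsIIDMatrix (X n) L (P n)) (hξ : IsPPP α ξ P')
    (hS : ∀ i, IsOneSidedStable α (S i) P') (hSindep : iIndepFun S P')
    (hξS : IndepFun (fun w i => ξ i w) (fun w i => S i w) P') (k : ℕ) :
    TendstoInDistribution
      (fun n w (i : Fin k) => ranked (fun j => markovMatrix (X n w) j 0) i) atTop
      (fun w (i : Fin k) => ranked (fun j => ξ j w / (ξ j w + S j w)) i) P P' := by
  have hM := isMarkedPoisson_of_stable hξ hS hSindep hξS
  have hκ := (hS 0).ae_map_pos hα₀ hα₁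
  have hfin := (hS 0).ratioIntensity_ne_top hα₀ hα₁
  have hκp : IsProbabilityMeasure (P'.map (S 0)) :=
    Measure.isProbabilityMeasure_map (hS 0).measurable.aemeasurable
  have hD := hM.tendstoInDistribution_ranked hκ hfin (Q := P)
    (y := fun n (j : Fin (n + 1)) w => X n w j 0 / (X n w j 0 + tailRowSum (X n w) j))
    (fun n j => ((hX n).measurable j 0).div
      (((hX n).measurable j 0).add ((hX n).measurable_tailRowSum j)))
    (fun n => by
      filter_upwards [(hX n).ae_nonneg hL.nonneg] with w hw j
      exact div_add_mem_Icc (hw j 0) (tailRowSum_nonneg hw j))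
    (fun n => ae_of_all _ fun w => finite_setOf_le_fin _)
    (fun m t ht p => by
      refine (tendsto_integral_levelWeight_pow hfin
        (fun T hT => hL.tendsto_mul_entryLaw hα₀ hα₁ (hS 0) hT) ht p).congr fun n => ?_
      exact (integral_prod_counts_eq (measurable_pi_lambda _ fun j =>
        ((hX n).measurable j 0).prodMk ((hX n).measurable_tailRowSum j))
        (hX n).map_head_tailRowSum measurable_fst_div_add t p).symm) k
  have hb : Tendsto (fun n : ℕ => (sumLaw L n).real (Set.Iio 1)) atTop (𝓝 0) :=
    squeeze_zero (fun n => measureReal_nonneg) (fun n => by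
      have h1 : (0 : ℝ) ≤ n := Nat.cast_nonneg n
      have h2 : 0 ≤ (sumLaw L n).real (Set.Iio 1) := measureReal_nonneg
      nlinarith) (hL.tendsto_mul_sumLaw_Iio hα₀)
  -- The limit was obtained for `x / (x + r)`, which is i.i.d. over the rows; the matrix entries
  -- agree with it unless row `0` vanishes.
  refine hD.congr_of_tendsto_measure_ne (fun n => ?_) hb (Eventually.of_forall fun n => ?_)
  · refine aemeasurable_pi_lambda _ fun i => ?_
    refine aemeasurable_ranked (fun j => (hX n).measurable_markovMatrix j 0) ?_
      (ae_of_all _ fun w => finite_setOf_le_fin _) i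
    filter_upwards [(hX n).ae_nonneg hL.nonneg] with w hw j using markovMatrix_mem_Icc hw j 0
  · refine le_trans (measureReal_mono fun w hw => ?_) ((hX n).measureReal_row_eq_zero_le hL.nonneg)
    by_contra hne
    exact hw (by simp only [markovMatrix_column_eq hne])

theorem ae_exists_perm_ranked_ratio (hα₀ : 0 < α) (hα₁ : α < 1) (hξ : IsPPP α ξ P')
    (hS : ∀ i, IsOneSidedStable α (S i) P') (hSindep : iIndepFun S P')
    (hξS : IndepFun (fun w i => ξ i w) (fun w i => S i w) P') :
    ∀ᵐ w ∂P', Antitone (ranked fun i => ξ i w / (ξ i w + S i w)) ∧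
      ∃ τ : Equiv.Perm ℕ, ∀ k,
        ranked (fun i => ξ i w / (ξ i w + S i w)) k = ξ (τ k) w / (ξ (τ k) w + S (τ k) w) := by
  have hM := isMarkedPoisson_of_stable hξ hS hSindep hξS
  have hκp : IsProbabilityMeasure (P'.map (S 0)) :=
    Measure.isProbabilityMeasure_map (hS 0).measurable.aemeasurable
  filter_upwards [hM.ae_pos ((hS 0).ae_map_pos hα₀ hα₁),
    hM.ae_finite_ratio ((hS 0).ratioIntensity_ne_top hα₀ hα₁)] with w hpos hfin
  obtain ⟨τ, hτ⟩ := exists_perm_antitone (y := fun i => ξ i w / (ξ i w + S i w))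
    (fun i => (div_add_mem_Ioo (hpos i).1 (hpos i).2).1) hfin
  have h := ranked_eq_of_nat (fun i => ξ i w / (ξ i w + S i w)) τ hτ
  refine ⟨fun i j hij => ?_, τ, h⟩
  rw [h, h]
  exact hτ hij

/-- Stable marks and the constant mark `q` have the same moment of order `-α`, hence the same ratio
tails. A constant mark preserves the order of the points, so nothing is left to rank. -/
theorem identDistrib_ranked_ratio (hα₀ : 0 < α) (hα₁ : α < 1) (hξ : IsPPP α ξ P')
    (hS : ∀ i, IsOneSidedStable α (S i) P') (hSindep : iIndepFun S P')
    (hξS : IndepFun (fun w i => ξ i w) (fun w i => S i w) P') :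
    IdentDistrib (fun w => ranked fun i => ξ i w / (ξ i w + S i w))
      (fun w i => ξ i w / (ξ i w + qConst α)) P' P' := by
  have hM := isMarkedPoisson_of_stable hξ hS hSindep hξS
  have hκ := (hS 0).ae_map_pos hα₀ hα₁
  have hκp : IsProbabilityMeasure (P'.map (S 0)) :=
    Measure.isProbabilityMeasure_map (hS 0).measurable.aemeasurable
  have hq := qConst_pos hα₀ hα₁
  have hC := isMarkedPoisson_const hξ.poisson (qConst α)
  have hκ' : ∀ᵐ s ∂(Measure.dirac (qConst α)), 0 < s :=
    (ae_dirac_iff measurableSet_Ioi).mpr hq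
  have heq : ∀ T ∈ Set.Ioo (0 : ℝ) 1, ratioIntensity α (P'.map (S 0)) (Set.Ici T) =
      ratioIntensity α (Measure.dirac (qConst α)) (Set.Ici T) := by
    intro T hT
    rw [(hS 0).ratioIntensity_Ici hα₀ hα₁ hT, ratioIntensity_Ici hα₀ hκ' hT, lintegral_dirac]
  have h := hM.identDistrib_ranked hC hκ hκ' ((hS 0).ratioIntensity_ne_top hα₀ hα₁) heq
  refine h.trans (IdentDistrib.of_ae_eq h.aemeasurable_snd ?_)
  filter_upwards [hC.ae_pos hκ', hξ.antitone] with w hpos hanti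
  funext i
  exact congrFun (ranked_ratio_const hanti (fun i => (hpos i).1) hq) i

end RankedLimit


/-! ### The largest entries of the first column and their row sums. -/

section FirstEntries

theorem measurable_apply_fin {A B : Type*} [MeasurableSpace A] [MeasurableSpace B] {m : ℕ}
    {F : Fin m → A → B} (hF : ∀ j, Measurable (F j)) {τ : A → Fin m} (hτ : Measurable τ) :
    Measurable fun x => F (τ x) x := by
  have h : Measurable fun z : Fin m × A => F z.1 z.2 :=
    measurable_from_prod_countable_right fun j => hF j
  exact h.comp (hτ.prodMk measurable_id)

theorem measurable_firstCoords {A : Type*} [MeasurableSpace A] {m k : ℕ} {f : A → Fin m → ℝ}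
    (hf : ∀ j, Measurable fun w => f w j) : Measurable fun w => firstCoords k (f w) := by
  refine measurable_pi_lambda _ fun i => ?_
  unfold firstCoords
  split_ifs
  · exact hf _
  · exact measurable_const

theorem firstCoords_castLE {m k : ℕ} (h : k ≤ m) (x : Fin m → ℝ) (i : Fin k) :
    firstCoords k x i = x (Fin.castLE h i) :=
  dif_pos (i.2.trans_le h)

theorem firstCoords_mem_Icc {m : ℕ} (k : ℕ) {x : Fin m → ℝ} (hx : ∀ j, x j ∈ Set.Icc (0 : ℝ) 1)
    (i : Fin k) : firstCoords k x i ∈ Set.Icc (0 : ℝ) 1 := by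
  unfold firstCoords
  split_ifs
  · exact hx _
  · simp

theorem integral_prod_eval_injective {ι : Type*} [Fintype ι] {k : ℕ} {ρ : Measure ℝ}
    [IsProbabilityMeasure ρ] {e : Fin k → ι} (he : e.Injective) {f : Fin k → ℝ → ℝ}
    (hf : ∀ i, Measurable (f i)) :
    ∫ r, ∏ i, f i (r (e i)) ∂(Measure.pi fun _ : ι => ρ) = ∏ i, ∫ x, f i x ∂ρ := by
  have h := (iIndepFun_pi (μ := fun _ : ι => ρ) (X := fun _ x => x)
    fun _ => aemeasurable_id).precomp he
  rw [h.integral_fun_prod_comp (fun i => (measurable_pi_apply (e i)).aemeasurable)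
    fun i => (hf i).aestronglyMeasurable]
  refine Finset.prod_congr rfl fun i _ => ?_
  have h2 := (measurePreserving_eval (fun _ : ι => ρ) (e i)).map_eq
  conv_rhs => rw [← h2]
  rw [integral_map (measurable_pi_apply (e i)).aemeasurable (hf i).aestronglyMeasurable]

/-- For fixed `x` the positions `τ x` are distinct, so the coordinates there are i.i.d. with a law
that does not depend on `x`: selection by an independent rule is invisible. -/
theorem integral_mul_prod_eval {A ι : Type*} [MeasurableSpace A] [Fintype ι] {k : ℕ}
    {μ : Measure A} [IsProbabilityMeasure μ] {ρ : Measure ℝ} [IsProbabilityMeasure ρ]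
    {τ : A → Fin k → ι} (hτ : ∀ x, (τ x).Injective) {f : Fin k → ℝ → ℝ}
    (hf : ∀ i, Measurable (f i)) {a : A → ℝ}
    (hint : Integrable (fun z : A × (ι → ℝ) => a z.1 * ∏ i, f i (z.2 (τ z.1 i)))
      (μ.prod (Measure.pi fun _ : ι => ρ))) :
    ∫ z, a z.1 * ∏ i, f i (z.2 (τ z.1 i)) ∂(μ.prod (Measure.pi fun _ : ι => ρ)) =
      (∫ x, a x ∂μ) * ∏ i, ∫ x, f i x ∂ρ := by
  rw [integral_prod _ hint]
  simp only [integral_const_mul, integral_prod_eval_injective (hτ _) hf, integral_mul_const]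

/-- The ratios `x / (x + a)` of the `k` largest entries of `x`. -/
noncomputable def topRatio {m : ℕ} (σ : (Fin m → ℝ) → Equiv.Perm (Fin m)) (a : ℝ) (k : ℕ)
    (x : Fin m → ℝ) : Fin k → ℝ :=
  firstCoords k fun j => x (σ x j) / (x (σ x j) + a)

/-- The weights `exp (-r / a)` at the positions of the `k` largest entries of `x`. -/
noncomputable def topWeight {m : ℕ} (σ : (Fin m → ℝ) → Equiv.Perm (Fin m)) (a : ℝ) (k : ℕ)
    (x r : Fin m → ℝ) : Fin k → ℝ :=
  firstCoords k fun j => Real.exp (-(r (σ x j) / a))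

variable {m : ℕ} {σ : (Fin m → ℝ) → Equiv.Perm (Fin m)} {a : ℝ} {k : ℕ}

theorem IsRankingRule.measurable_topRatio (hσ : IsRankingRule σ) :
    Measurable (topRatio σ a k) := by
  refine measurable_firstCoords fun j => ?_
  have h : Measurable fun x : Fin m → ℝ => x (σ x j) :=
    measurable_apply_fin (fun l => measurable_pi_apply l) (hσ.measurable j)
  exact h.div (h.add_const a)

theorem IsRankingRule.measurable_topWeight (hσ : IsRankingRule σ) :
    Measurable fun z : (Fin m → ℝ) × (Fin m → ℝ) => topWeight σ a k z.1 z.2 := by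
  refine measurable_firstCoords fun j => ?_
  have h : Measurable fun z : (Fin m → ℝ) × (Fin m → ℝ) => z.2 (σ z.1 j) :=
    measurable_apply_fin (F := fun l (z : (Fin m → ℝ) × (Fin m → ℝ)) => z.2 l)
      (fun l => (measurable_pi_apply l).comp measurable_snd)
      ((hσ.measurable j).comp measurable_fst)
  exact (h.div_const a).neg.exp

theorem topRatio_mem_Icc (ha : 0 < a) {x : Fin m → ℝ} (hx : ∀ j, 0 ≤ x j) (i : Fin k) :
    topRatio σ a k x i ∈ Set.Icc (0 : ℝ) 1 :=
  firstCoords_mem_Icc k (fun _ => div_add_mem_Icc (hx _) ha.le) i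

theorem topWeight_mem_Icc (ha : 0 < a) (x : Fin m → ℝ) {r : Fin m → ℝ} (hr : ∀ j, 0 ≤ r j)
    (i : Fin k) : topWeight σ a k x r i ∈ Set.Icc (0 : ℝ) 1 :=
  firstCoords_mem_Icc k (fun _ => exp_neg_mem_Icc (div_nonneg (hr _) ha.le)) i

/-- `x / (x + a)` is increasing in `x ≥ 0` when `a` is a constant, so ordering by `x` orders the
ratios. -/
theorem IsRankingRule.topRatio_eq_ranked (hσ : IsRankingRule σ) (ha : 0 < a) (hk : k ≤ m)
    {x : Fin m → ℝ} (hx : ∀ j, 0 ≤ x j) :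
    topRatio σ a k x = fun i : Fin k => ranked (fun j => x j / (x j + a)) i := by
  funext i
  have hanti : Antitone ((fun j => x j / (x j + a)) ∘ σ x) := by
    intro j l hjl
    have h1 := hσ.antitone x hjl
    simp only [Function.comp] at h1 ⊢
    have h2 := hx (σ x j)
    have h3 := hx (σ x l)
    rw [div_le_div_iff₀ (by positivity) (by positivity)]
    nlinarith
  rw [topRatio, firstCoords_castLE hk]
  exact (ranked_eq_of_fin _ (σ x) hanti (Fin.castLE hk i)).symm

theorem prod_pow_mem_Icc {ι : Type*} [Fintype ι] {v : ι → ℝ} (hv : ∀ i, v i ∈ Set.Icc (0 : ℝ) 1)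
    (p : ι → ℕ) : ∏ i, v i ^ p i ∈ Set.Icc (0 : ℝ) 1 :=
  ⟨Finset.prod_nonneg fun i _ => pow_nonneg (hv i).1 _,
    Finset.prod_le_one (fun i _ => pow_nonneg (hv i).1 _) fun i _ => pow_le_one₀ (hv i).1 (hv i).2⟩

variable {L : Measure ℝ} [IsProbabilityMeasure L]

theorem IsRankingRule.integral_topRatio_mul_topWeight (hσ : IsRankingRule σ) (ha : 0 < a)
    (hk : k ≤ m) (hL : ∀ᵐ x ∂L, 0 ≤ x) (n : ℕ) (p q : Fin k → ℕ) :
    ∫ z, (∏ i, topRatio σ a k z.1 i ^ p i) * ∏ i, topWeight σ a k z.1 z.2 i ^ q i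
        ∂((Measure.pi fun _ : Fin m => L).prod (Measure.pi fun _ : Fin m => sumLaw L n)) =
      (∫ x, ∏ i, topRatio σ a k x i ^ p i ∂(Measure.pi fun _ : Fin m => L)) *
        ∏ i, (∫ x, Real.exp (-(q i : ℝ) * (x / a)) ∂L) ^ n := by
  have hint : Integrable (fun z : (Fin m → ℝ) × (Fin m → ℝ) =>
      (∏ i, topRatio σ a k z.1 i ^ p i) * ∏ i, topWeight σ a k z.1 z.2 i ^ q i)
      ((Measure.pi fun _ : Fin m => L).prod (Measure.pi fun _ : Fin m => sumLaw L n)) := by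
    have h1 : Measurable fun z : (Fin m → ℝ) × (Fin m → ℝ) => ∏ i, topRatio σ a k z.1 i ^ p i :=
      Finset.measurable_fun_prod _ fun i _ => ((measurable_pi_apply i).comp
        (hσ.measurable_topRatio.comp measurable_fst)).pow_const _
    have h2 : Measurable fun z : (Fin m → ℝ) × (Fin m → ℝ) =>
        ∏ i, topWeight σ a k z.1 z.2 i ^ q i :=
      Finset.measurable_fun_prod _ fun i _ => ((measurable_pi_apply i).comp
        hσ.measurable_topWeight).pow_const _
    refine Integrable.of_bound (C := 1) (h1.mul h2).aestronglyMeasurable ?_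
    have a1 := Measure.quasiMeasurePreserving_fst (μ := Measure.pi fun _ : Fin m => L)
      (ν := Measure.pi fun _ : Fin m => sumLaw L n) |>.ae (ae_pi_nonneg hL m)
    have a2 := Measure.quasiMeasurePreserving_snd (μ := Measure.pi fun _ : Fin m => L)
      (ν := Measure.pi fun _ : Fin m => sumLaw L n) |>.ae
      (ae_pi_nonneg (ae_sumLaw_nonneg hL n) m)
    filter_upwards [a1, a2] with z hz1 hz2
    have b1 := prod_pow_mem_Icc (topRatio_mem_Icc (σ := σ) (k := k) ha hz1) p
    have b2 := prod_pow_mem_Icc (topWeight_mem_Icc (σ := σ) (k := k) ha z.1 hz2) q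
    rw [Real.norm_of_nonneg (mul_nonneg b1.1 b2.1)]
    exact mul_le_one₀ b1.2 b2.1 b2.2
  have hw : ∀ (x r : Fin m → ℝ) (i : Fin k), topWeight σ a k x r i ^ q i =
      Real.exp (-(q i : ℝ) * (r (σ x (Fin.castLE hk i)) / a)) := by
    intro x r i
    rw [topWeight, firstCoords_castLE hk, ← Real.exp_nat_mul]
    congr 1
    ring
  simp only [hw] at hint ⊢
  rw [integral_mul_prod_eval (τ := fun x i => σ x (Fin.castLE hk i))
    (f := fun i r => Real.exp (-(q i : ℝ) * (r / a)))
    (a := fun x => ∏ i, topRatio σ a k x i ^ p i)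
    (fun x => (σ x).injective.comp (Fin.castLE_injective hk)) (fun i => by fun_prop) hint]
  simp only [integral_exp_sumLaw]

/-- Recovers `x / (x + r)` from `x / (x + a)` and `exp (-r / a)`. -/
noncomputable def combineRatio (k : ℕ) (v : Fin k ⊕ Fin k → ℝ) : Fin k → ℝ := fun i =>
  v (Sum.inl i) / (v (Sum.inl i) + (1 - v (Sum.inl i)) * -Real.log (v (Sum.inr i)))

theorem measurable_combineRatio (k : ℕ) : Measurable (combineRatio k) := by
  unfold combineRatio
  fun_prop

theorem continuousOn_combineRatio (k : ℕ) :
    ContinuousOn (combineRatio k) {v | ∀ i, v i ∈ Set.Ioo (0 : ℝ) 1} := by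
  refine continuousOn_pi.mpr fun i => ?_
  have hl : ContinuousOn (fun v : Fin k ⊕ Fin k → ℝ => v (Sum.inl i))
      {v | ∀ i, v i ∈ Set.Ioo (0 : ℝ) 1} := (continuous_apply _).continuousOn
  have hr : ContinuousOn (fun v : Fin k ⊕ Fin k → ℝ => Real.log (v (Sum.inr i)))
      {v | ∀ i, v i ∈ Set.Ioo (0 : ℝ) 1} :=
    (continuous_apply _).continuousOn.log fun v hv => (hv _).1.ne'
  refine hl.div (hl.add ((continuousOn_const.sub hl).mul hr.neg)) fun v hv => ?_
  have h1 := hv (Sum.inl i)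
  have h2 := hv (Sum.inr i)
  have h3 := Real.log_neg h2.1 h2.2
  have h4 : 0 < 1 - v (Sum.inl i) := sub_pos.mpr h1.2
  nlinarith [h1.1, mul_pos h4 (neg_pos.mpr h3)]

/-- With `u = x / (x + a)`, the denominator `u + (1 - u) r / a` equals `(x + r) / (x + a)`, so the
scale `a` cancels. -/
theorem combine_div_add {x r a : ℝ} (ha : 0 < a) (hx : 0 ≤ x) :
    x / (x + a) / (x / (x + a) + (1 - x / (x + a)) * -Real.log (Real.exp (-(r / a)))) =
      x / (x + r) := by
  have h : 0 < x + a := by linarith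
  have e : x / (x + a) + (1 - x / (x + a)) * -Real.log (Real.exp (-(r / a))) =
      (x + r) / (x + a) := by
    rw [Real.log_exp]
    field_simp
    ring
  rw [e, div_div_div_cancel_right₀ h.ne']

theorem combineRatio_top (ha : 0 < a) (hk : k ≤ m) {x r : Fin m → ℝ} (hx : ∀ j, 0 ≤ x j) :
    combineRatio k (Sum.elim (topRatio σ a k x) (topWeight σ a k x r)) =
      firstCoords k fun j => x (σ x j) / (x (σ x j) + r (σ x j)) := by
  funext i
  simp only [combineRatio, Sum.elim_inl, Sum.elim_inr, topRatio, topWeight,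
    firstCoords_castLE hk]
  exact combine_div_add ha (hx _)

end FirstEntries

/-! ### Convergence of moments from convergence in distribution. -/

section Moments

variable {Ω : ℕ → Type*} [∀ n, MeasurableSpace (Ω n)] {P : ∀ n, Measure (Ω n)}
  [∀ n, IsProbabilityMeasure (P n)] {Ω' : Type*} [MeasurableSpace Ω'] {P' : Measure Ω'}
  [IsProbabilityMeasure P']

theorem MeasureTheory.TendstoInDistribution.tendsto_moments {ι : Type*} [Fintype ι]
    {V : ∀ n, Ω n → ι → ℝ} {V' : Ω' → ι → ℝ} (h : TendstoInDistribution V atTop V' P P')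
    (h01 : ∀ n, ∀ᵐ w ∂P n, ∀ i, V n w i ∈ Set.Icc (0 : ℝ) 1)
    (h01' : ∀ᵐ w ∂P', ∀ i, V' w i ∈ Set.Icc (0 : ℝ) 1) (p : ι → ℕ) :
    Tendsto (fun n => ∫ w, ∏ i, V n w i ^ p i ∂P n) atTop (𝓝 (∫ w, ∏ i, V' w i ^ p i ∂P')) := by
  -- Clamping makes the monomials bounded and continuous everywhere without changing their values on
  -- the cube.
  have hcl : ∀ v : ι → ℝ, ∀ i, max 0 (min 1 (v i)) ∈ Set.Icc (0 : ℝ) 1 := fun v i =>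
    ⟨le_max_left _ _, max_le zero_le_one (min_le_left _ _)⟩
  have hid : ∀ v : ι → ℝ, (∀ i, v i ∈ Set.Icc (0 : ℝ) 1) →
      ∏ i, max 0 (min 1 (v i)) ^ p i = ∏ i, v i ^ p i := fun v hv =>
    Finset.prod_congr rfl fun i _ => by rw [min_eq_right (hv i).2, max_eq_right (hv i).1]
  have h1 := h.tendsto_integral (BoundedContinuousFunction.ofNormedAddCommGroup
    (fun v : ι → ℝ => ∏ i, max 0 (min 1 (v i)) ^ p i) (by fun_prop) 1 fun v => by
      rw [Real.norm_of_nonneg (prod_pow_mem_Icc (hcl v) p).1]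
      exact (prod_pow_mem_Icc (hcl v) p).2)
  simp only [BoundedContinuousFunction.coe_ofNormedAddCommGroup] at h1
  have e' : ∫ w, ∏ i, max 0 (min 1 (V' w i)) ^ p i ∂P' = ∫ w, ∏ i, V' w i ^ p i ∂P' :=
    integral_congr_ae (by filter_upwards [h01'] with w hw using hid _ hw)
  rw [e'] at h1
  refine h1.congr fun n => integral_congr_ae ?_
  filter_upwards [h01 n] with w hw using hid _ hw

end Moments


/-! ### The limit of the first entries. -/

section FirstEntriesLimit

variable {α c : ℝ} {L : Measure ℝ} [IsProbabilityMeasure L]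
  {Ω : ℕ → Type*} [∀ n, MeasurableSpace (Ω n)] {P : ∀ n, Measure (Ω n)}
  [∀ n, IsProbabilityMeasure (P n)] {X : ∀ n, Ω n → Matrix (Fin (n + 1)) (Fin (n + 1)) ℝ}
  {Ω' : Type*} [MeasurableSpace Ω'] {P' : Measure Ω'} [IsProbabilityMeasure P']
  {ξ S : ℕ → Ω' → ℝ} {σ : ∀ n, (Fin (n + 1) → ℝ) → Equiv.Perm (Fin (n + 1))}

theorem IsIIDMatrix.measurable_column {Θ : Type*} [MeasurableSpace Θ] {Q : Measure Θ} {n : ℕ}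
    {Y : Θ → Matrix (Fin (n + 1)) (Fin (n + 1)) ℝ} (hY : IsIIDMatrix Y L Q) :
    Measurable fun w j => Y w j 0 :=
  measurable_pi_lambda _ fun j => hY.measurable j 0

theorem IsIIDMatrix.map_column {Θ : Type*} [MeasurableSpace Θ] {Q : Measure Θ}
    [IsProbabilityMeasure Q] {n : ℕ} {Y : Θ → Matrix (Fin (n + 1)) (Fin (n + 1)) ℝ}
    (hY : IsIIDMatrix Y L Q) :
    Q.map (fun w j => Y w j 0) = Measure.pi fun _ : Fin (n + 1) => L := by
  have h := congrArg (Measure.map Prod.fst) hY.map_column_tailRowSum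
  rw [Measure.map_map measurable_fst (hY.measurable_column.prodMk
    (measurable_pi_lambda _ fun j => hY.measurable_tailRowSum j)), ← Measure.fst,
    Measure.fst_prod] at h
  exact h

theorem HeavyTailedLaw.tendsto_mul_scaled_ratio (hL : HeavyTailedLaw α c L) (hα : 0 < α) {T : ℝ}
    (hT : T ∈ Set.Ioo (0 : ℝ) 1) :
    Tendsto (fun n : ℕ => ((n : ℝ) + 1) *
      (L.map fun x => x / (x + tailScale α c n)).real (Set.Ici T)) atTop
      (𝓝 ((ratioIntensity α (Measure.dirac 1)).real (Set.Ici T))) := by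
  have hs : 0 < T / (1 - T) := div_pos hT.1 (sub_pos.mpr hT.2)
  have h1 : (ratioIntensity α (Measure.dirac 1)).real (Set.Ici T) = (T / (1 - T)) ^ (-α) := by
    rw [measureReal_def, ratioIntensity_Ici hα
      ((ae_dirac_iff measurableSet_Ioi).mpr (zero_lt_one' ℝ)) hT, lintegral_dirac]
    simp [Real.rpow_nonneg hs.le]
  rw [h1]
  refine (hL.tendsto_mul_tail hα hs).congr fun n => ?_
  congr 1
  rw [map_measureReal_apply (by fun_prop) measurableSet_Ici]
  refine measureReal_congr ?_
  filter_upwards [hL.nonneg] with x hx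
  have ha := tailScale_pos (α := α) hL.pos n
  exact eq_iff_iff.mpr (le_div_add_iff hT (by linarith)).symm

/-- The counting argument with the constant `a_n` in place of the row sums; rescaled by `a_n`, it
becomes the mark `1` in the limit. -/
theorem tendstoInDistribution_topRatio (hα₀ : 0 < α) (hL : HeavyTailedLaw α c L)
    (hX : ∀ n, IsIIDMatrix (X n) L (P n)) (hξ : IsPPP α ξ P')
    (hσ : ∀ n, IsRankingRule (σ n)) (k : ℕ) :
    TendstoInDistribution
      (fun n w => topRatio (σ n) (tailScale α c n) k fun j => X n w j 0) atTop
      (fun w (i : Fin k) => ξ i w / (ξ i w + 1)) P P' := by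
  have hM := isMarkedPoisson_const hξ.poisson (1 : ℝ)
  have hκ : ∀ᵐ s ∂(Measure.dirac (1 : ℝ)), 0 < s :=
    (ae_dirac_iff measurableSet_Ioi).mpr (zero_lt_one' ℝ)
  have hfin : ∀ T ∈ Set.Ioo (0 : ℝ) 1,
      ratioIntensity α (Measure.dirac 1) (Set.Ici T) ≠ ⊤ := fun T hT => by
    rw [ratioIntensity_Ici hα₀ hκ hT, lintegral_dirac]
    exact ENNReal.mul_ne_top ENNReal.ofReal_ne_top ENNReal.ofReal_ne_top
  have ha := fun n => tailScale_pos (α := α) hL.pos n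
  have hg : ∀ n, Measurable fun x : ℝ => x / (x + tailScale α c n) := fun n => by fun_prop
  have hpr : ∀ n, IsProbabilityMeasure (L.map fun x => x / (x + tailScale α c n)) := fun n =>
    Measure.isProbabilityMeasure_map (hg n).aemeasurable
  have hD := hM.tendstoInDistribution_ranked hκ hfin (Q := P)
    (y := fun n (j : Fin (n + 1)) w => X n w j 0 / (X n w j 0 + tailScale α c n))
    (fun n j => (hg n).comp ((hX n).measurable j 0))
    (fun n => by
      filter_upwards [(hX n).ae_nonneg hL.nonneg] with w hw j
      exact div_add_mem_Icc (hw j 0) (ha n).le)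
    (fun n => ae_of_all _ fun w => finite_setOf_le_fin _)
    (fun m t ht p => by
      refine (tendsto_integral_levelWeight_pow hfin
        (fun T hT => hL.tendsto_mul_scaled_ratio hα₀ hT) ht p).congr fun n => ?_
      exact (integral_prod_counts_eq (hX n).measurable_column (hX n).map_column (hg n) t p).symm) k
  have hD' := hD.congr (fun n => EventuallyEq.rfl) (T := fun w (i : Fin k) => ξ i w / (ξ i w + 1)) (by
    filter_upwards [hM.ae_pos hκ, hξ.antitone] with w hpos hanti
    funext i
    exact congrFun (ranked_ratio_const hanti (fun i => (hpos i).1) one_pos) i)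
  refine hD'.congr_of_tendsto_measure_ne
    (fun n => ((hσ n).measurable_topRatio.comp (hX n).measurable_column).aemeasurable)
    (b := fun _ => 0) tendsto_const_nhds ?_
  -- For `n ≥ k` there are at least `k` rows, so `firstCoords` pads nothing.
  filter_upwards [eventually_ge_atTop k] with n hn
  refine (measureReal_eq_zero_of_ae ?_).le
  filter_upwards [(hX n).ae_nonneg hL.nonneg] with w hw
  simpa using (hσ n).topRatio_eq_ranked (ha n) (by omega) (fun j => hw j 0)

theorem integral_limit_moments (hξ : IsPPP α ξ P') (hS : ∀ i, IsOneSidedStable α (S i) P')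
    (hSindep : iIndepFun S P') (hξS : IndepFun (fun w i => ξ i w) (fun w i => S i w) P') {k : ℕ}
    (p q : Fin k → ℕ) :
    ∫ w, (∏ i : Fin k, (ξ i w / (ξ i w + 1)) ^ p i) * ∏ i : Fin k, Real.exp (-S i w) ^ q i ∂P' =
      (∫ w, ∏ i : Fin k, (ξ i w / (ξ i w + 1)) ^ p i ∂P') *
        ∏ i, Real.exp (-Real.Gamma (1 - α) * (q i : ℝ) ^ α) := by
  have h1 : Measurable fun x : ℕ → ℝ => ∏ i : Fin k, (x i / (x i + 1)) ^ p i := by fun_prop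
  have h2 : Measurable fun s : ℕ → ℝ => ∏ i : Fin k, Real.exp (-s i) ^ q i := by fun_prop
  rw [hξS.integral_fun_comp_mul_comp (f := fun x : ℕ → ℝ => ∏ i : Fin k, (x i / (x i + 1)) ^ p i)
    (g := fun s : ℕ → ℝ => ∏ i : Fin k, Real.exp (-s i) ^ q i)
    (measurable_pi_lambda _ fun i => hξ.poisson.measurable i).aemeasurable
    (measurable_pi_lambda _ fun i => (hS i).measurable).aemeasurable
    h1.aestronglyMeasurable h2.aestronglyMeasurable]
  congr 1
  have h3 := (hSindep.precomp (Fin.val_injective (n := k))).integral_fun_prod_comp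
    (f := fun i s => Real.exp (-s) ^ q i) (fun i => (hS i).measurable.aemeasurable)
    (fun i => Measurable.aestronglyMeasurable (by fun_prop))
  refine h3.trans (Finset.prod_congr rfl fun i _ => ?_)
  rw [← (hS i).laplace (q i) (Nat.cast_nonneg _)]
  refine integral_congr_ae (ae_of_all _ fun w => ?_)
  simp only
  rw [← Real.exp_nat_mul]
  congr 1
  ring

/-- The ratios of the largest entries of the first column and the sums of the corresponding rows
are asymptotically independent. -/
theorem tendstoInDistribution_topRatio_topWeight (hα₀ : 0 < α) (hα₁ : α < 1)
    (hL : HeavyTailedLaw α c L) (hX : ∀ n, IsIIDMatrix (X n) L (P n)) (hξ : IsPPP α ξ P')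
    (hS : ∀ i, IsOneSidedStable α (S i) P') (hSindep : iIndepFun S P')
    (hξS : IndepFun (fun w i => ξ i w) (fun w i => S i w) P')
    (hσ : ∀ n, IsRankingRule (σ n)) (k : ℕ) :
    TendstoInDistribution
      (fun n w => Sum.elim (topRatio (σ n) (tailScale α c n) k fun j => X n w j 0)
        (topWeight (σ n) (tailScale α c n) k (fun j => X n w j 0) (tailRowSum (X n w)))) atTop
      (fun w => Sum.elim (fun i : Fin k => ξ i w / (ξ i w + 1))
        (fun i : Fin k => Real.exp (-S i w))) P P' := by
  have ha := fun n => tailScale_pos (α := α) hL.pos n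
  have hU := tendstoInDistribution_topRatio hα₀ hL hX hξ hσ k
  have hM := isMarkedPoisson_of_stable hξ hS hSindep hξS
  have hpos := hM.ae_pos ((hS 0).ae_map_pos hα₀ hα₁)
  have hZ : ∀ n, Measurable fun w => ((fun j => X n w j 0), fun j => tailRowSum (X n w) j) :=
    fun n => (hX n).measurable_column.prodMk
      (measurable_pi_lambda _ fun j => (hX n).measurable_tailRowSum j)
  have hR01 : ∀ n, ∀ᵐ w ∂P n, ∀ i : Fin k,
      topRatio (σ n) (tailScale α c n) k (fun j => X n w j 0) i ∈ Set.Icc (0 : ℝ) 1 := fun n => by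
    filter_upwards [(hX n).ae_nonneg hL.nonneg] with w hw i
    exact topRatio_mem_Icc (ha n) (fun j => hw j 0) i
  have hξ01 : ∀ᵐ w ∂P', ∀ i : Fin k, ξ i w / (ξ i w + 1) ∈ Set.Icc (0 : ℝ) 1 := by
    filter_upwards [hpos] with w hw i using div_add_mem_Icc (hw i).1.le zero_le_one
  refine tendstoInDistribution_of_moments (fun n => ?_) ?_ (fun n => ?_) ?_ fun p => ?_
  · refine aemeasurable_pi_lambda _ fun i => Measurable.aemeasurable ?_
    cases i with
    | inl i =>
      exact measurable_pi_iff.mp ((hσ n).measurable_topRatio.comp (hX n).measurable_column) i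
    | inr i => exact measurable_pi_iff.mp ((hσ n).measurable_topWeight.comp (hZ n)) i
  · refine aemeasurable_pi_lambda _ fun i => Measurable.aemeasurable ?_
    cases i with
    | inl i => exact (hξ.poisson.measurable i).div ((hξ.poisson.measurable i).add_const 1)
    | inr i => exact (hS i).measurable.neg.exp
  · filter_upwards [hR01 n, (hX n).ae_nonneg hL.nonneg] with w hw hw' i
    cases i with
    | inl i => exact hw i
    | inr i => exact topWeight_mem_Icc (ha n) _ (tailRowSum_nonneg hw') i
  · filter_upwards [hξ01, hpos] with w hw hw' i
    cases i with
    | inl i => exact hw i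
    | inr i => exact exp_neg_mem_Icc (hw' i).2.le
  · simp only [Fintype.prod_sum_type, Sum.elim_inl, Sum.elim_inr]
    rw [integral_limit_moments hξ hS hSindep hξS]
    -- The column factor and the Laplace factors converge separately; for `n ≥ k` their product is
    -- exactly the joint moment.
    have h1 := (hU.tendsto_moments hR01 hξ01 fun i => p (Sum.inl i)).mul
      (tendsto_finsetProd Finset.univ fun i _ =>
        hL.tendsto_laplace_pow hα₀ hα₁ (Nat.cast_nonneg (p (Sum.inr i))))
    refine h1.congr' ?_
    filter_upwards [eventually_ge_atTop k] with n hn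
    have h2 := (hσ n).integral_topRatio_mul_topWeight (k := k) (ha n) (by omega) hL.nonneg n
      (fun i => p (Sum.inl i)) (fun i => p (Sum.inr i))
    have m1 : Measurable fun x : Fin (n + 1) → ℝ =>
        ∏ i, topRatio (σ n) (tailScale α c n) k x i ^ p (Sum.inl i) :=
      Finset.measurable_fun_prod _ fun i _ => ((measurable_pi_apply i).comp
        (hσ n).measurable_topRatio).pow_const _
    have m2 : Measurable fun z : (Fin (n + 1) → ℝ) × (Fin (n + 1) → ℝ) =>
        ∏ i, topWeight (σ n) (tailScale α c n) k z.1 z.2 i ^ p (Sum.inr i) :=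
      Finset.measurable_fun_prod _ fun i _ => ((measurable_pi_apply i).comp
        (hσ n).measurable_topWeight).pow_const _
    have m3 : Measurable fun z : (Fin (n + 1) → ℝ) × (Fin (n + 1) → ℝ) =>
        (∏ i, topRatio (σ n) (tailScale α c n) k z.1 i ^ p (Sum.inl i)) *
          ∏ i, topWeight (σ n) (tailScale α c n) k z.1 z.2 i ^ p (Sum.inr i) :=
      (m1.comp measurable_fst).mul m2
    rw [← (hX n).map_column_tailRowSum, ← (hX n).map_column,
      integral_map (hZ n).aemeasurable m3.aestronglyMeasurable,
      integral_map (hX n).measurable_column.aemeasurable m1.aestronglyMeasurable] at h2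
    exact h2.symm

theorem tendstoInDistribution_firstCoords_markovMatrix (hα₀ : 0 < α) (hα₁ : α < 1)
    (hL : HeavyTailedLaw α c L) (hX : ∀ n, IsIIDMatrix (X n) L (P n)) (hξ : IsPPP α ξ P')
    (hS : ∀ i, IsOneSidedStable α (S i) P') (hSindep : iIndepFun S P')
    (hξS : IndepFun (fun w i => ξ i w) (fun w i => S i w) P')
    (hσ : ∀ n, IsRankingRule (σ n)) (k : ℕ) :
    TendstoInDistribution
      (fun n w => firstCoords k fun j =>
        markovMatrix (X n w) (σ n (fun l => X n w l 0) j) 0) atTop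
      (fun w (i : Fin k) => ξ i w / (ξ i w + S i w)) P P' := by
  have ha := fun n => tailScale_pos (α := α) hL.pos n
  have hM := isMarkedPoisson_of_stable hξ hS hSindep hξS
  have hpos := hM.ae_pos ((hS 0).ae_map_pos hα₀ hα₁)
  have hW := tendstoInDistribution_topRatio_topWeight hα₀ hα₁ hL hX hξ hS hSindep hξS hσ k
  have hopen : IsOpen {v : Fin k ⊕ Fin k → ℝ | ∀ i, v i ∈ Set.Ioo (0 : ℝ) 1} := by
    simp only [Set.ofPred_forall]
    exact isOpen_iInter_of_finite fun i => isOpen_Ioo.preimage (continuous_apply i)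
  -- The limit lies in the open cube because the points and the marks are positive; there the
  -- denominator in `combineRatio` does not vanish.
  have hC := hW.comp_of_continuousOn (measurable_combineRatio k) hopen
    (continuousOn_combineRatio k) (by
      filter_upwards [hpos] with w hw i
      cases i with
      | inl i => exact div_add_mem_Ioo (hw i).1 one_pos
      | inr i => exact ⟨Real.exp_pos _, Real.exp_lt_one_iff.mpr (neg_neg_of_pos (hw i).2)⟩)
  have hC' := hC.congr (fun n => EventuallyEq.rfl)
    (T := fun w (i : Fin k) => ξ i w / (ξ i w + S i w)) (by
      filter_upwards [hpos] with w hw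
      funext i
      have := combine_div_add (r := S i w) one_pos (hw i).1.le
      rwa [div_one] at this)
  have hb : Tendsto (fun n : ℕ => (sumLaw L n).real (Set.Iio 1)) atTop (𝓝 0) :=
    squeeze_zero (fun n => measureReal_nonneg) (fun n => by
      have h1 : (0 : ℝ) ≤ n := Nat.cast_nonneg n
      have h2 : 0 ≤ (sumLaw L n).real (Set.Iio 1) := measureReal_nonneg
      nlinarith) (hL.tendsto_mul_sumLaw_Iio hα₀)
  refine hC'.congr_of_tendsto_measure_ne (fun n => ?_) hb ?_
  · refine (measurable_firstCoords fun j => ?_).aemeasurable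
    exact measurable_apply_fin (F := fun l w => markovMatrix (X n w) l 0)
      (fun l => (hX n).measurable_markovMatrix l 0)
      (((hσ n).measurable j).comp (hX n).measurable_column)
  · filter_upwards [eventually_ge_atTop k] with n hn
    refine le_trans (ENNReal.toReal_mono (measure_ne_top _ _) (measure_mono_ae ?_))
      ((hX n).measureReal_row_eq_zero_le hL.nonneg)
    filter_upwards [(hX n).ae_nonneg hL.nonneg] with w hw hne
    by_contra h0
    refine hne ?_
    rw [combineRatio_top (ha n) (by omega) fun j => hw j 0]
    simp only [markovMatrix_column_eq h0]

end FirstEntriesLimit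


/-! ### Ranked rearrangements. -/

theorem lemma2p3 {α c : ℝ} (hα₀ : 0 < α) (hα₁ : α < 1)
    (L : Measure ℝ) [IsProbabilityMeasure L] (hL : HeavyTailedLaw α c L)
    -- for every `n`, an i.i.d. matrix of size `n + 1`
    {Ω : ℕ → Type*} [∀ n, MeasurableSpace (Ω n)]
    (P : ∀ n, Measure (Ω n)) [∀ n, IsProbabilityMeasure (P n)]
    (X : ∀ n, Ω n → Matrix (Fin (n + 1)) (Fin (n + 1)) ℝ)
    (hX : ∀ n, IsIIDMatrix (X n) L (P n))
    -- the limiting variables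
    {Ω' : Type*} [MeasurableSpace Ω'] (P' : Measure Ω') [IsProbabilityMeasure P']
    (ξ S : ℕ → Ω' → ℝ) (hξ : IsPPP α ξ P')
    (hS : ∀ i, IsOneSidedStable α (S i) P') (hSindep : iIndepFun S P')
    (hξS : IndepFun (fun w i => ξ i w) (fun w i => S i w) P') :
    -- the entries of the first column of `M`, in the order of the sizes of the `X_{j,1}`
    (∀ σ : ∀ n, (Fin (n + 1) → ℝ) → Equiv.Perm (Fin (n + 1)), (∀ n, IsRankingRule (σ n)) →
      ∀ k : ℕ, TendstoInDistribution
        (fun n w => firstCoords k fun j =>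
          markovMatrix (X n w) (σ n (fun l => X n w l 0) j) 0)
        atTop
        (fun w (i : Fin k) => ξ i w / (ξ i w + S i w)) P P') ∧
    -- the limiting sequence has a ranked rearrangement
    (∀ᵐ w ∂P', Antitone (ranked fun i => ξ i w / (ξ i w + S i w)) ∧
      ∃ τ : Equiv.Perm ℕ, ∀ k,
        ranked (fun i => ξ i w / (ξ i w + S i w)) k = ξ (τ k) w / (ξ (τ k) w + S (τ k) w)) ∧
    -- convergence of the ranked rearrangement of the first column of `M`
    (∀ k : ℕ, TendstoInDistribution
        (fun n w (i : Fin k) => ranked (fun j => markovMatrix (X n w) j 0) i)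
        atTop
        (fun w (i : Fin k) => ranked (fun j => ξ j w / (ξ j w + S j w)) i) P P') ∧
    -- identification of the limit
    IdentDistrib
      (fun w => ranked fun i => ξ i w / (ξ i w + S i w))
      (fun w i => ξ i w / (ξ i w + qConst α)) P' P' := by
  exact ⟨fun σ hσ k => tendstoInDistribution_firstCoords_markovMatrix hα₀ hα₁ hL hX hξ hS hSindep
      hξS hσ k,
    ae_exists_perm_ranked_ratio hα₀ hα₁ hξ hS hSindep hξS,
    tendstoInDistribution_ranked_markovMatrix hα₀ hα₁ hL hX hξ hS hSindep hξS,
    identDistrib_ranked_ratio hα₀ hα₁ hξ hS hSindep hξS⟩
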